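/- **Theorem.** For integers $n\ge 1$, $k\ge 2$, $w\ge 0$ let $\mathbf{S}_k(n,w^\uparrow)$ be the set of strings of length $n$ over $\{1,\dots,k\}$ whose weight (sum of symbols) is at least $w$. A *necklace* is a string that is lexicographically smallest among its rotations. The *aperiodic prefix* $\mathrm{ap}(\mathbf{s})$ of $\mathbf{s}$ is the shortest string $\mathbf{t}$ with $\mathbf{s}=\mathbf{t}^j$ for some $j\ge 1$. Let $\alpha_1,\dots,\alpha_m$ be the necklaces in $\mathbf{S}_k(n,w^\uparrow)$ in lexicographic order, and let $$\mathcal{G}_k(n,w^\uparrow)=\mathrm{ap}(\alpha_1)\,\mathrm{ap}(\alpha_2)\cdots\mathrm{ap}(\alpha_m),$$ regarded as a cyclic sequence. For $1\le r\le|\mathbf{S}_k(n,w^\uparrow)|$, the string at rank $r$ is the string $\mathbf{s}\in\mathbf{S}_k(n,w^\uparrow)$ that starts at index $r$ of $\mathcal{G}_k(n,w^\uparrow)$ (indices start at $1$ and wrap around). Then $\mathcal{G}_k(n,w^\uparrow)$ can be unranked in $O(n^4k^2\log k)$ time and $O(n^3k)$ space on a unit-cost RAM. That is, there are one RAM program and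 one constant $C$ such that, for all $n\ge 1$, $k\ge 2$, $w\ge 0$ and $1\le r\le |\mathbf{S}_k(n,w^\uparrow)|$, the program on input $(n,k,w,r)$ outputs the string at rank $r$ (which exists and lies in $\mathbf{S}_k(n,w^\uparrow)$) and halts after at most $C\,n^4k^2\log k$ steps, accessing only registers with address less than $C\,n^3k$, and with every register at all times holding a natural number at most $k^{Cn}$ (that is, $O(n\log k)$ bits). Here a RAM has registers $R[0],R[1],\dots$ holding natural numbers, initially the input followed by zeros, and a write-only output tape. Its unit-cost instructions are: load a constant, addition, truncated subtraction, multiplication, integer division, indirect load and store, jump, jump if $R[a]<R[b]$, and append a register to the output. -/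

import Mathlib

/-! ### Strings, necklaces and the bounded-weight cycle -/

namespace BoundedWeight

/-- All strings of length `n` over the alphabet `{1, ..., k}`. -/
def strings (k n : ℕ) : Finset (List ℕ) :=
  (Fintype.piFinset (fun _ : Fin n => Finset.Icc 1 k)).image List.ofFn

theorem mem_strings {k n : ℕ} {s : List ℕ} :
    s ∈ strings k n ↔ s.length = n ∧ ∀ x ∈ s, 1 ≤ x ∧ x ≤ k := by
  unfold strings
  simp only [Finset.mem_image, Fintype.mem_piFinset, Finset.mem_Icc]
  constructor
  · rintro ⟨f, hf, rfl⟩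
    refine ⟨by simp, ?_⟩
    intro x hx
    obtain ⟨i, rfl⟩ := List.mem_ofFn.1 hx
    exact hf i
  · rintro ⟨rfl, h⟩
    exact ⟨s.get, fun i => h _ (List.get_mem s i), by simp⟩

/-- The strings of length `n` over `{1, ..., k}` whose weight (sum of the symbols) is
at least `w`. -/
def heavyStrings (k n w : ℕ) : Finset (List ℕ) :=
  (strings k n).filter (fun s => w ≤ s.sum)

/-- A necklace: a string that is lexicographically smallest among its rotations.
The order on `List ℕ` is the lexicographic one. -/
def IsNecklace (s : List ℕ) : Prop := ∀ i : ℕ, s ≤ s.rotate i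

open Classical in
/-- The necklaces of length `n` over `{1, ..., k}` of weight at least `w`, listed in
lexicographic order. -/
noncomputable def necklaces (k n w : ℕ) : List (List ℕ) :=
  ((heavyStrings k n w).filter IsNecklace).sort (· ≤ ·)

/-- `s` is a power `t^j`, `j ≥ 1`, of its prefix `t` of length `p`. -/
def IsPowerOfPrefix (s : List ℕ) (p : ℕ) : Prop :=
  ∃ j : ℕ, 1 ≤ j ∧ (List.replicate j (s.take p)).flatten = s

theorem exists_isPowerOfPrefix (s : List ℕ) : ∃ p, IsPowerOfPrefix s p :=
  ⟨s.length, 1, le_rfl, by simp⟩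

open Classical in
/-- The aperiodic prefix of `s`: the shortest string `t` with `s = t^j` for some `j ≥ 1`. -/
noncomputable def aperiodicPrefix (s : List ℕ) : List ℕ :=
  s.take (Nat.find (exists_isPowerOfPrefix s))

/-- The cyclic sequence obtained by concatenating the aperiodic prefixes of the necklaces of
weight at least `w` in lexicographic order. -/
noncomputable def cycle (k n w : ℕ) : List ℕ :=
  ((necklaces k n w).map aperiodicPrefix).flatten

/-- The string `s` starts at index `r` (indices start at `1`) of the cyclic sequence `u`. -/
def HasRank (u s : List ℕ) (r : ℕ) : Prop :=
  1 ≤ r ∧ r ≤ u.length ∧ ∀ i < s.length, s[i]? = u[(r - 1 + i) % u.length]?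

end BoundedWeight

/-! ### The unit-cost random access machine -/

namespace RAM

/-- Instructions of a random access machine with registers `R[0], R[1], ...` holding natural
numbers, and a write-only output tape. Addresses `d`, `a`, `b` and jump targets `l` are
constants of the program. -/
inductive Instr where
  /-- `R[d] := c` -/
  | const (d c : ℕ)
  /-- `R[d] := R[a] + R[b]` -/
  | add (d a b : ℕ)
  /-- `R[d] := max (R[a] - R[b]) 0` -/
  | sub (d a b : ℕ)
  /-- `R[d] := R[a] * R[b]` -/
  | mul (d a b : ℕ)
  /-- `R[d] := ⌊R[a] / R[b]⌋` (`0` if `R[b] = 0`) -/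
  | div (d a b : ℕ)
  /-- `R[d] := R[R[a]]` -/
  | load (d a : ℕ)
  /-- `R[R[a]] := R[b]` -/
  | store (a b : ℕ)
  /-- go to instruction `l` -/
  | jump (l : ℕ)
  /-- if `R[a] < R[b]` go to instruction `l` -/
  | jumpLt (a b l : ℕ)
  /-- append `R[a]` to the output -/
  | write (a : ℕ)

/-- A program is a finite list of instructions, numbered from `0`. -/
abbrev Program := List Instr

/-- A configuration: program counter, register contents, output written so far. -/
structure Config where
  pc : ℕ
  mem : ℕ → ℕ
  out : List ℕ

/-- Set register `d` to `v` and proceed to the next instruction. -/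
def Config.set (c : Config) (d v : ℕ) : Config :=
  ⟨c.pc + 1, Function.update c.mem d v, c.out⟩

/-- The effect of one instruction. -/
def Instr.exec (c : Config) : Instr → Config
  | .const d v => c.set d v
  | .add d a b => c.set d (c.mem a + c.mem b)
  | .sub d a b => c.set d (c.mem a - c.mem b)
  | .mul d a b => c.set d (c.mem a * c.mem b)
  | .div d a b => c.set d (c.mem a / c.mem b)
  | .load d a => c.set d (c.mem (c.mem a))
  | .store a b => c.set (c.mem a) (c.mem b)
  | .jump l => ⟨l, c.mem, c.out⟩
  | .jumpLt a b l => ⟨if c.mem a < c.mem b then l else c.pc + 1, c.mem, c.out⟩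
  | .write a => ⟨c.pc + 1, c.mem, c.out ++ [c.mem a]⟩

/-- The addresses of the registers that an instruction reads or writes. -/
def Instr.accessed (mem : ℕ → ℕ) : Instr → List ℕ
  | .const d _ => [d]
  | .add d a b => [d, a, b]
  | .sub d a b => [d, a, b]
  | .mul d a b => [d, a, b]
  | .div d a b => [d, a, b]
  | .load d a => [d, a, mem a]
  | .store a b => [a, b, mem a]
  | .jump _ => []
  | .jumpLt a b _ => [a, b]
  | .write a => [a]

/-- The machine has halted when the program counter has left the program. -/
def Halted (P : Program) (c : Config) : Prop := P.length ≤ c.pc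

/-- One step; a halted configuration does not change. -/
def step (P : Program) (c : Config) : Config :=
  match P[c.pc]? with
  | some i => i.exec c
  | none => c

/-- The initial configuration: the input in the first registers, `0` in all others. -/
def start (input : List ℕ) : Config := ⟨0, fun a => input.getD a 0, []⟩

/-- The configuration after `t` steps. -/
def configAt (P : Program) (input : List ℕ) (t : ℕ) : Config := (step P)^[t] (start input)

/-- On the given input, `P` halts after at most `time` steps with the given output; up to then it
accesses only registers with address less than `space`, and no register ever holds
a number greater than `word`. -/
def ComputesWithin (P : Program) (input output : List ℕ) (time : ℝ) (space word : ℕ) : Prop :=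
  ∃ T : ℕ, (T : ℝ) ≤ time ∧
    Halted P (configAt P input T) ∧ (configAt P input T).out = output ∧
    (∀ t < T, ∀ i : Instr, P[(configAt P input t).pc]? = some i →
      ∀ a ∈ i.accessed (configAt P input t).mem, a < space) ∧
    (∀ t ≤ T, ∀ a : ℕ, (configAt P input t).mem a ≤ word)

end RAM

/-! ### A structured language on top of the random access machine -/

namespace Structured

/-! Read the cycle from its end. The rotation classes of heavy strings are indexed by necklaces, and
the class of α has |ap(α)| members. So the cycle has length N, the number of heavy strings, and the
number of heavy strings all of whose rotations exceed b is the length of the part of the cycle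
contributed by necklaces greater than b (`card_heavyStrings_eq`). Hence index r lies in the
aperiodic prefix of the least string a for which this number is at most N - r (`Target`,
`target_of_split`), and a can be found symbol by symbol by binary search once these numbers can be
computed.

Counting. Let b be at most its suffixes in the sense of `IsPre`. All rotations of s exceed b iff at
every cyclic position of s there starts a block b_0 ... b_{j-1} c with c > b_j. By `Blk.sub` a block
starting inside another one ends no later, so s splits cyclically into blocks in a unique way. The
block covering the first symbol can be placed in j + 1 ways, and the rest is a linear sequence of
blocks, counted by a recursion on length and required weight (`cnt_succ`, `card_aboveStrings`). The
table has about n · nk entries of cost O(nk) each, which makes O(n^3 k^2) per count. A probe a_0 ...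
a_{t-1} c k ... k satisfies `IsPre` whenever c ≥ a_t (`Target.isPre_probe`), so a probe that fails
the suffix test is simply too small. There are about n log k probes.

Reading off the string. It starts with the last i symbols of a, where i is N - r + 1 minus the
number of strings above a. Raising one symbol below k and filling up with k turns a heavy necklace
into a heavy necklace (`isNecklace_bump`), so the next necklace keeps every prefix that precedes a
symbol below k (`next_necklace`). Therefore the aperiodic prefixes from any necklace other than k^n
on spell out that necklace (`necklace_prefix_flatten`), and the string is completed by a prefix of
the next necklace. Only k^n, which is last, contributes a single k, after which the first necklace
follows (`Target.isRanked`).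

Machine. The algorithm is written in a small structured language whose compilation preserves cost
exactly (`Eval.runs`); the triples `Tri` carry correctness, time, address bound and word bound
together. -/

/-- The scalar variables of structured programs. -/
inductive Var
  | n | k | w | r | one | two | n1 | k1 | len | bb | ba
  | t | v | j | c | m | p | xa | ya | bj | acc | g | ws
  | ok | eq | h | l | q | i | lo | hi | lo1 | mid | lim | total | rem | addr | fill
  deriving DecidableEq

/-- The register that holds a variable. -/
def Var.reg (x : Var) : ℕ := x.ctorIdx

theorem Var.reg_injective : Function.Injective Var.reg := fun a b h => by
  have := congrArg Var.ofNat h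
  simpa [Var.reg, Var.ofNat_ctorIdx] using this

/-- Heap cells are the registers from `heapStart` on. -/
def heapStart : ℕ := 64

theorem Var.reg_lt (x : Var) : x.reg < heapStart := by
  cases x <;> decide

/-- Straight-line operations. -/
inductive Op
  | const (d : Var) (c : ℕ)
  | add (d a b : Var)
  | sub (d a b : Var)
  | mul (d a b : Var)
  | div (d a b : Var)
  | load (d a : Var)
  | store (a b : Var)
  | write (a : Var)

/-- Structured programs: basic blocks, composition, `if a < b`, `while a < b`. -/
inductive Stmt
  | ops (l : List Op)
  | seq (p q : Stmt)
  | ite (a b : Var) (p q : Stmt)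
  | loop (a b : Var) (p : Stmt)

/-- Scalars, heap and output. -/
structure State where
  s : Var → ℕ
  h : ℕ → ℕ
  out : List ℕ

/-- Assignment to a scalar. -/
def State.set (σ : State) (d : Var) (v : ℕ) : State :=
  ⟨Function.update σ.s d v, σ.h, σ.out⟩

/-- The effect of an operation. -/
def Op.exec (σ : State) : Op → State
  | .const d c => σ.set d c
  | .add d a b => σ.set d (σ.s a + σ.s b)
  | .sub d a b => σ.set d (σ.s a - σ.s b)
  | .mul d a b => σ.set d (σ.s a * σ.s b)
  | .div d a b => σ.set d (σ.s a / σ.s b)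
  | .load d a => σ.set d (σ.h (σ.s a))
  | .store a b => ⟨σ.s, Function.update σ.h (σ.s a) (σ.s b), σ.out⟩
  | .write a => ⟨σ.s, σ.h, σ.out ++ [σ.s a]⟩

/-- The operation respects the bound `M` on addresses and the bound `W` on values. -/
def Op.Safe (M W : ℕ) (σ : State) : Op → Prop
  | .const _ c => c ≤ W
  | .add _ a b => σ.s a + σ.s b ≤ W
  | .mul _ a b => σ.s a * σ.s b ≤ W
  | .load _ a => heapStart ≤ σ.s a ∧ σ.s a < M
  | .store a _ => heapStart ≤ σ.s a ∧ σ.s a < M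
  | _ => True

/-- The effect of a basic block. -/
def execAll : List Op → State → State
  | [], σ => σ
  | o :: l, σ => execAll l (o.exec σ)

/-- All operations of a basic block are safe. -/
def SafeAll (M W : ℕ) : List Op → State → Prop
  | [], _ => True
  | o :: l, σ => o.Safe M W σ ∧ SafeAll M W l (o.exec σ)

/-- Safe execution with its exact cost. -/
inductive Eval (M W : ℕ) : Stmt → State → ℕ → State → Prop
  | ops {l σ} : SafeAll M W l σ → Eval M W (.ops l) σ l.length (execAll l σ)
  | seq {p q σ σ' σ'' t t'} : Eval M W p σ t σ' → Eval M W q σ' t' σ'' →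
      Eval M W (.seq p q) σ (t + t') σ''
  | ite_true {a b p q σ σ' t} : σ.s a < σ.s b → Eval M W p σ t σ' →
      Eval M W (.ite a b p q) σ (1 + t) σ'
  | ite_false {a b p q σ σ' t} : ¬ σ.s a < σ.s b → Eval M W q σ t σ' →
      Eval M W (.ite a b p q) σ (1 + (t + 1)) σ'
  | loop_true {a b p σ σ' σ'' t t'} : σ.s a < σ.s b → Eval M W p σ t σ' →
      Eval M W (.loop a b p) σ' t' σ'' → Eval M W (.loop a b p) σ (1 + (t + (1 + t'))) σ''
  | loop_false {a b p σ} : ¬ σ.s a < σ.s b → Eval M W (.loop a b p) σ (1 + 1) σ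

/-! #### Compilation -/

/-- The machine instruction of an operation. -/
def Op.instr : Op → RAM.Instr
  | .const d c => .const d.reg c
  | .add d a b => .add d.reg a.reg b.reg
  | .sub d a b => .sub d.reg a.reg b.reg
  | .mul d a b => .mul d.reg a.reg b.reg
  | .div d a b => .div d.reg a.reg b.reg
  | .load d a => .load d.reg a.reg
  | .store a b => .store a.reg b.reg
  | .write a => .write a.reg

/-- The number of instructions of the compiled program. -/
def Stmt.size : Stmt → ℕ
  | .ops l => l.length
  | .seq p q => p.size + q.size
  | .ite _ _ p q => q.size + p.size + 2
  | .loop _ _ p => p.size + 3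

/-- The machine code of a structured program, to be placed at position `o`. -/
def Stmt.code : Stmt → ℕ → RAM.Program
  | .ops l, _ => l.map Op.instr
  | .seq p q, o => p.code o ++ q.code (o + p.size)
  | .ite a b p q, o =>
      .jumpLt a.reg b.reg (o + q.size + 2) :: (q.code (o + 1) ++
        .jump (o + q.size + p.size + 2) :: p.code (o + q.size + 2))
  | .loop a b p, o =>
      .jumpLt a.reg b.reg (o + 2) :: .jump (o + p.size + 3) :: (p.code (o + 2) ++ [.jump o])

theorem Stmt.length_code (p : Stmt) (o : ℕ) : (p.code o).length = p.size := by
  induction p generalizing o with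
  | ops l => simp [code, size]
  | seq p q hp hq => simp [code, size, hp, hq]
  | ite a b p q hp hq => simp [code, size, hp, hq]; omega
  | loop a b p hp => simp [code, size, hp]

/-- `l` occurs in `P` at position `o`. -/
def CodeAt (P l : RAM.Program) (o : ℕ) : Prop := ∀ i < l.length, P[o + i]? = l[i]?

theorem CodeAt.left {P l l' : RAM.Program} {o : ℕ} (h : CodeAt P (l ++ l') o) :
    CodeAt P l o := fun i hi => by
  rw [h i (by simp; omega), List.getElem?_append_left hi]

theorem CodeAt.right {P l l' : RAM.Program} {o : ℕ} (h : CodeAt P (l ++ l') o) :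
    CodeAt P l' (o + l.length) := fun i hi => by
  rw [add_assoc, h (l.length + i) (by simp; omega), List.getElem?_append_right (by omega)]
  simp

theorem CodeAt.head {P l : RAM.Program} {a : RAM.Instr} {o : ℕ} (h : CodeAt P (a :: l) o) :
    P[o]? = some a := by simpa using h 0 (by simp)

theorem CodeAt.tail {P l : RAM.Program} {a : RAM.Instr} {o : ℕ} (h : CodeAt P (a :: l) o) :
    CodeAt P l (o + 1) := fun i hi => by
  have := h (i + 1) (by simpa using hi)
  rw [add_right_comm o 1 i]; simpa [add_assoc] using this

/-- `T` machine steps lead from `c` to `c'` within the bounds `M` and `W`. -/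
structure Runs (M W : ℕ) (P : RAM.Program) (c : RAM.Config) (T : ℕ) (c' : RAM.Config) :
    Prop where
  result : (RAM.step P)^[T] c = c'
  access : ∀ t < T, ∀ i : RAM.Instr, P[((RAM.step P)^[t] c).pc]? = some i →
    ∀ a ∈ i.accessed ((RAM.step P)^[t] c).mem, a < M
  bounded : ∀ t ≤ T, ∀ a, ((RAM.step P)^[t] c).mem a ≤ W

theorem Runs.refl {M W : ℕ} {P : RAM.Program} {c : RAM.Config} (h : ∀ a, c.mem a ≤ W) :
    Runs M W P c 0 c :=
  ⟨rfl, fun t ht => absurd ht (by omega), fun t ht => by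
    obtain rfl : t = 0 := by omega
    exact h⟩

theorem Runs.trans {M W : ℕ} {P : RAM.Program} {c c' c'' : RAM.Config} {T T' : ℕ}
    (h : Runs M W P c T c') (h' : Runs M W P c' T' c'') : Runs M W P c (T + T') c'' := by
  have key : ∀ t, T ≤ t → (RAM.step P)^[t] c = (RAM.step P)^[t - T] c' := fun t ht => by
    conv_lhs => rw [← Nat.sub_add_cancel ht, Function.iterate_add_apply, h.result]
  refine ⟨?_, fun t ht => ?_, fun t ht => ?_⟩
  · rw [key _ (by omega), Nat.add_sub_cancel_left, h'.result]
  · rcases lt_or_ge t T with h1 | h1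
    · exact h.access t h1
    · rw [key t h1]; exact h'.access _ (by omega)
  · rcases lt_or_ge t T with h1 | h1
    · exact h.bounded t h1.le
    · rw [key t h1]; exact h'.bounded _ (by omega)

theorem Runs.single {M W : ℕ} {P : RAM.Program} {c c' : RAM.Config} {i : RAM.Instr}
    (hi : P[c.pc]? = some i) (hc : i.exec c = c') (ha : ∀ a ∈ i.accessed c.mem, a < M)
    (hb : ∀ a, c.mem a ≤ W) (hb' : ∀ a, c'.mem a ≤ W) : Runs M W P c 1 c' := by
  have hs : RAM.step P c = c' := by simp [RAM.step, hi, hc]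
  refine ⟨by simpa using hs, fun t ht => ?_, fun t ht => ?_⟩
  · obtain rfl : t = 0 := by omega
    intro j hj
    obtain rfl : i = j := by simpa [hi] using hj
    exact ha
  · obtain rfl | rfl : t = 0 ∨ t = 1 := by omega
    · exact hb
    · simpa [hs] using hb'

/-- The machine configuration `c` holds the state `σ`, with all registers bounded by `W`. -/
structure Rep (W : ℕ) (σ : State) (c : RAM.Config) : Prop where
  scalar : ∀ x : Var, c.mem x.reg = σ.s x
  heap : ∀ a, heapStart ≤ a → c.mem a = σ.h a
  out : c.out = σ.out
  bounded : ∀ a, c.mem a ≤ W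

theorem Rep.set {W : ℕ} {σ : State} {c : RAM.Config} (h : Rep W σ c) {d : Var} {v : ℕ}
    (hv : v ≤ W) : Rep W (σ.set d v) (c.set d.reg v) := by
  refine ⟨fun x => ?_, fun a ha => ?_, h.out, fun a => ?_⟩
  · by_cases hx : x = d
    · subst hx; simp [State.set, RAM.Config.set]
    · have : x.reg ≠ d.reg := fun e => hx (Var.reg_injective e)
      simp [State.set, RAM.Config.set, hx, this, h.scalar]
  · have : a ≠ d.reg := by have := d.reg_lt; omega
    simp [State.set, RAM.Config.set, this, h.heap a ha]
  · by_cases ha : a = d.reg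
    · subst ha; simpa [RAM.Config.set] using hv
    · simpa [RAM.Config.set, ha] using h.bounded a

theorem Rep.jump {W : ℕ} {σ : State} {c : RAM.Config} (h : Rep W σ c) (l : ℕ) :
    Rep W σ ⟨l, c.mem, c.out⟩ := ⟨h.scalar, h.heap, h.out, h.bounded⟩

/-- Scalars live below `heapStart` and safe heap accesses at or above it, so neither can clobber the
other. Subtraction and division do not exceed their first operand and loads and stores copy existing
values; thus only constants, sums and products need a word bound in `Op.Safe`. -/
theorem Op.instr_spec {M W : ℕ} (hM : heapStart ≤ M) {o : Op} {σ : State} {c : RAM.Config}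
    (h : Rep W σ c) (hs : o.Safe M W σ) :
    Rep W (o.exec σ) (o.instr.exec c) ∧ (o.instr.exec c).pc = c.pc + 1 ∧
      ∀ a ∈ o.instr.accessed c.mem, a < M := by
  have hr : ∀ x : Var, x.reg < M := fun x => x.reg_lt.trans_le hM
  have hb : ∀ x, σ.s x ≤ W := fun x => h.scalar x ▸ h.bounded _
  cases o with
  | const d v => exact ⟨h.set hs, rfl, by simp [instr, RAM.Instr.accessed, hr]⟩
  | add d a b =>
    refine ⟨?_, rfl, by simp [instr, RAM.Instr.accessed, hr]⟩
    simp only [exec, instr, RAM.Instr.exec, h.scalar]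
    exact h.set hs
  | sub d a b =>
    refine ⟨?_, rfl, by simp [instr, RAM.Instr.accessed, hr]⟩
    simp only [exec, instr, RAM.Instr.exec, h.scalar]
    exact h.set ((Nat.sub_le _ _).trans (hb a))
  | mul d a b =>
    refine ⟨?_, rfl, by simp [instr, RAM.Instr.accessed, hr]⟩
    simp only [exec, instr, RAM.Instr.exec, h.scalar]
    exact h.set hs
  | div d a b =>
    refine ⟨?_, rfl, by simp [instr, RAM.Instr.accessed, hr]⟩
    simp only [exec, instr, RAM.Instr.exec, h.scalar]
    exact h.set ((Nat.div_le_self _ _).trans (hb a))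
  | load d a =>
    refine ⟨?_, rfl, by simp [instr, RAM.Instr.accessed, hr, h.scalar, hs.2]⟩
    simp only [exec, instr, RAM.Instr.exec, h.scalar, h.heap _ hs.1]
    exact h.set (h.heap _ hs.1 ▸ h.bounded _)
  | store a b =>
    refine ⟨?_, rfl, by simp [instr, RAM.Instr.accessed, hr, h.scalar, hs.2]⟩
    simp only [exec, instr, RAM.Instr.exec, h.scalar]
    refine ⟨fun x => ?_, fun y hy => ?_, h.out, fun y => ?_⟩
    · have : x.reg ≠ σ.s a := by have := x.reg_lt; have := hs.1; omega
      simp [RAM.Config.set, this, h.scalar]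
    · by_cases hya : y = σ.s a
      · subst hya; simp [RAM.Config.set]
      · simp [RAM.Config.set, hya, h.heap y hy]
    · by_cases hya : y = σ.s a
      · subst hya; simpa [RAM.Config.set] using hb b
      · simpa [RAM.Config.set, hya] using h.bounded y
  | write a =>
    refine ⟨⟨h.scalar, h.heap, ?_, h.bounded⟩, rfl, by simp [instr, RAM.Instr.accessed, hr]⟩
    simp [exec, instr, RAM.Instr.exec, h.scalar, h.out]

theorem runs_ops {M W : ℕ} (hM : heapStart ≤ M) {P : RAM.Program} (l : List Op) {σ : State}
    {c : RAM.Config} (h : Rep W σ c) (hs : SafeAll M W l σ)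
    (hP : CodeAt P (l.map Op.instr) c.pc) :
    ∃ c', Runs M W P c l.length c' ∧ c'.pc = c.pc + l.length ∧ Rep W (execAll l σ) c' := by
  induction l generalizing σ c with
  | nil => exact ⟨c, Runs.refl h.bounded, rfl, h⟩
  | cons o l ih =>
    obtain ⟨h1, h2, h3⟩ := Op.instr_spec hM h hs.1
    obtain ⟨c', r, e, h'⟩ := ih h1 hs.2 (by rw [h2]; exact CodeAt.tail hP)
    refine ⟨c', ?_, by rw [e, h2, List.length_cons]; omega, h'⟩
    have r1 : Runs M W P c 1 (o.instr.exec c) :=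
      Runs.single (CodeAt.head hP) rfl h3 h.bounded h1.bounded
    rw [List.length_cons, add_comm]
    exact r1.trans r

theorem runs_jump {M W : ℕ} {P : RAM.Program} {σ : State} {c : RAM.Config} {l : ℕ}
    (h : Rep W σ c) (hP : P[c.pc]? = some (.jump l)) :
    Runs M W P c 1 ⟨l, c.mem, c.out⟩ :=
  Runs.single hP rfl (by simp [RAM.Instr.accessed]) h.bounded h.bounded

theorem runs_jumpLt {M W : ℕ} (hM : heapStart ≤ M) {P : RAM.Program} {σ : State}
    {c : RAM.Config} {a b : Var} {l : ℕ}
    (h : Rep W σ c) (hP : P[c.pc]? = some (.jumpLt a.reg b.reg l)) :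
    Runs M W P c 1 ⟨if σ.s a < σ.s b then l else c.pc + 1, c.mem, c.out⟩ :=
  Runs.single hP (by simp [RAM.Instr.exec, h.scalar])
    (by simp [RAM.Instr.accessed, a.reg_lt.trans_le hM, b.reg_lt.trans_le hM])
    h.bounded h.bounded

/-- Induction is on the evaluation, not on the program, since a loop reappears unchanged as its own
continuation. The program counter stays general, so that the code may sit anywhere in `P`. -/
theorem Eval.runs {M W : ℕ} (hM : heapStart ≤ M) {P : RAM.Program} {p : Stmt} {σ σ' : State}
    {t : ℕ} (h : Eval M W p σ t σ') : ∀ {c : RAM.Config}, Rep W σ c → CodeAt P (p.code c.pc) c.pc →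
    ∃ c', Runs M W P c t c' ∧ c'.pc = c.pc + p.size ∧ Rep W σ' c' := by
  induction h with
  | ops hs => exact fun hc hP => runs_ops hM _ hc hs hP
  | @seq p q _ _ _ _ _ _ _ ih1 ih2 =>
    intro c hc hP
    obtain ⟨c1, r1, e1, h1⟩ := ih1 hc hP.left
    have hP2 := hP.right
    rw [Stmt.length_code, ← e1] at hP2
    obtain ⟨c2, r2, e2, h2⟩ := ih2 h1 hP2
    exact ⟨c2, r1.trans r2, by rw [e2, e1, Stmt.size, add_assoc], h2⟩
  | @ite_true a b p q _ _ _ hlt _ ih =>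
    intro c hc hP
    have r0 := runs_jumpLt hM hc hP.head
    rw [if_pos hlt] at r0
    have hP1 := hP.tail.right.tail
    rw [Stmt.length_code] at hP1
    have e : c.pc + 1 + q.size + 1 = c.pc + q.size + 2 := by omega
    rw [e] at hP1
    obtain ⟨c1, r1, e1, h1⟩ := ih (hc.jump (c.pc + q.size + 2)) hP1
    exact ⟨c1, r0.trans r1, by rw [e1, Stmt.size]; dsimp only; omega, h1⟩
  | @ite_false a b p q _ _ _ hlt _ ih =>
    intro c hc hP
    have r0 := runs_jumpLt hM hc hP.head
    rw [if_neg hlt] at r0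
    obtain ⟨c1, r1, e1, h1⟩ := ih (hc.jump (c.pc + 1)) hP.tail.left
    have hP1 := hP.tail.right.head
    rw [Stmt.length_code] at hP1
    have r2 := runs_jump (M := M) h1 (by rw [e1]; exact hP1)
    exact ⟨_, r0.trans (r1.trans r2), by simp only [Stmt.size]; omega, h1.jump _⟩
  | @loop_true a b p _ _ _ _ _ hlt _ _ ih1 ih2 =>
    intro c hc hP
    have r0 := runs_jumpLt hM hc hP.head
    rw [if_pos hlt] at r0
    obtain ⟨c1, r1, e1, h1⟩ := ih1 (hc.jump (c.pc + 2)) hP.tail.tail.left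
    have hP1 := hP.tail.tail.right.head
    rw [Stmt.length_code] at hP1
    have r2 := runs_jump (M := M) h1 (by rw [e1]; exact hP1)
    -- The jump back restores the program counter, so the same code hypothesis serves the remaining
    -- iterations.
    obtain ⟨c2, r3, e2, h2⟩ := ih2 (h1.jump c.pc) hP
    exact ⟨c2, r0.trans (r1.trans (r2.trans r3)), e2, h2⟩
  | loop_false hlt =>
    intro c hc hP
    have r0 := runs_jumpLt hM hc hP.head
    rw [if_neg hlt] at r0
    have r1 := runs_jump (M := M) (hc.jump (c.pc + 1)) hP.tail.head
    exact ⟨_, r0.trans r1, by simp only [Stmt.size]; omega, hc.jump _⟩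

/-- The state in which a program is started on four inputs. -/
def initialState (n k w r : ℕ) : State where
  s x := match x with
    | .n => n
    | .k => k
    | .w => w
    | .r => r
    | _ => 0
  h _ := 0
  out := []

/-- This depends on the order of the constructors of `Var`: the first four are the inputs. -/
theorem rep_start {W n k w r : ℕ} (hn : n ≤ W) (hk : k ≤ W) (hw : w ≤ W) (hr : r ≤ W) :
    Rep W (initialState n k w r) (RAM.start [n, k, w, r]) := by
  refine ⟨fun x => ?_, fun a ha => ?_, rfl, fun a => ?_⟩
  · cases x <;> rfl
  · have : 4 ≤ a := le_trans (by decide) ha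
    simp [RAM.start, initialState, this]
  · match a with
    | 0 => exact hn
    | 1 => exact hk
    | 2 => exact hw
    | 3 => exact hr
    | a + 4 => simp [RAM.start]

theorem Eval.computesWithin {M W n k w r : ℕ} (hM : heapStart ≤ M) {p : Stmt} {σ : State} {t : ℕ}
    (h : Eval M W p (initialState n k w r) t σ)
    (hn : n ≤ W) (hk : k ≤ W) (hw : w ≤ W) (hr : r ≤ W) {time : ℝ} (ht : (t : ℝ) ≤ time) :
    RAM.ComputesWithin (p.code 0) [n, k, w, r] σ.out time M W := by
  obtain ⟨c, hrun, hpc, hrep⟩ := h.runs (P := p.code 0) hM (rep_start hn hk hw hr)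
    (by intro i _; simp [RAM.start])
  refine ⟨t, ht, ?_, ?_, hrun.access, hrun.bounded⟩
  · rw [RAM.Halted, RAM.configAt, hrun.result, hpc, Stmt.length_code]; exact Nat.le_add_left _ _
  · rw [RAM.configAt, hrun.result, hrep.out]

/-! #### Program logic -/

/-- `x` is assigned somewhere in the program. -/
def Op.assigns (x : Var) : Op → Bool
  | .const d _ | .add d _ _ | .sub d _ _ | .mul d _ _ | .div d _ _ | .load d _ => d = x
  | _ => false

/-- The operation changes the heap. -/
def Op.stores : Op → Bool
  | .store _ _ => true
  | _ => false

/-- The operation produces output. -/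
def Op.writes : Op → Bool
  | .write _ => true
  | _ => false

/-- Some operation of the program satisfies `f`. -/
def Stmt.some (f : Op → Bool) : Stmt → Bool
  | .ops l => l.any f
  | .seq p q => p.some f || q.some f
  | .ite _ _ p q => p.some f || q.some f
  | .loop _ _ p => p.some f

/-- What a run of `p` cannot change is the same in `σ` and `σ'`. -/
structure Frame (p : Stmt) (σ σ' : State) : Prop where
  scalar : ∀ x, p.some (Op.assigns x) = false → σ'.s x = σ.s x
  heap : p.some Op.stores = false → σ'.h = σ.h
  out : p.some Op.writes = false → σ'.out = σ.out

theorem Frame.refl (p : Stmt) (σ : State) : Frame p σ σ :=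
  ⟨fun _ _ => rfl, fun _ => rfl, fun _ => rfl⟩

theorem Frame.trans {p : Stmt} {σ σ' σ'' : State} (h : Frame p σ σ') (h' : Frame p σ' σ'') :
    Frame p σ σ'' :=
  ⟨fun x hx => (h'.scalar x hx).trans (h.scalar x hx), fun hp => (h'.heap hp).trans (h.heap hp),
    fun hp => (h'.out hp).trans (h.out hp)⟩

theorem Frame.mono {p q : Stmt} {σ σ' : State} (h : Frame p σ σ')
    (hq : ∀ f, q.some f = false → p.some f = false) : Frame q σ σ' :=
  ⟨fun x hx => h.scalar x (hq _ hx), fun hp => h.heap (hq _ hp), fun hp => h.out (hq _ hp)⟩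

theorem frame_op (o : Op) (σ : State) : Frame (.ops [o]) σ (o.exec σ) := by
  refine ⟨fun x hx => ?_, fun hp => ?_, fun hp => ?_⟩
  · cases o <;> simp only [Stmt.some, Op.assigns, List.any_cons, List.any_nil, Bool.or_false,
      decide_eq_false_iff_not] at hx <;>
      first
        | rfl
        | exact Function.update_of_ne (Ne.symm hx) _ _
  · cases o <;> simp [Stmt.some, Op.stores] at hp <;> rfl
  · cases o <;> simp [Stmt.some, Op.writes] at hp <;> rfl

theorem frame_execAll (l : List Op) (σ : State) : Frame (.ops l) σ (execAll l σ) := by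
  induction l generalizing σ with
  | nil => exact Frame.refl _ _
  | cons o l ih =>
    refine Frame.trans ((frame_op o σ).mono ?_) ((ih _).mono ?_) <;>
      intro f hf <;> simp [Stmt.some] at hf ⊢ <;> tauto

/-- The side conditions in `Frame` are Boolean computations on the syntax, so later proofs discharge
"this loop leaves that variable alone" by `rfl`. -/
theorem Eval.frame {M W : ℕ} {p : Stmt} {σ σ' : State} {t : ℕ} (h : Eval M W p σ t σ') :
    Frame p σ σ' := by
  induction h with
  | ops _ => exact frame_execAll _ _
  | seq _ _ h1 h2 =>
    refine (h1.mono ?_).trans (h2.mono ?_) <;> intro f hf <;> simp [Stmt.some] at hf <;> tauto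
  | ite_true _ _ h1 => refine h1.mono ?_; intro f hf; simp [Stmt.some] at hf; tauto
  | ite_false _ _ h1 => refine h1.mono ?_; intro f hf; simp [Stmt.some] at hf; tauto
  | loop_true _ _ _ h1 h2 => exact Frame.trans (h1.mono fun f hf => hf) h2
  | loop_false _ => exact Frame.refl _ _

/-- From `σ`, the program `p` terminates safely within `T` steps in a state satisfying `Q`. -/
def Tri (M W : ℕ) (p : Stmt) (σ : State) (T : ℕ) (Q : State → Prop) : Prop :=
  ∃ t ≤ T, ∃ σ', Eval M W p σ t σ' ∧ Q σ'

section

variable {M W : ℕ} {p q : Stmt} {σ : State} {T T' : ℕ} {Q Q' : State → Prop}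

theorem Tri.mono (h : Tri M W p σ T Q) (hT : T ≤ T')
    (hQ : ∀ σ', Frame p σ σ' → Q σ' → Q' σ') : Tri M W p σ T' Q' := by
  obtain ⟨t, ht, σ', he, hq⟩ := h
  exact ⟨t, ht.trans hT, σ', he, hQ _ he.frame hq⟩

theorem Tri.time (h : Tri M W p σ T Q) (hT : T ≤ T') : Tri M W p σ T' Q :=
  h.mono hT fun _ _ h => h

theorem Tri.ops {l : List Op} (hs : SafeAll M W l σ) (hq : Q (execAll l σ)) :
    Tri M W (.ops l) σ l.length Q := ⟨_, le_rfl, _, .ops hs, hq⟩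

/-- The second part receives the frame of the first, so postconditions need to mention only what has
changed. -/
theorem Tri.seq (h : Tri M W p σ T Q')
    (h' : ∀ σ', Frame p σ σ' → Q' σ' → Tri M W q σ' T' Q) :
    Tri M W (.seq p q) σ (T + T') Q := by
  obtain ⟨t, ht, σ', he, hq⟩ := h
  obtain ⟨t', ht', σ'', he', hq'⟩ := h' σ' he.frame hq
  exact ⟨_, add_le_add ht ht', σ'', he.seq he', hq'⟩

theorem Tri.ops_seq {l : List Op} (hs : SafeAll M W l σ) (h : Tri M W q (execAll l σ) T Q) :
    Tri M W (.seq (.ops l) q) σ (l.length + T) Q :=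
  (Tri.ops (Q := fun σ' => σ' = execAll l σ) hs rfl).seq fun _ _ e => e ▸ h

theorem Tri.ite {a b : Var} (h1 : σ.s a < σ.s b → Tri M W p σ T Q)
    (h2 : ¬ σ.s a < σ.s b → Tri M W q σ T Q) : Tri M W (.ite a b p q) σ (T + 2) Q := by
  by_cases h : σ.s a < σ.s b
  · obtain ⟨t, ht, σ', he, hq⟩ := h1 h
    exact ⟨_, by omega, σ', .ite_true h he, hq⟩
  · obtain ⟨t, ht, σ', he, hq⟩ := h2 h
    exact ⟨_, by omega, σ', .ite_false h he, hq⟩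

/-- Total correctness of a loop whose invariant is indexed by a bound `N` on the number of
remaining iterations. -/
theorem Tri.loop_variant {a b : Var} (I : ℕ → State → Prop) {N : ℕ} (h0 : I N σ)
    (hstep : ∀ m σ', Frame p σ σ' → I m σ' → σ'.s a < σ'.s b →
      ∃ m' < m, Tri M W p σ' T (I m'))
    (hend : ∀ m σ', Frame p σ σ' → I m σ' → ¬ σ'.s a < σ'.s b → Q σ') :
    Tri M W (.loop a b p) σ (N * (T + 2) + 2) Q := by
  have key : ∀ m σ', m ≤ N → Frame p σ σ' → I m σ' →
      Tri M W (.loop a b p) σ' (m * (T + 2) + 2) Q := by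
    intro m
    induction m using Nat.strong_induction_on with
    | _ m ih =>
      intro σ' hm hf hI
      by_cases h : σ'.s a < σ'.s b
      · obtain ⟨m', hm', t, ht, σ'', he, hI'⟩ := hstep m σ' hf hI h
        obtain ⟨t', ht', σ''', he', hq⟩ := ih m' hm' σ'' (by omega) (hf.trans he.frame) hI'
        refine ⟨_, ?_, σ''', .loop_true h he he', hq⟩
        -- An iteration costs its body, one test and one jump back; the failed test and the jump out
        -- make up the final 2.
        have : (m' + 1) * (T + 2) ≤ m * (T + 2) := Nat.mul_le_mul_right _ hm'
        rw [Nat.succ_mul] at this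
        omega
      · exact ⟨_, by omega, σ', .loop_false h, hend m σ' hf hI h⟩
  exact key N σ le_rfl (Frame.refl _ _) h0

/-- Total correctness of a loop that performs exactly `N` iterations. -/
theorem Tri.loop_count {a b : Var} (I : ℕ → State → Prop) {N : ℕ} (h0 : I 0 σ)
    (hguard : ∀ i σ', Frame p σ σ' → I i σ' → i ≤ N → (σ'.s a < σ'.s b ↔ i < N))
    (hstep : ∀ i σ', Frame p σ σ' → I i σ' → i < N → Tri M W p σ' T (I (i + 1)))
    (hend : ∀ σ', Frame p σ σ' → I N σ' → Q σ') :
    Tri M W (.loop a b p) σ (N * (T + 2) + 2) Q := by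
  refine Tri.loop_variant (fun m σ' => m ≤ N ∧ I (N - m) σ') (N := N) ⟨le_rfl, by simpa⟩ ?_ ?_
  · rintro m σ' hf ⟨hm, hI⟩ h
    have := (hguard _ σ' hf hI (by omega)).1 h
    refine ⟨m - 1, by omega, (hstep _ σ' hf hI this).mono le_rfl fun σ'' _ h => ⟨by omega, ?_⟩⟩
    rwa [show N - (m - 1) = N - m + 1 by omega]
  · rintro m σ' hf ⟨hm, hI⟩ h
    have := mt (hguard _ σ' hf hI (by omega)).2 h
    obtain rfl : m = 0 := by omega
    exact hend σ' hf hI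

end

end Structured

/-! ### Counting strings all of whose rotations exceed a given string -/

namespace BoundedWeight

/-- Every suffix of `b 0, ..., b (n - 1)` is at least the prefix of the same length. -/
def IsPre (b : ℕ → ℕ) (n : ℕ) : Prop :=
  ∀ h l, h + l < n → (∀ i < l, b (h + i) = b i) → b l ≤ b (h + l)

/-- The word `x` contains at position `p` the block `b 0, ..., b (j - 1), c` with `b j < c`. -/
def Blk (b x : ℕ → ℕ) (p j : ℕ) : Prop := (∀ i < j, x (p + i) = b i) ∧ b j < x (p + j)

/-- The length j marks the first place where x departs from b. -/
theorem Blk.unique {b x : ℕ → ℕ} {p j j' : ℕ} (h : Blk b x p j) (h' : Blk b x p j') : j = j' := by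
  rcases lt_trichotomy j j' with hj | hj | hj
  · have := h'.1 j hj; have := h.2; omega
  · exact hj
  · have := h.1 j' hj; have := h'.2; omega

/-- From offset d on, the block reads b_d ... b_{j-1} followed by a symbol above b_j. Compared with
b from its beginning, the first difference is upward by `IsPre`; without a difference, the last
symbol exceeds b_j ≥ b_{j-d}. Either way a block starts at offset d and ends no later than the given
one. -/
theorem Blk.sub {b x : ℕ → ℕ} {n p j d : ℕ} (hb : IsPre b n) (hj : j < n) (h : Blk b x p j)
    (hd : d ≤ j) : ∃ j', d + j' ≤ j ∧ Blk b x (p + d) j' := by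
  classical
  by_cases hex : ∃ i, i < j - d ∧ x (p + d + i) ≠ b i
  · obtain ⟨hi, hne⟩ := Nat.find_spec hex
    have hmin : ∀ i < Nat.find hex, x (p + d + i) = b i := fun i hlt => by
      have := Nat.find_min hex hlt
      by_contra hc
      exact this ⟨by omega, hc⟩
    refine ⟨Nat.find hex, by omega, hmin, ?_⟩
    have hx : ∀ i < j - d, x (p + d + i) = b (d + i) := fun i hlt => by
      rw [add_assoc]; exact h.1 _ (by omega)
    have := hb d (Nat.find hex) (by omega) fun i hlt => by
      rw [← hx i (by omega)]; exact hmin i hlt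
    rw [← hx _ hi] at this
    exact lt_of_le_of_ne this (Ne.symm hne)
  · push Not at hex
    refine ⟨j - d, by omega, hex, ?_⟩
    have := hb d (j - d) (by omega) fun i hlt => by
      rw [← hex i hlt, add_assoc]; exact (h.1 _ (by omega)).symm
    rw [show d + (j - d) = j by omega] at this
    rw [show p + d + (j - d) = p + j by omega]
    exact this.trans_lt h.2

/-- The string `b 0, ..., b (j - 1)`. -/
def pre (b : ℕ → ℕ) (j : ℕ) : List ℕ := (List.range j).map b

@[simp] theorem length_pre (b : ℕ → ℕ) (j : ℕ) : (pre b j).length = j := by simp [pre]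

@[simp] theorem getElem_pre (b : ℕ → ℕ) (j i : ℕ) (h : i < (pre b j).length) :
    (pre b j)[i] = b i := by simp [pre]

theorem sum_pre (b : ℕ → ℕ) (j : ℕ) : (pre b j).sum = ∑ i ∈ Finset.range j, b i := by
  rw [pre, Finset.sum_range]
  simp [← List.sum_ofFn, List.ofFn_eq_map, ← List.map_coe_finRange_eq_range, Function.comp_def]

theorem pre_congr {b b' : ℕ → ℕ} {j : ℕ} (h : ∀ i < j, b i = b' i) : pre b j = pre b' j :=
  List.map_congr_left fun i hi => h i (by simpa using hi)

theorem pre_getD (s : List ℕ) : pre (fun i => s.getD i 0) s.length = s :=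
  List.ext_getElem (by simp) fun i h h' => by simp [h']

/-- The factor of length `l` of the word `x` at position `p`. -/
def seg (x : ℕ → ℕ) (p l : ℕ) : List ℕ := pre (fun i => x (p + i)) l

@[simp] theorem length_seg (x : ℕ → ℕ) (p l : ℕ) : (seg x p l).length = l := by simp [seg]

@[simp] theorem getElem_seg (x : ℕ → ℕ) (p l i : ℕ) (h : i < (seg x p l).length) :
    (seg x p l)[i] = x (p + i) := by simp [seg]

theorem seg_add (x : ℕ → ℕ) (p l l' : ℕ) :
    seg x p (l + l') = seg x p l ++ seg x (p + l) l' := by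
  refine List.ext_getElem (by simp) fun i h h' => ?_
  rw [List.getElem_append]
  split
  · simp
  · rename_i hi
    simp only [length_seg, not_lt] at hi
    simp only [getElem_seg, length_seg]
    congr 1; omega

/-- The periodic word `s s s ...`. -/
def per (s : List ℕ) (i : ℕ) : ℕ := s.getD (i % s.length) 0

theorem per_add_length (s : List ℕ) (i : ℕ) : per s (i + s.length) = per s i := by simp [per]

theorem rotate_eq_seg (s : List ℕ) (p : ℕ) : s.rotate p = seg (per s) p s.length := by
  refine List.ext_getElem (by simp) fun i h h' => ?_
  simp only [length_seg] at h'
  have := Nat.mod_lt (p + i) (by omega : 0 < s.length)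
  simp [List.getElem_rotate, per, add_comm i p, this]

theorem blk_per_add_length {b : ℕ → ℕ} {s : List ℕ} {p j : ℕ} :
    Blk b (per s) (p + s.length) j ↔ Blk b (per s) p j := by
  simp only [Blk, add_right_comm p s.length, per_add_length]

/-- Translates the order into blocks: for equal lengths a proper prefix is impossible, so being
larger means a first difference upward. -/
theorem pre_lt_seg {b x : ℕ → ℕ} {p n : ℕ} :
    pre b n < seg x p n ↔ ∃ j < n, Blk b x p j := by
  rw [List.lt_iff_exists]
  constructor
  · rintro (⟨-, h⟩ | ⟨i, h1, h2, h3, h4⟩)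
    · simp at h
    · simp only [getElem_pre, getElem_seg, length_pre] at h1 h3 h4
      exact ⟨i, h1, fun l hl => (h3 l hl).symm, h4⟩
  · rintro ⟨j, hj, h1, h2⟩
    refine Or.inr ⟨j, by simpa, by simpa, fun l hl => ?_, ?_⟩
    · simpa using (h1 l hl).symm
    · simpa using h2

/-! ### Block sequences and their recursive count. -/

/-- Concatenations of blocks. -/
inductive IsBlocks (b : ℕ → ℕ) : List ℕ → Prop
  | nil : IsBlocks b []
  | cons (j c : ℕ) (u : List ℕ) : b j < c → IsBlocks b u → IsBlocks b (pre b j ++ c :: u)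

theorem Blk.seg_eq {b x : ℕ → ℕ} {p j l : ℕ} (h : Blk b x p j) (hl : j < l) :
    seg x p l = pre b j ++ x (p + j) :: seg x (p + j + 1) (l - 1 - j) := by
  obtain ⟨m, rfl⟩ : ∃ m, l = j + 1 + m := ⟨l - 1 - j, by omega⟩
  rw [seg_add, seg_add x p j 1, show j + 1 + m - 1 - j = m by omega]
  have : seg x p j = pre b j := pre_congr h.1
  rw [this]
  simp [seg, pre, add_assoc]

/-- Greedy parsing: cut off the block at the first position and continue behind it. -/
theorem isBlocks_seg {b x : ℕ → ℕ} {p l : ℕ}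
    (h : ∀ i < l, ∃ j, i + j < l ∧ Blk b x (p + i) j) : IsBlocks b (seg x p l) := by
  induction l using Nat.strong_induction_on generalizing p with
  | _ l ih =>
    rcases Nat.eq_zero_or_pos l with rfl | hl
    · simpa [seg, pre] using IsBlocks.nil
    · obtain ⟨j, hj, hB⟩ := h 0 hl
      rw [zero_add] at hj
      rw [add_zero] at hB
      rw [hB.seg_eq hj]
      refine IsBlocks.cons j _ _ hB.2 (ih _ (by omega) fun i hi => ?_)
      obtain ⟨j', hj', hB'⟩ := h (j + 1 + i) (by omega)
      exact ⟨j', by omega, by rwa [show p + j + 1 + i = p + (j + 1 + i) by omega]⟩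

theorem append_cons_eq_seg {b x : ℕ → ℕ} {p j c l : ℕ} {u : List ℕ} (hc : b j < c)
    (h : pre b j ++ c :: u = seg x p l) :
    Blk b x p j ∧ u = seg x (p + j + 1) (l - 1 - j) ∧ j < l := by
  have hl : l = j + (u.length + 1) := by simpa using (congrArg List.length h).symm
  have hx : ∀ i (hi : i < l), x (p + i) = (pre b j ++ c :: u)[i]'(by simp; omega) := by
    intro i hi
    simp [h]
  have hB : Blk b x p j := by
    refine ⟨fun i hi => ?_, ?_⟩
    · rw [hx i (by omega), List.getElem_append_left (by simpa)]; simp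
    · rw [hx j (by omega), List.getElem_append_right (by simp)]; simpa
  refine ⟨hB, ?_, by omega⟩
  rw [hB.seg_eq (by omega)] at h
  exact (List.cons.inj (List.append_cancel_left h)).2

/-- Converse of `isBlocks_seg`. Positions strictly inside a factor are not starting points of the
decomposition; for them `Blk.sub`, hence `IsPre`, is needed. -/
theorem IsBlocks.exists_blk {b x : ℕ → ℕ} {n : ℕ} (hb : IsPre b n) {u : List ℕ}
    (hu : IsBlocks b u) : ∀ {p l}, l ≤ n → u = seg x p l →
      ∀ i < l, ∃ j, i + j < l ∧ Blk b x (p + i) j := by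
  induction hu with
  | nil =>
    intro p l _ h i hi
    have := congrArg List.length h
    simp at this
    omega
  | cons j c u hc _ ih =>
    intro p l hl h i hi
    obtain ⟨hB, hu, hj⟩ := append_cons_eq_seg hc h
    by_cases hij : i ≤ j
    · obtain ⟨j', h1, h2⟩ := hB.sub hb (by omega) hij
      exact ⟨j', by omega, h2⟩
    · obtain ⟨j', h1, h2⟩ := ih (by omega) hu (i - j - 1) (by omega)
      exact ⟨j', by omega, by rwa [show p + j + 1 + (i - j - 1) = p + i by omega] at h2⟩

/-- The length of the first block can be recovered from the word by `Blk.unique`. -/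
theorem append_cons_inj {b : ℕ → ℕ} {j j' c c' : ℕ} {u u' : List ℕ} (hc : b j < c)
    (hc' : b j' < c') (h : pre b j ++ c :: u = pre b j' ++ c' :: u') :
    j = j' ∧ c = c' ∧ u = u' := by
  -- Both sides are read as one segment of a word, so that `Blk.unique` applies.
  have hs : pre b j' ++ c' :: u' =
      seg (fun i => (pre b j' ++ c' :: u').getD i 0) 0 (pre b j' ++ c' :: u').length := by
    conv_lhs => rw [← pre_getD (pre b j' ++ c' :: u')]
    simp [seg]
  obtain rfl := (append_cons_eq_seg hc (h.trans hs)).1.unique (append_cons_eq_seg hc' hs).1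
  simpa using h

open Classical in
/-- The block sequences of length `t` over `{1, ..., k}` of weight at least `v`. -/
noncomputable def blockStrings (k : ℕ) (b : ℕ → ℕ) (t v : ℕ) : Finset (List ℕ) :=
  (strings k t).filter fun u => IsBlocks b u ∧ v ≤ u.sum

/-- The number of block sequences of length `t` of weight at least `v`. -/
noncomputable def cnt (k : ℕ) (b : ℕ → ℕ) (t v : ℕ) : ℕ := (blockStrings k b t v).card

theorem mem_blockStrings {k t v : ℕ} {b : ℕ → ℕ} {u : List ℕ} :
    u ∈ blockStrings k b t v ↔
      (u.length = t ∧ ∀ x ∈ u, 1 ≤ x ∧ x ≤ k) ∧ IsBlocks b u ∧ v ≤ u.sum := by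
  simp [blockStrings, mem_strings]

theorem card_strings (k n : ℕ) : (strings k n).card = k ^ n := by
  rw [strings, Finset.card_image_of_injective _ List.ofFn_injective]
  simp

theorem cnt_le (k : ℕ) (b : ℕ → ℕ) (t v : ℕ) : cnt k b t v ≤ k ^ t := by
  rw [← card_strings]
  exact Finset.card_le_card fun u hu => mem_strings.2 (mem_blockStrings.1 hu).1

theorem cnt_zero (k : ℕ) (b : ℕ → ℕ) (v : ℕ) : cnt k b 0 v = if v = 0 then 1 else 0 := by
  have : blockStrings k b 0 v = if v = 0 then {[]} else ∅ := by
    ext u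
    rw [mem_blockStrings]
    split_ifs with h
    · constructor
      · rintro ⟨⟨h, -⟩, -⟩; simpa using h
      · intro h'
        obtain rfl : u = [] := by simpa using h'
        exact ⟨by simp, .nil, by simp [h]⟩
    · constructor
      · rintro ⟨⟨h1, -⟩, -, h2⟩
        obtain rfl : u = [] := by simpa using h1
        simp at h2; omega
      · simp
  rw [cnt, this]
  split_ifs <;> rfl

theorem mem_pre {b : ℕ → ℕ} {j y : ℕ} (h : y ∈ pre b j) : ∃ i < j, b i = y := by
  simpa [pre] using h

/-- Split off the first block. The subtraction is truncated on purpose: once the required weight is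
reached, nothing more is required of the rest. -/
theorem cnt_succ {k n t : ℕ} {b : ℕ → ℕ} (hb : ∀ i < n, 1 ≤ b i ∧ b i ≤ k) (h1 : 1 ≤ t)
    (hn : t ≤ n) (v : ℕ) :
    cnt k b t v = ∑ j ∈ Finset.range t, ∑ c ∈ Finset.Ioc (b j) k,
      cnt k b (t - 1 - j) (v - (∑ i ∈ Finset.range j, b i + c)) := by
  simp only [cnt, ← Finset.card_sigma]
  symm
  refine Finset.card_nbij (fun a => pre b a.1 ++ a.2.1 :: a.2.2) ?_ ?_ ?_
  · rintro ⟨j, c, u⟩ h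
    simp only [Finset.coe_sigma, Set.mem_sigma_iff, Finset.mem_coe,
      Finset.mem_range, Finset.mem_Ioc, mem_blockStrings] at h ⊢
    obtain ⟨hj, ⟨hc, hck⟩, ⟨hu, hus⟩, hblk, hw⟩ := h
    refine ⟨⟨by simp; omega, ?_⟩, .cons _ _ _ hc hblk, ?_⟩
    · intro y hy
      simp only [List.mem_append, List.mem_cons] at hy
      rcases hy with hy | rfl | hy
      · obtain ⟨i, hi, rfl⟩ := mem_pre hy; exact hb i (by omega)
      · omega
      · exact hus y hy
    · simp only [List.sum_append, List.sum_cons, sum_pre]; omega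
  · rintro ⟨j, c, u⟩ h ⟨j', c', u'⟩ h' e
    simp only [Finset.coe_sigma, Set.mem_sigma_iff, Finset.mem_coe,
      Finset.mem_range, Finset.mem_Ioc, mem_blockStrings] at h h'
    obtain ⟨rfl, rfl, rfl⟩ := append_cons_inj h.2.1.1 h'.2.1.1 e
    rfl
  · intro s hs
    simp only [Finset.mem_coe, mem_blockStrings] at hs
    obtain ⟨⟨hl, hsk⟩, hblk, hw⟩ := hs
    cases hblk with
    | nil => simp at hl; omega
    | cons j c u hc hu =>
      simp only [List.length_append, length_pre, List.length_cons, List.mem_append,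
        List.mem_cons, List.sum_append, List.sum_cons, sum_pre] at hl hsk hw
      refine ⟨⟨j, c, u⟩, ?_, rfl⟩
      simp only [Finset.coe_sigma, Set.mem_sigma_iff, Finset.mem_coe,
        Finset.mem_range, Finset.mem_Ioc, mem_blockStrings]
      exact ⟨by omega, ⟨hc, (hsk c (by simp)).2⟩,
        ⟨by omega, fun y hy => hsk y (by simp [hy])⟩, hu, by omega⟩

open Classical in
/-- The heavy strings all of whose rotations exceed `b 0, ..., b (n - 1)`. -/
noncomputable def aboveStrings (k n w : ℕ) (b : ℕ → ℕ) : Finset (List ℕ) :=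
  (heavyStrings k n w).filter fun s => ∀ i, pre b n < s.rotate i

theorem mem_heavyStrings {k n w : ℕ} {s : List ℕ} :
    s ∈ heavyStrings k n w ↔ (s.length = n ∧ ∀ x ∈ s, 1 ≤ x ∧ x ≤ k) ∧ w ≤ s.sum := by
  simp [heavyStrings, mem_strings]

theorem mem_aboveStrings {k n w : ℕ} {b : ℕ → ℕ} {s : List ℕ} :
    s ∈ aboveStrings k n w b ↔
      ((s.length = n ∧ ∀ x ∈ s, 1 ≤ x ∧ x ≤ k) ∧ w ≤ s.sum) ∧ ∀ i, pre b n < s.rotate i := by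
  simp [aboveStrings, mem_heavyStrings]

theorem heavyStrings_rotate {k n w : ℕ} {s : List ℕ} (i : ℕ) :
    s.rotate i ∈ heavyStrings k n w ↔ s ∈ heavyStrings k n w := by
  simp only [mem_heavyStrings, List.length_rotate, List.mem_rotate,
    (List.rotate_perm s i).sum_eq]

theorem eq_rotate_of_rotate_eq {z z' : List ℕ} {l l' : ℕ} (hl : l ≤ l') (hn : l ≤ z.length)
    (h : z.rotate l = z'.rotate l') : z = z'.rotate (l' - l) := by
  have hlen : z.length = z'.length := by simpa using congrArg List.length h
  have h2 := congrArg (fun y => y.rotate (z.length - l)) h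
  simp only [List.rotate_rotate] at h2
  rw [Nat.add_sub_cancel' hn, List.rotate_length,
    show l' + (z.length - l) = l' - l + z.length by omega, hlen] at h2
  rw [h2, ← List.rotate_rotate]
  conv_lhs => rw [← List.length_rotate z' (l' - l), List.rotate_length]

/-- Every cyclic string above `b` decomposes uniquely into blocks. -/
theorem card_aboveStrings {k n w : ℕ} {b : ℕ → ℕ} (hb : ∀ i < n, 1 ≤ b i ∧ b i ≤ k)
    (hpre : IsPre b n) (hn : 1 ≤ n) :
    (aboveStrings k n w b).card = ∑ j ∈ Finset.range n, (j + 1) * ∑ c ∈ Finset.Ioc (b j) k,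
      cnt k b (n - 1 - j) (w - (∑ i ∈ Finset.range j, b i + c)) := by
  have key : ∀ j, (j + 1) * ∑ c ∈ Finset.Ioc (b j) k,
      cnt k b (n - 1 - j) (w - (∑ i ∈ Finset.range j, b i + c)) =
      ((Finset.range (j + 1)).sigma fun _ => (Finset.Ioc (b j) k).sigma fun c =>
        blockStrings k b (n - 1 - j) (w - (∑ i ∈ Finset.range j, b i + c))).card := by
    intro j
    simp [cnt]
  simp only [key, ← Finset.card_sigma]
  symm
  have hmem : ∀ (j l c : ℕ) (u : List ℕ), (⟨j, l, c, u⟩ : Σ _ : ℕ, Σ _ : ℕ, Σ _ : ℕ, List ℕ) ∈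
      ((Finset.range n).sigma fun j => (Finset.range (j + 1)).sigma fun _ =>
        (Finset.Ioc (b j) k).sigma fun c =>
          blockStrings k b (n - 1 - j) (w - (∑ i ∈ Finset.range j, b i + c))) ↔
      j < n ∧ l ≤ j ∧ (b j < c ∧ c ≤ k) ∧ (u.length = n - 1 - j ∧ ∀ y ∈ u, 1 ≤ y ∧ y ≤ k) ∧
        IsBlocks b u ∧ w - (∑ i ∈ Finset.range j, b i + c) ≤ u.sum := by
    intro j l c u
    simp only [Finset.mem_sigma, Finset.mem_range, Finset.mem_Ioc, mem_blockStrings,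
      Nat.lt_succ_iff]
  -- The linear word starts with the block that covers the first symbol of the cyclic string, and l
  -- ≤ j is the offset of that symbol in the block; this is the source of the factor j + 1.
  refine Finset.card_nbij (fun a => (pre b a.1 ++ a.2.2.1 :: a.2.2.2).rotate a.2.1) ?_ ?_ ?_
  · rintro ⟨j, l, c, u⟩ h
    obtain ⟨hj, hl, ⟨hc, hck⟩, ⟨hu, hus⟩, hblk, hw⟩ := (hmem _ _ _ _).1 h
    have hlen : (pre b j ++ c :: u).length = n := by simp; omega
    rw [Finset.mem_coe, mem_aboveStrings, ← mem_heavyStrings]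
    dsimp only
    rw [heavyStrings_rotate, mem_heavyStrings]
    refine ⟨⟨⟨hlen, ?_⟩, ?_⟩, ?_⟩
    · intro y hy
      simp only [List.mem_append, List.mem_cons] at hy
      rcases hy with hy | rfl | hy
      · obtain ⟨i, hi, rfl⟩ := mem_pre hy; exact hb i (by omega)
      · omega
      · exact hus y hy
    · simp only [List.sum_append, List.sum_cons, sum_pre]; omega
    · intro i
      have hz := rotate_eq_seg (pre b j ++ c :: u) 0
      rw [List.rotate_zero, hlen] at hz
      obtain ⟨j', h1, h2⟩ := (IsBlocks.cons j c u hc hblk).exists_blk hpre le_rfl hz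
        ((l + i) % n) (Nat.mod_lt _ (by omega))
      rw [List.rotate_rotate, ← List.rotate_mod, hlen, rotate_eq_seg, hlen, pre_lt_seg]
      rw [zero_add] at h2
      exact ⟨j', by omega, h2⟩
  -- If l < l', the start of the second word sits at position n - (l' - l) of the first, where a
  -- block must end before the word does, hence has j2 < l' - l. By uniqueness j2 = j' ≥ l', a
  -- contradiction.
  · have main : ∀ (j l c : ℕ) (u : List ℕ) (j' l' c' : ℕ) (u' : List ℕ), l < l' → j < n →
        l ≤ j → b j < c → u.length = n - 1 - j → IsBlocks b u → j' < n →
        l' ≤ j' → b j' < c' → u'.length = n - 1 - j' →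
        (pre b j ++ c :: u).rotate l ≠ (pre b j' ++ c' :: u').rotate l' := by
      intro j l c u j' l' c' u' hll hj hl hc hu hblk hj' hl' hc' hu' e
      have hlen : (pre b j ++ c :: u).length = n := by simp; omega
      have hlen' : (pre b j' ++ c' :: u').length = n := by simp; omega
      have hz' := rotate_eq_seg (pre b j' ++ c' :: u') 0
      rw [List.rotate_zero, hlen'] at hz'
      have hB := (append_cons_eq_seg hc' hz').1
      have hz := eq_rotate_of_rotate_eq hll.le (by omega) e
      rw [rotate_eq_seg, hlen'] at hz
      obtain ⟨j2, h1, h2⟩ := (IsBlocks.cons j c u hc hblk).exists_blk hpre le_rfl hz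
        (n - (l' - l)) (by omega)
      rw [show l' - l + (n - (l' - l)) = 0 + n by omega] at h2
      conv at h2 => rw [← hlen']
      rw [blk_per_add_length] at h2
      obtain rfl := h2.unique hB
      omega
    rintro ⟨j, l, c, u⟩ h ⟨j', l', c', u'⟩ h' e
    obtain ⟨hj, hl, ⟨hc, hck⟩, ⟨hu, hus⟩, hblk, hw⟩ := (hmem _ _ _ _).1 h
    obtain ⟨hj', hl', ⟨hc', hck'⟩, ⟨hu', hus'⟩, hblk', hw'⟩ := (hmem _ _ _ _).1 h'
    dsimp only at e
    rcases lt_trichotomy l l' with hll | rfl | hll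
    · exact (main _ _ _ _ _ _ _ _ hll hj hl hc hu hblk hj' hl' hc' hu' e).elim
    · obtain ⟨rfl, rfl, rfl⟩ := append_cons_inj hc hc' (List.rotate_injective l e)
      rfl
    · exact (main _ _ _ _ _ _ _ _ hll hj' hl' hc' hu' hblk' hj hl hc hu e.symm).elim
  · intro s hs
    obtain ⟨⟨⟨hlen, hsk⟩, hw⟩, habove⟩ := mem_aboveStrings.1 (Finset.mem_coe.1 hs)
    have hx : ∀ p, ∃ j < n, Blk b (per s) p j := fun p => by
      have := habove p
      rwa [rotate_eq_seg, hlen, pre_lt_seg] at this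
    have hper : ∀ p j, Blk b (per s) (p + n) j ↔ Blk b (per s) p j := fun p j => by
      rw [← hlen]; exact blk_per_add_length
    -- The least p whose block reaches index n or beyond starts the block that covers the first
    -- symbol, seen one turn later; p = n is a candidate, so n - p is a valid offset.
    have hex : ∃ p, ∃ j < n, Blk b (per s) p j ∧ n ≤ p + j := by
      obtain ⟨j, hj, h⟩ := hx n
      exact ⟨n, j, hj, h, by omega⟩
    classical
    obtain ⟨j, hj, hB, hpj⟩ := Nat.find_spec hex
    have hmin : ∀ q < Nat.find hex, ∀ j < n, Blk b (per s) q j → q + j < n := by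
      intro q hq j hj h
      by_contra hc
      exact Nat.find_min hex hq ⟨j, hj, h, by omega⟩
    have hpn : Nat.find hex ≤ n := Nat.find_min' hex (by
      obtain ⟨j, hj, h⟩ := hx n
      exact ⟨j, hj, h, by omega⟩)
    generalize Nat.find hex = p at hB hpj hmin hpn
    have hz : s.rotate p =
        pre b j ++ per s (p + j) :: seg (per s) (p + j + 1) (n - 1 - j) := by
      rw [rotate_eq_seg, hlen, hB.seg_eq hj]
    have hzmem : s.rotate p ∈ heavyStrings k n w := by
      rw [heavyStrings_rotate, mem_heavyStrings]; exact ⟨⟨hlen, hsk⟩, hw⟩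
    rw [hz, mem_heavyStrings] at hzmem
    obtain ⟨⟨-, hzk⟩, hzw⟩ := hzmem
    simp only [List.mem_append, List.mem_cons, List.sum_append, List.sum_cons, sum_pre]
      at hzk hzw
    refine ⟨⟨j, n - p, per s (p + j), seg (per s) (p + j + 1) (n - 1 - j)⟩,
      (hmem _ _ _ _).2 ⟨hj, by omega, ⟨hB.2, (hzk _ (by simp)).2⟩,
        ⟨by simp, fun y hy => hzk y (by simp [hy])⟩, isBlocks_seg fun i hi => ?_, by omega⟩, ?_⟩
    -- Positions behind the chosen block are q + n with q < p. By minimality of p the block at q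
    -- ends before n. If it reached p, then `Blk.sub` would give the block at p an end before n as
    -- well.
    · obtain ⟨q, hq⟩ : ∃ q, p + j + 1 + i = q + n := ⟨p + j + 1 + i - n, by omega⟩
      obtain ⟨j', hj', hB'⟩ := hx q
      refine ⟨j', ?_, by rw [hq, hper]; exact hB'⟩
      by_contra hc
      have h1 := hmin q (by omega) j' hj' hB'
      obtain ⟨j2, h2, h3⟩ := hB'.sub (d := p - q) hpre hj' (by omega)
      rw [show q + (p - q) = p by omega] at h3
      obtain rfl := h3.unique hB
      omega
    · dsimp only
      rw [← hz, List.rotate_rotate, Nat.add_sub_cancel' hpn, ← hlen, List.rotate_length]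

end BoundedWeight

/-! ### Aperiodic prefixes and the number of strings below a given string -/

namespace BoundedWeight

theorem iterate_rotate_one (s : List ℕ) (i : ℕ) :
    (fun l : List ℕ => l.rotate 1)^[i] s = s.rotate i := by
  induction i with
  | zero => simp
  | succ i ih => rw [Function.iterate_succ_apply', ih, List.rotate_rotate]

/-- The least `d ≥ 1` such that rotating `s` by `d` does not change it. -/
noncomputable def period (s : List ℕ) : ℕ :=
  Function.minimalPeriod (fun l : List ℕ => l.rotate 1) s

theorem isPeriodicPt_rotate {s : List ℕ} {d : ℕ} :
    Function.IsPeriodicPt (fun l : List ℕ => l.rotate 1) d s ↔ s.rotate d = s := by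
  rw [Function.IsPeriodicPt, Function.IsFixedPt, iterate_rotate_one]

theorem rotate_period (s : List ℕ) : s.rotate (period s) = s :=
  isPeriodicPt_rotate.1 (Function.isPeriodicPt_minimalPeriod _ s)

theorem period_dvd_length (s : List ℕ) : period s ∣ s.length :=
  (isPeriodicPt_rotate.2 s.rotate_length).minimalPeriod_dvd

theorem period_pos {s : List ℕ} (hs : s ≠ []) : 0 < period s :=
  Function.IsPeriodicPt.minimalPeriod_pos (List.length_pos_iff.2 hs)
    (isPeriodicPt_rotate.2 s.rotate_length)

theorem period_le_length {s : List ℕ} (hs : s ≠ []) : period s ≤ s.length :=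
  Nat.le_of_dvd (List.length_pos_iff.2 hs) (period_dvd_length s)

theorem period_le {s : List ℕ} {p : ℕ} (hp : 0 < p) (h : s.rotate p = s) : period s ≤ p :=
  (isPeriodicPt_rotate.2 h).minimalPeriod_le hp

theorem drop_eq_take_of_rotate_eq {s : List ℕ} {d : ℕ} (hd : d ≤ s.length)
    (h : s.rotate d = s) : s.drop d = s.take (s.length - d) := by
  conv_rhs => rw [← h, List.rotate_eq_drop_append_take hd]
  rw [List.take_append_of_le_length (by simp), List.take_of_length_le (by simp; omega)]

theorem eq_flatten_replicate {d : ℕ} (m : ℕ) (s : List ℕ) (hl : s.length = m * d)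
    (h : s.drop d = s.take (s.length - d)) : s = (List.replicate m (s.take d)).flatten := by
  induction m generalizing s with
  | zero => simpa using hl
  | succ m ih =>
    conv_lhs => rw [← List.take_append_drop d s, h]
    rw [List.replicate_succ, List.flatten_cons]
    congr 1
    have hld : s.length - d = m * d := by rw [hl, Nat.succ_mul]; omega
    rw [hld]
    rcases Nat.eq_zero_or_pos m with rfl | hm
    · simp
    · have hdm : d ≤ m * d := Nat.le_mul_of_pos_left d hm
      have hlen : (s.take (m * d)).length = m * d := by simp; omega
      rw [hld] at h
      have := ih (s.take (m * d)) hlen (by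
        rw [hlen, List.drop_take, h, List.take_take])
      rw [List.take_take, min_eq_left hdm] at this
      exact this

theorem isPowerOfPrefix_period {s : List ℕ} (hs : s ≠ []) : IsPowerOfPrefix s (period s) := by
  obtain ⟨m, hm⟩ := period_dvd_length s
  refine ⟨m, ?_, ?_⟩
  · rcases Nat.eq_zero_or_pos m with rfl | h
    · exact absurd (List.length_eq_zero_iff.1 (by simpa using hm)) hs
    · exact h
  · exact (eq_flatten_replicate m s (by rw [hm, mul_comm])
      (drop_eq_take_of_rotate_eq (period_le_length hs) (rotate_period s))).symm

theorem rotate_of_isPowerOfPrefix {s : List ℕ} {p : ℕ} (hp : p ≤ s.length)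
    (h : IsPowerOfPrefix s p) : s.rotate p = s := by
  obtain ⟨j, hj, e⟩ := h
  obtain ⟨j, rfl⟩ : ∃ i, j = i + 1 := ⟨j - 1, by omega⟩
  have hl : (s.take p).length = p := by simpa
  generalize s.take p = t at e hl
  subst e hl
  rw [List.rotate_eq_drop_append_take hp]
  conv_rhs => rw [List.replicate_succ', List.flatten_append]
  rw [List.replicate_succ, List.flatten_cons, List.drop_left, List.take_left]
  simp

/-- A string is a power of its prefix of length p only if rotation by p fixes it, and its least
rotation period gives such a power. This turns the shortest root into a minimal period of an orbit.
-/
theorem aperiodicPrefix_eq {s : List ℕ} (hs : s ≠ []) :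
    aperiodicPrefix s = s.take (period s) := by
  -- Quantifying over the instance avoids matching the classical one hidden in the definition.
  have key : ∀ inst : DecidablePred (IsPowerOfPrefix s),
      @Nat.find _ inst (exists_isPowerOfPrefix s) = period s := by
    intro _
    refine (Nat.find_eq_iff _).2 ⟨isPowerOfPrefix_period hs, fun p hp h => ?_⟩
    have h0 : 0 < p := by
      rcases Nat.eq_zero_or_pos p with rfl | h0
      · obtain ⟨j, -, e⟩ := h
        exact absurd (by simpa using e.symm) hs
      · exact h0
    have := period_le h0 (rotate_of_isPowerOfPrefix (hp.le.trans (period_le_length hs)) h)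
    omega
  exact congrArg s.take (key _)

theorem length_aperiodicPrefix {s : List ℕ} (hs : s ≠ []) :
    (aperiodicPrefix s).length = period s := by
  rw [aperiodicPrefix_eq hs, List.length_take, min_eq_left (period_le_length hs)]

/-- The set of rotations of `s`. -/
def rotations (s : List ℕ) : Finset (List ℕ) := (Finset.range s.length).image s.rotate

theorem mem_rotations {s u : List ℕ} (hs : s ≠ []) : u ∈ rotations s ↔ ∃ i, s.rotate i = u := by
  simp only [rotations, Finset.mem_image, Finset.mem_range]
  constructor
  · rintro ⟨i, -, h⟩; exact ⟨i, h⟩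
  · rintro ⟨i, h⟩
    exact ⟨i % s.length, Nat.mod_lt _ (List.length_pos_iff.2 hs), by rw [List.rotate_mod, h]⟩

/-- Orbit size equals minimal period. This is why the cycle is exactly as long as the set of heavy
strings is large. -/
theorem card_rotations {s : List ℕ} (hs : s ≠ []) :
    (rotations s).card = (aperiodicPrefix s).length := by
  have : rotations s = (Finset.range (period s)).image s.rotate := by
    ext u
    simp only [mem_rotations hs, Finset.mem_image, Finset.mem_range]
    constructor
    · rintro ⟨i, h⟩
      refine ⟨i % period s, Nat.mod_lt _ (period_pos hs), ?_⟩
      rw [← h, ← iterate_rotate_one, ← iterate_rotate_one, period,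
        Function.iterate_mod_minimalPeriod_eq]
    · rintro ⟨i, -, h⟩; exact ⟨i, h⟩
  rw [this, length_aperiodicPrefix hs, Finset.card_image_of_injOn, Finset.card_range]
  have := Function.iterate_injOn_Iio_minimalPeriod (f := fun l : List ℕ => l.rotate 1) (x := s)
  simp only [iterate_rotate_one] at this
  simpa [period] using this

theorem mem_necklaces {k n w : ℕ} {s : List ℕ} :
    s ∈ necklaces k n w ↔ s ∈ heavyStrings k n w ∧ IsNecklace s := by
  simp [necklaces]

theorem nodup_necklaces (k n w : ℕ) : (necklaces k n w).Nodup := by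
  unfold necklaces
  exact Finset.sort_nodup _ _

theorem pairwise_necklaces (k n w : ℕ) : (necklaces k n w).Pairwise (· < ·) :=
by
  refine (List.Pairwise.and ?_ (nodup_necklaces k n w)).imp fun h => lt_of_le_of_ne h.1 h.2
  unfold necklaces
  exact Finset.pairwise_sort _ _

theorem exists_isNecklace_rotate (s : List ℕ) (hs : s ≠ []) : ∃ i, IsNecklace (s.rotate i) := by
  obtain ⟨i, -, hi⟩ := Finset.exists_min_image (Finset.range s.length) s.rotate
    ⟨0, by simpa using List.length_pos_iff.2 hs⟩
  refine ⟨i, fun j => ?_⟩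
  rw [List.rotate_rotate, ← List.rotate_mod s (i + j)]
  exact hi _ (by simpa using Nat.mod_lt _ (List.length_pos_iff.2 hs))

theorem ne_nil_of_mem_heavyStrings {k n w : ℕ} (hn : 1 ≤ n) {s : List ℕ}
    (hs : s ∈ heavyStrings k n w) : s ≠ [] := by
  rintro rfl
  have := (mem_heavyStrings.1 hs).1.1
  simp at this; omega

/-- The number of heavy strings that have a rotation at most `b`. -/
theorem card_heavyStrings_eq {k n w : ℕ} (hn : 1 ≤ n) (b : ℕ → ℕ) :
    (heavyStrings k n w).card = (aboveStrings k n w b).card +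
      (((necklaces k n w).filter (· ≤ pre b n)).map fun s => (aperiodicPrefix s).length).sum := by
  classical
  rw [← List.sum_toFinset _ ((nodup_necklaces k n w).filter _)]
  have hne : ∀ s ∈ ((necklaces k n w).filter (· ≤ pre b n)).toFinset,
      s ∈ heavyStrings k n w ∧ IsNecklace s ∧ s ≤ pre b n := by
    intro s hs
    simpa [mem_necklaces, and_assoc] using hs
  -- Lengths become sizes of rotation classes, so the sum counts a disjoint union.
  rw [Finset.sum_congr rfl fun s hs =>
    (card_rotations (ne_nil_of_mem_heavyStrings hn (hne s hs).1)).symm, ← Finset.card_biUnion]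
  · rw [← Finset.card_union_of_disjoint]
    · congr 1
      ext s
      simp only [Finset.mem_union, Finset.mem_biUnion]
      constructor
      · intro hs
        by_cases h : ∀ i, pre b n < s.rotate i
        · exact Or.inl (mem_aboveStrings.2 ⟨mem_heavyStrings.1 hs, h⟩)
        · right
          push Not at h
          obtain ⟨j, hj⟩ := h
          have hs0 := ne_nil_of_mem_heavyStrings hn hs
          obtain ⟨i, hi⟩ := exists_isNecklace_rotate s hs0
          have hmem := (heavyStrings_rotate i).2 hs
          have hback : ∀ l, ∃ m, (s.rotate i).rotate m = s.rotate l := fun l => by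
            refine ⟨(s.length - i % s.length) + l, ?_⟩
            have : i % s.length < s.length := Nat.mod_lt _ (List.length_pos_iff.2 hs0)
            rw [← List.rotate_mod s i, List.rotate_rotate, ← add_assoc,
              Nat.add_sub_cancel' this.le, ← List.rotate_rotate, List.rotate_length]
          refine ⟨s.rotate i, ?_, ?_⟩
          · obtain ⟨m, hm⟩ := hback j
            simpa [mem_necklaces, hmem, hi] using (hi m).trans (hm ▸ hj)
          · rw [mem_rotations (ne_nil_of_mem_heavyStrings hn hmem)]
            simpa using hback 0
      · rintro (h | ⟨a, ha, h⟩)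
        · exact mem_heavyStrings.2 (mem_aboveStrings.1 h).1
        · obtain ⟨ha, -⟩ := hne a ha
          obtain ⟨i, rfl⟩ := (mem_rotations (ne_nil_of_mem_heavyStrings hn ha)).1 h
          rwa [heavyStrings_rotate]
    · rw [Finset.disjoint_left]
      intro s hs hs'
      obtain ⟨a, ha, h⟩ := Finset.mem_biUnion.1 hs'
      obtain ⟨ha, -, hab⟩ := hne a ha
      have ha0 := ne_nil_of_mem_heavyStrings hn ha
      obtain ⟨i, rfl⟩ := (mem_rotations ha0).1 h
      have := (mem_aboveStrings.1 hs).2 (a.length - i % a.length)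
      have hlt : i % a.length < a.length := Nat.mod_lt _ (List.length_pos_iff.2 ha0)
      rw [← List.rotate_mod a i, List.rotate_rotate, Nat.add_sub_cancel' hlt.le,
        List.rotate_length] at this
      exact absurd hab (not_le.2 this)
  · intro a ha a' ha' hne'
    obtain ⟨ha, hna, -⟩ := hne a ha
    obtain ⟨ha', hna', -⟩ := hne a' ha'
    rw [Function.onFun, Finset.disjoint_left]
    intro s hs hs'
    have ha0 := ne_nil_of_mem_heavyStrings hn ha
    have ha0' := ne_nil_of_mem_heavyStrings hn ha'
    have hlen : a.length = a'.length := by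
      rw [(mem_heavyStrings.1 ha).1.1, (mem_heavyStrings.1 ha').1.1]
    obtain ⟨i, rfl⟩ := (mem_rotations ha0).1 hs
    obtain ⟨j, hj⟩ := (mem_rotations ha0').1 hs'
    -- Two necklaces with a common rotation are rotations of each other, hence each is at most the
    -- other.
    have aux : ∀ {a a' : List ℕ} {i j : ℕ}, a' ≠ [] → IsNecklace a → a.rotate i = a'.rotate j →
        a ≤ a' := by
      intro a a' i j h0 hna h
      have hlt : j % a'.length < a'.length := Nat.mod_lt _ (List.length_pos_iff.2 h0)
      have := hna (i + (a'.length - j % a'.length))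
      rwa [← List.rotate_rotate, h, ← List.rotate_mod a' j, List.rotate_rotate,
        Nat.add_sub_cancel' hlt.le, List.rotate_length] at this
    exact hne' (le_antisymm (aux ha0' hna hj.symm) (aux ha0 hna' hj))

end BoundedWeight

/-! ### Consecutive necklaces and the strings of the cycle -/

namespace BoundedWeight

theorem pre_lt_pre {b b' : ℕ → ℕ} {n : ℕ} :
    pre b n < pre b' n ↔ ∃ j < n, (∀ i < j, b' i = b i) ∧ b j < b' j := by
  have := pre_lt_seg (b := b) (x := b') (p := 0) (n := n)
  simpa [seg, Blk] using this

theorem exists_eq_pre {s : List ℕ} {n : ℕ} (h : s.length = n) : ∃ b, s = pre b n :=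
  ⟨_, by subst h; exact (pre_getD s).symm⟩

theorem pre_inj {b b' : ℕ → ℕ} {n : ℕ} (h : pre b n = pre b' n) {i : ℕ} (hi : i < n) :
    b i = b' i := by
  simpa [hi] using congrArg (fun l : List ℕ => l.getD i 0) h |>.trans (by simp [hi] : _ = b' i)

theorem per_pre {b : ℕ → ℕ} {n i : ℕ} (hi : i < n) : per (pre b n) i = b i := by
  simp [per, Nat.mod_eq_of_lt hi, hi]

/-- Rotate the suffix to the front and use only the symbols before the wrap-around. -/
theorem IsNecklace.isPre {b : ℕ → ℕ} {n : ℕ} (h : IsNecklace (pre b n)) : IsPre b n := by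
  intro p l hl heq
  by_contra hlt
  refine not_lt.2 (h p) ?_
  rw [rotate_eq_seg, length_pre, seg, pre_lt_pre]
  refine ⟨l, by omega, fun i hi => ?_, ?_⟩
  · rw [per_pre (by omega), heq i hi]
  · rw [per_pre hl]; omega

/-- Suffixes are compared in their first symbol only. It follows that k^n is the only necklace that
starts with k. -/
theorem IsPre.eq_of_first {b : ℕ → ℕ} {n k : ℕ} (h : IsPre b n) (hk : ∀ i < n, b i ≤ k)
    (h0 : b 0 = k) : ∀ i < n, b i = k := fun i hi =>
  le_antisymm (hk i hi) (h0 ▸ h i 0 hi (by simp))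

/-- `b` with its `t`-th symbol increased and everything after it replaced by `k`. -/
def bump (k : ℕ) (b : ℕ → ℕ) (t i : ℕ) : ℕ := if i < t then b i else if i = t then b t + 1 else k

/-- The new string has a block of b ending at t, so by `Blk.sub` every rotation by 0 < p ≤ t is
larger. A rotation by p > t starts with k, which is larger unless the string itself starts with k,
and then it is k^n. -/
theorem isNecklace_bump {k n t : ℕ} {b : ℕ → ℕ} (hb : IsPre b n) (hk : ∀ i < n, b i ≤ k)
    (ht : t < n) (hlt : b t < k) : IsNecklace (pre (bump k b t) n) := by
  intro p
  rw [← List.rotate_mod, length_pre]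
  have hp : p % n < n := Nat.mod_lt _ (by omega)
  generalize p % n = p at hp
  have hx : ∀ i < n, per (pre (bump k b t) n) i = bump k b t i := fun i hi => per_pre hi
  rcases Nat.eq_zero_or_pos p with rfl | hp0
  · simp
  rw [rotate_eq_seg, length_pre]
  by_cases hpt : p ≤ t
  · refine (pre_lt_seg.2 ?_).le
    have h0 : Blk b (per (pre (bump k b t) n)) 0 t := by
      refine ⟨fun i hi => ?_, ?_⟩
      · rw [zero_add, hx i (by omega), bump, if_pos hi]
      · rw [zero_add, hx t ht]; simp [bump]
    obtain ⟨j, hj, h1, h2⟩ := h0.sub hb ht hpt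
    rw [zero_add] at h1 h2
    refine ⟨j, by omega, fun i hi => ?_, ?_⟩
    · rw [h1 i hi, bump, if_pos (by omega)]
    · rwa [bump, if_pos (by omega)]
  · by_cases hb0 : bump k b t 0 = k
    · have hall : ∀ i < n, bump k b t i = k := by
        rcases Nat.eq_zero_or_pos t with rfl | ht0
        · intro i hi
          rcases Nat.eq_zero_or_pos i with rfl | hi0
          · exact hb0
          · simp [bump]; omega
        · simp only [bump, ht0, if_true] at hb0
          have := hb.eq_of_first hk hb0 t ht
          omega
      have hr := rotate_eq_seg (pre (bump k b t) n) p
      rw [length_pre] at hr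
      have : pre (bump k b t) n = List.replicate n k := by
        refine List.eq_replicate_iff.2 ⟨by simp, fun y hy => ?_⟩
        obtain ⟨i, hi, rfl⟩ := mem_pre hy
        exact hall i hi
      rw [← hr, this]; simp
    · refine (pre_lt_seg.2 ⟨0, by omega, by simp, ?_⟩).le
      rw [add_zero, hx p hp]
      have h1 : bump k b t p = k := by
        rw [bump, if_neg (by omega), if_neg (by omega)]
      have h2 : bump k b t 0 ≤ k := by
        unfold bump
        split_ifs with h h'
        · exact hk _ (by omega)
        · omega
        · exact le_rfl
      omega

theorem pre_mem_heavyStrings {k n w : ℕ} {b : ℕ → ℕ} : pre b n ∈ heavyStrings k n w ↔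
    (∀ i < n, 1 ≤ b i ∧ b i ≤ k) ∧ w ≤ ∑ i ∈ Finset.range n, b i := by
  rw [mem_heavyStrings, sum_pre]
  simp [pre]

theorem le_bump {k n t : ℕ} {b : ℕ → ℕ} (hk : ∀ i < n, b i ≤ k) {i : ℕ} (hi : i < n) :
    b i ≤ bump k b t i := by
  unfold bump
  split_ifs with h h'
  · exact le_rfl
  · subst h'; omega
  · exact hk i hi

theorem bump_mem_necklaces {k n w t : ℕ} {b : ℕ → ℕ} (hb : pre b n ∈ necklaces k n w)
    (ht : t < n) (hlt : b t < k) : pre (bump k b t) n ∈ necklaces k n w := by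
  rw [mem_necklaces, pre_mem_heavyStrings] at hb ⊢
  obtain ⟨⟨h1, h2⟩, h3⟩ := hb
  have hk : ∀ i < n, b i ≤ k := fun i hi => (h1 i hi).2
  refine ⟨⟨fun i hi => ⟨(h1 i hi).1.trans (le_bump hk hi), ?_⟩, ?_⟩,
    isNecklace_bump h3.isPre hk ht hlt⟩
  · unfold bump
    split_ifs
    · exact hk i hi
    · omega
    · exact le_rfl
  · exact h2.trans (Finset.sum_le_sum fun i hi => le_bump hk (Finset.mem_range.1 hi))

/-- In the list of necklaces, the prefix before the last symbol that is not `k` survives. -/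
theorem next_necklace {k n w m t : ℕ} {a : ℕ → ℕ} {L₁ L₂ : List (List ℕ)}
    (hL : necklaces k n w = L₁ ++ pre a n :: L₂) (hm : m ≤ t) (ht : t < n) (hlt : a t < k) :
    ∃ b L₃, L₂ = pre b n :: L₃ ∧ ∀ i < m, b i = a i := by
  have hp := pairwise_necklaces k n w
  have ha : pre a n ∈ necklaces k n w := by simp [hL]
  have hmem := bump_mem_necklaces ha ht hlt
  have hgt : pre a n < pre (bump k a t) n :=
    pre_lt_pre.2 ⟨t, ht, fun i hi => by simp [bump, hi], by simp [bump]⟩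
  rw [hL, List.pairwise_append, List.pairwise_cons] at hp
  obtain ⟨-, ⟨hp2, hp3⟩, hp1⟩ := hp
  have hmem2 : pre (bump k a t) n ∈ L₂ := by
    rw [hL, List.mem_append, List.mem_cons] at hmem
    rcases hmem with h | h | h
    · exact absurd (hp1 _ h _ (by simp)) (not_lt.2 hgt.le)
    · exact absurd h hgt.ne'
    · exact h
  cases L₂ with
  | nil => simp at hmem2
  | cons s L₃ =>
    have hs : s ∈ necklaces k n w := by simp [hL]
    obtain ⟨b, rfl⟩ := exists_eq_pre (mem_heavyStrings.1 (mem_necklaces.1 hs).1).1.1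
    refine ⟨b, L₃, rfl, fun i hi => ?_⟩
    obtain ⟨j, hj, h1, h2⟩ := pre_lt_pre.1 (hp2 (pre b n) (by simp))
    by_cases hjm : j < m
    · exfalso
      -- As the immediate successor of a, the string b is at most the bumped necklace. That one
      -- agrees with a before t, so a first increase of b before m ≤ t would put b above it.
      have hle : pre b n ≤ pre (bump k a t) n := by
        rcases List.mem_cons.1 hmem2 with h | h
        · exact h.ge
        · exact ((List.pairwise_cons.1 hp3).1 _ h).le
      refine not_lt.2 hle (pre_lt_pre.2 ⟨j, hj, fun l hl => ?_, ?_⟩)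
      · rw [h1 l hl, bump, if_pos (by omega)]
      · rwa [bump, if_pos (by omega)]
    · exact h1 i (by omega)

theorem pre_prefix_pre {b : ℕ → ℕ} {m n : ℕ} (h : m ≤ n) : pre b m <+: pre b n :=
  ⟨seg b m (n - m), by
    have := seg_add b 0 m (n - m)
    rw [Nat.add_sub_cancel' h] at this
    simpa [seg] using this.symm⟩

theorem take_pre {b : ℕ → ℕ} {m n : ℕ} (h : m ≤ n) : (pre b n).take m = pre b m := by
  have := (List.prefix_iff_eq_take.1 (pre_prefix_pre (b := b) h)).symm
  simpa using this

theorem drop_pre (b : ℕ → ℕ) (m n : ℕ) : (pre b n).drop m = seg b m (n - m) :=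
  List.ext_getElem (by simp) fun i h h' => by simp

theorem aperiodicPrefix_eq_drop {s : List ℕ} (hs : s ≠ []) :
    aperiodicPrefix s = s.drop (s.length - period s) := by
  have hd := period_le_length hs
  have h := congrArg (fun l => l.rotate (s.length - period s)) (rotate_period s)
  rw [List.rotate_rotate, Nat.add_sub_cancel' hd, List.rotate_length,
    List.rotate_eq_drop_append_take (Nat.sub_le _ _)] at h
  have h2 := congrArg (List.take (period s)) h
  rw [List.take_left' (by simp; omega)] at h2
  rw [aperiodicPrefix_eq hs, h2]

/-- The aperiodic prefixes from a necklace on start with that necklace, unless it is the last. -/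
theorem necklace_prefix_flatten {k n w : ℕ} {a : ℕ → ℕ} {L₁ L₂ : List (List ℕ)} (hn : 1 ≤ n)
    (hL : necklaces k n w = L₁ ++ pre a n :: L₂) (hlt : a 0 < k) :
    pre a n <+: ((pre a n :: L₂).map aperiodicPrefix).flatten := by
  induction L₂ generalizing L₁ a with
  | nil =>
    obtain ⟨b, L₃, h, -⟩ := next_necklace hL le_rfl hn hlt
    simp at h
  | cons s L₂ ih =>
    have hne : pre a n ≠ [] := by
      intro h; have := congrArg List.length h; simp at this; omega
    have hd := period_le_length hne
    have hd0 := period_pos hne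
    rw [length_pre] at hd
    -- With d the period, a is ap(a) followed by its own prefix of length n - d; it remains to find
    -- that prefix at the start of the later part.
    have hsplit : pre a n = aperiodicPrefix (pre a n) ++ pre a (n - period (pre a n)) := by
      have h := drop_eq_take_of_rotate_eq (period_le_length hne) (rotate_period _)
      conv_lhs => rw [← List.take_append_drop (period (pre a n)) (pre a n), h, length_pre,
        take_pre (Nat.sub_le _ _), ← aperiodicPrefix_eq hne]
    have hmem : pre a n ∈ necklaces k n w := by simp [hL]
    rw [mem_necklaces, pre_mem_heavyStrings] at hmem
    have hk : ∀ i < n, a i ≤ k := fun i hi => (hmem.1.1 i hi).2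
    -- By periodicity this symbol equals the first one, which is below k. So the next necklace keeps
    -- the first n - d symbols of a, and if n - d > 0 it again starts with a symbol below k, as the
    -- induction requires.
    have hnotall : a (n - period (pre a n)) < k := by
      have h1 := aperiodicPrefix_eq hne
      rw [aperiodicPrefix_eq_drop hne, drop_pre, length_pre, take_pre hd] at h1
      have h2 := congrArg (fun l : List ℕ => l.getD 0 0) h1
      have h3 : 0 < n - (n - period (pre a n)) := by omega
      simp [h3, hd0] at h2
      omega
    obtain ⟨b, L₃, h, hb⟩ := next_necklace hL le_rfl (by omega) hnotall
    obtain ⟨rfl, rfl⟩ := List.cons.inj h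
    rw [List.map_cons, List.flatten_cons]
    conv_lhs => rw [hsplit]
    rw [List.prefix_append_right_inj]
    rcases Nat.eq_zero_or_pos (n - period (pre a n)) with h0 | h0
    · rw [h0]; simp [pre]
    · have := ih (L₁ := L₁ ++ [pre a n]) (a := b) (by simp [hL]) (by rw [hb 0 h0]; exact hlt)
      refine List.IsPrefix.trans ?_ this
      rw [← pre_congr hb]
      exact pre_prefix_pre (Nat.sub_le _ _)

/-! ### The necklace that contains a given index of the cycle. -/

/-- The total length of the aperiodic prefixes. -/
noncomputable def totalLength (L : List (List ℕ)) : ℕ :=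
  (L.map fun s => (aperiodicPrefix s).length).sum

theorem length_flatten_map (L : List (List ℕ)) :
    (L.map aperiodicPrefix).flatten.length = totalLength L := by
  simp [totalLength, List.length_flatten, Function.comp_def]

theorem totalLength_append (L L' : List (List ℕ)) :
    totalLength (L ++ L') = totalLength L + totalLength L' := by simp [totalLength]

theorem totalLength_cons (s : List ℕ) (L : List (List ℕ)) :
    totalLength (s :: L) = (aperiodicPrefix s).length + totalLength L := by simp [totalLength]

theorem pre_le_top {k n : ℕ} {b : ℕ → ℕ} (hb : ∀ i < n, b i ≤ k) : pre b n ≤ pre (fun _ => k) n := by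
  refine not_lt.1 fun h => ?_
  obtain ⟨j, hj, -, h⟩ := pre_lt_pre.1 h
  exact absurd (hb j hj) (not_le.2 h)

theorem le_top_of_mem_heavyStrings {k n w : ℕ} {s : List ℕ} (h : s ∈ heavyStrings k n w) :
    s ≤ pre (fun _ => k) n := by
  obtain ⟨b, rfl⟩ := exists_eq_pre (mem_heavyStrings.1 h).1.1
  exact pre_le_top fun i hi => ((pre_mem_heavyStrings.1 h).1 i hi).2

/-- No string exceeds k^n, so with b = k^n every class is counted. -/
theorem card_heavyStrings {k n w : ℕ} (hn : 1 ≤ n) :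
    (heavyStrings k n w).card = totalLength (necklaces k n w) := by
  rw [card_heavyStrings_eq hn fun _ => k, List.filter_eq_self.2, Finset.card_eq_zero.2]
  · simp [totalLength]
  · refine Finset.eq_empty_of_forall_notMem fun s hs => ?_
    have h := mem_aboveStrings.1 hs
    have := h.2 0
    rw [List.rotate_zero] at this
    exact absurd (le_top_of_mem_heavyStrings (mem_heavyStrings.2 h.1)) (not_le.2 this)
  · intro s hs
    simpa using le_top_of_mem_heavyStrings (mem_necklaces.1 hs).1

/-- `a` is the least string such that at most `R` heavy strings have all rotations above it. -/
structure Target (k n w R : ℕ) (a : ℕ → ℕ) : Prop where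
  symbol : ∀ i < n, 1 ≤ a i ∧ a i ≤ k
  isPre : IsPre a n
  le : (aboveStrings k n w a).card ≤ R
  lt : ∀ b, pre b n < pre a n → R < (aboveStrings k n w b).card

theorem Target.unique {k n w R : ℕ} {a a' : ℕ → ℕ} (h : Target k n w R a)
    (h' : Target k n w R a') : pre a n = pre a' n := by
  rcases lt_trichotomy (pre a n) (pre a' n) with hlt | he | hlt
  · have := h'.lt a hlt; have := h.le; omega
  · exact he
  · have := h.lt a' hlt; have := h'.le; omega

theorem card_aboveStrings_of_split {k n w : ℕ} {a : ℕ → ℕ} {L₁ L₂ : List (List ℕ)} (hn : 1 ≤ n)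
    (hL : necklaces k n w = L₁ ++ pre a n :: L₂) :
    (aboveStrings k n w a).card = totalLength L₂ := by
  have h := card_heavyStrings_eq (k := k) (w := w) hn a
  have hp := pairwise_necklaces k n w
  rw [hL, List.pairwise_append, List.pairwise_cons] at hp
  obtain ⟨-, ⟨hp2, hp3⟩, hp1⟩ := hp
  have h1 : L₁.filter (· ≤ pre a n) = L₁ :=
    List.filter_eq_self.2 fun s hs => by simpa using (hp1 s hs _ (by simp)).le
  have h2 : L₂.filter (· ≤ pre a n) = [] :=
    List.filter_eq_nil_iff.2 fun s hs => by simpa using hp2 s hs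
  rw [card_heavyStrings hn, hL, List.filter_append, List.filter_cons, h1, h2] at h
  simp only [le_refl, decide_true, if_true] at h
  have e : ((L₁ ++ [pre a n]).map fun s => (aperiodicPrefix s).length).sum =
    totalLength (L₁ ++ [pre a n]) := rfl
  rw [e] at h
  simp only [totalLength_append, totalLength_cons] at h
  have : totalLength [] = 0 := rfl
  omega

theorem lt_card_aboveStrings_of_split {k n w : ℕ} {a b : ℕ → ℕ} {L₁ L₂ : List (List ℕ)}
    (hn : 1 ≤ n) (hL : necklaces k n w = L₁ ++ pre a n :: L₂) (hb : pre b n < pre a n) :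
    totalLength (pre a n :: L₂) ≤ (aboveStrings k n w b).card := by
  have h := card_heavyStrings_eq (k := k) (w := w) hn b
  have hp := pairwise_necklaces k n w
  rw [hL, List.pairwise_append, List.pairwise_cons] at hp
  obtain ⟨-, ⟨hp2, hp3⟩, hp1⟩ := hp
  have h2 : (pre a n :: L₂).filter (· ≤ pre b n) = [] := by
    refine List.filter_eq_nil_iff.2 fun s hs => ?_
    rcases List.mem_cons.1 hs with rfl | hs
    · simpa using hb
    · simpa using hb.trans (hp2 s hs)
  rw [card_heavyStrings hn, hL, List.filter_append, h2, List.append_nil,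
    totalLength_append] at h
  have : ((L₁.filter (· ≤ pre b n)).map fun s => (aperiodicPrefix s).length).sum ≤
      totalLength L₁ := (List.filter_sublist.map _).sum_le_sum (by simp)
  omega

/-- Counted from the end of the cycle, position R (from 0) lies in the aperiodic prefix of a. -/
theorem target_of_split {k n w R : ℕ} {a : ℕ → ℕ} {L₁ L₂ : List (List ℕ)} (hn : 1 ≤ n)
    (hL : necklaces k n w = L₁ ++ pre a n :: L₂) (h1 : totalLength L₂ ≤ R)
    (h2 : R < totalLength (pre a n :: L₂)) : Target k n w R a := by
  have hmem : pre a n ∈ necklaces k n w := by simp [hL]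
  rw [mem_necklaces, pre_mem_heavyStrings] at hmem
  refine ⟨hmem.1.1, hmem.2.isPre, ?_, fun b hb => ?_⟩
  · rwa [card_aboveStrings_of_split hn hL]
  · exact h2.trans_le (lt_card_aboveStrings_of_split hn hL hb)

theorem exists_split (L : List (List ℕ)) {R : ℕ} (h : R < totalLength L) :
    ∃ L₁ s L₂, L = L₁ ++ s :: L₂ ∧ totalLength L₂ ≤ R ∧ R < totalLength (s :: L₂) := by
  induction L with
  | nil => simp [totalLength] at h
  | cons s L ih =>
    by_cases hR : R < totalLength L
    · obtain ⟨L₁, t, L₂, rfl, h1, h2⟩ := ih hR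
      exact ⟨s :: L₁, t, L₂, rfl, h1, h2⟩
    · exact ⟨[], s, L, rfl, not_lt.1 hR, h⟩

theorem exists_target {k n w R : ℕ} (hn : 1 ≤ n) (hR : R < (heavyStrings k n w).card) :
    ∃ L₁ a L₂, necklaces k n w = L₁ ++ pre a n :: L₂ ∧ totalLength L₂ ≤ R ∧
      R < totalLength (pre a n :: L₂) ∧ Target k n w R a := by
  rw [card_heavyStrings hn] at hR
  obtain ⟨L₁, s, L₂, hL, h1, h2⟩ := exists_split _ hR
  have hs : s ∈ necklaces k n w := by simp [hL]
  obtain ⟨a, rfl⟩ := exists_eq_pre (mem_heavyStrings.1 (mem_necklaces.1 hs).1).1.1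
  exact ⟨L₁, a, L₂, hL, h1, h2, target_of_split hn hL h1 h2⟩

/-- `Target` only asks for `IsPre`; by uniqueness its solution is nevertheless a heavy necklace. -/
theorem Target.exists_split {k n w R : ℕ} {a : ℕ → ℕ} (hn : 1 ≤ n)
    (hR : R < (heavyStrings k n w).card) (h : Target k n w R a) :
    ∃ L₁ L₂, necklaces k n w = L₁ ++ pre a n :: L₂ ∧ totalLength L₂ ≤ R ∧
      R < totalLength (pre a n :: L₂) := by
  obtain ⟨L₁, a', L₂, hL, h1, h2, h3⟩ := exists_target hn hR
  rw [← h.unique h3] at hL h2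
  exact ⟨L₁, L₂, hL, h1, h2⟩

theorem hasRank_of_prefix {u s : List ℕ} {r : ℕ} (h1 : 1 ≤ r) (h2 : r ≤ u.length)
    (h : s <+: u.drop (r - 1) ++ u) : HasRank u s r := by
  refine ⟨h1, h2, fun i hi => ?_⟩
  have hlen := h.length_le
  simp only [List.length_append, List.length_drop] at hlen
  obtain ⟨v, hv⟩ := h
  have e : s[i]? = (u.drop (r - 1) ++ u)[i]? := by rw [← hv, List.getElem?_append_left hi]
  rw [e]
  by_cases hc : i < u.length - (r - 1)
  · rw [List.getElem?_append_left (by simpa using hc), List.getElem?_drop,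
      Nat.mod_eq_of_lt (by omega)]
  · rw [List.getElem?_append_right (by simpa using hc), List.length_drop]
    have : r - 1 + i = (i - (u.length - (r - 1))) + u.length := by omega
    rw [this, Nat.add_mod_right, Nat.mod_eq_of_lt (by omega)]

end BoundedWeight

/-! ### Unranking in terms of the number of strings above a given string -/

namespace BoundedWeight

/-- `a` up to position `t`, then the symbol `c`, then only `k`. -/
def probe (k : ℕ) (a : ℕ → ℕ) (t c i : ℕ) : ℕ := if i < t then a i else if i = t then c else k

/-- Since the tail of a probe is as large as possible, the probe is below a exactly when c < a_t.
With `Target.probe_le` this makes comparing the count with R a test for the symbol a_t. -/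
theorem Target.lt_probe {k n w R t c : ℕ} {a : ℕ → ℕ} (h : Target k n w R a) (ht : t < n)
    (hc : c < a t) : R < (aboveStrings k n w (probe k a t c)).card :=
  h.lt _ (pre_lt_pre.2 ⟨t, ht, fun i hi => by simp [probe, hi], by simpa [probe] using hc⟩)

theorem Target.pre_le_probe {k n w R t c : ℕ} {a : ℕ → ℕ} (h : Target k n w R a)
    (hc : a t ≤ c) : pre a n ≤ pre (probe k a t c) n := by
  refine not_lt.1 fun hlt => ?_
  obtain ⟨j, hj, -, h2⟩ := pre_lt_pre.1 hlt
  have := (h.symbol j hj).2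
  unfold probe at h2
  split_ifs at h2 with h3 h4
  · omega
  · subst h4; omega
  · omega

theorem Target.probe_le {k n w R t c : ℕ} {a : ℕ → ℕ} (h : Target k n w R a)
    (hc : a t ≤ c) : (aboveStrings k n w (probe k a t c)).card ≤ R := by
  refine le_trans (Finset.card_le_card fun s hs => ?_) h.le
  rw [mem_aboveStrings] at hs ⊢
  exact ⟨hs.1, fun i => (h.pre_le_probe hc).trans_lt (hs.2 i)⟩

/-- Before t nothing changes, at t the symbol has not decreased, and behind t the compared symbol is
k, which nothing exceeds. For c < a_t this may fail, and the failure itself shows that c is too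
small. -/
theorem Target.isPre_probe {k n w R t c : ℕ} {a : ℕ → ℕ} (h : Target k n w R a)
    (hc : a t ≤ c) (hck : c ≤ k) : IsPre (probe k a t c) n := by
  intro d l hl heq
  rcases Nat.eq_zero_or_pos d with rfl | hd
  · simp
  rcases lt_trichotomy (d + l) t with h1 | h1 | h1
  · have := h.isPre d l hl fun i hi => by
      have := heq i hi
      simpa [probe, show d + i < t by omega, show i < t by omega] using this
    simpa [probe, h1, show l < t by omega] using this
  · have := h.isPre d l hl fun i hi => by
      have := heq i hi
      simpa [probe, show d + i < t by omega, show i < t by omega] using this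
    rw [h1] at this ⊢
    simp [probe, show l < t by omega]
    omega
  · have h2 : probe k a t c (d + l) = k := by
      simp [probe, show ¬ d + l < t by omega, show d + l ≠ t by omega]
    rw [h2, probe]
    split_ifs
    · exact (h.symbol l (by omega)).2
    · exact hck
    · exact le_rfl

theorem Target.symbol_probe {k n w R t c : ℕ} {a : ℕ → ℕ} (h : Target k n w R a) (hk : 1 ≤ k)
    (hc : 1 ≤ c) (hck : c ≤ k) : ∀ i < n, 1 ≤ probe k a t c i ∧ probe k a t c i ≤ k := by
  intro i hi
  unfold probe
  split_ifs
  · exact h.symbol i hi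
  · exact ⟨hc, hck⟩
  · exact ⟨hk, le_rfl⟩

theorem isPre_one (n : ℕ) : IsPre (fun _ => 1) n := fun _ _ _ _ => le_rfl

/-- The least string 1^n is the only one that has a rotation not above 1^n. So one run of the
counting program on 1^n also yields the total. -/
theorem card_heavyStrings_eq_one {k n w : ℕ} (hk : 1 ≤ k) :
    (heavyStrings k n w).card =
      (aboveStrings k n w fun _ => 1).card + if w ≤ n then 1 else 0 := by
  have hmem : pre (fun _ => 1) n ∈ heavyStrings k n w ↔ w ≤ n := by
    rw [pre_mem_heavyStrings]; simp [hk]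
  have hrep : pre (fun _ => 1) n = List.replicate n 1 := by
    simp [pre]
  have key : ∀ s ∈ heavyStrings k n w, (¬ ∀ i, pre (fun _ => 1) n < s.rotate i) →
      s = pre (fun _ => 1) n := by
    intro s hs h
    push Not at h
    obtain ⟨i, hi⟩ := h
    have hsi := (heavyStrings_rotate i).2 hs
    obtain ⟨b, hb⟩ := exists_eq_pre (mem_heavyStrings.1 hsi).1.1
    rw [hb] at hi hsi
    have hsym := (pre_mem_heavyStrings.1 hsi).1
    have : pre b n = pre (fun _ => 1) n := by
      refine le_antisymm hi (not_lt.1 fun hlt => ?_)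
      obtain ⟨j, hj, -, h2⟩ := pre_lt_pre.1 hlt
      have := (hsym j hj).1
      omega
    rw [this, hrep] at hb
    rw [hrep]
    refine List.rotate_injective i ?_
    dsimp only
    rw [hb, List.rotate_replicate]
  classical
  rw [← Finset.card_filter_add_card_filter_not (s := heavyStrings k n w)
    (fun s => ∀ i, pre (fun _ => 1) n < s.rotate i)]
  have e1 : (heavyStrings k n w).filter (fun s => ∀ i, pre (fun _ => 1) n < s.rotate i) =
      aboveStrings k n w fun _ => 1 := by
    ext s; rw [mem_aboveStrings, Finset.mem_filter, mem_heavyStrings]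
  have e2 : (heavyStrings k n w).filter (fun s => ¬ ∀ i, pre (fun _ => 1) n < s.rotate i) =
      if w ≤ n then {pre (fun _ => 1) n} else ∅ := by
    ext s
    rw [Finset.mem_filter]
    constructor
    · rintro ⟨h1, h2⟩
      obtain rfl := key s h1 h2
      simp [hmem.1 h1]
    · split_ifs with hw
      · intro h
        obtain rfl := Finset.mem_singleton.1 h
        refine ⟨hmem.2 hw, fun h => ?_⟩
        have := h 0
        simp at this
      · simp
  rw [e1, e2]
  split_ifs <;> simp

theorem aperiodicPrefix_top {k n : ℕ} (hn : 1 ≤ n) :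
    aperiodicPrefix (pre (fun _ => k) n) = [k] := by
  have hne : pre (fun _ => k) n ≠ [] := by
    intro h; have := congrArg List.length h; simp at this; omega
  have hrep : pre (fun _ => k) n = List.replicate n k := by simp [pre]
  have h1 := period_le (s := pre (fun _ => k) n) one_pos (by rw [hrep]; simp)
  have h2 := period_pos hne
  rw [aperiodicPrefix_eq hne, show period (pre (fun _ => k) n) = 1 by omega, take_pre hn]
  simp [pre]

theorem top_mem_necklaces {k n w : ℕ} (hk : 1 ≤ k)
    (h : (heavyStrings k n w).Nonempty) : pre (fun _ => k) n ∈ necklaces k n w := by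
  obtain ⟨s, hs⟩ := h
  obtain ⟨b, rfl⟩ := exists_eq_pre (mem_heavyStrings.1 hs).1.1
  rw [pre_mem_heavyStrings] at hs
  rw [mem_necklaces, pre_mem_heavyStrings]
  refine ⟨⟨fun _ _ => ⟨hk, le_rfl⟩, hs.2.trans (Finset.sum_le_sum fun i hi =>
    (hs.1 i (Finset.mem_range.1 hi)).2)⟩, fun i => ?_⟩
  simp [pre]

/-- A prefix of a heavy string, preceded by symbols `k`, is heavy. -/
theorem replicate_append_mem_heavyStrings {k n w i m : ℕ} {a : ℕ → ℕ} (hk : 1 ≤ k)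
    (ha : pre a n ∈ heavyStrings k n w) (hi : i + m = n) :
    List.replicate i k ++ pre a m ∈ heavyStrings k n w := by
  rw [pre_mem_heavyStrings] at ha
  rw [mem_heavyStrings]
  refine ⟨⟨by simpa, fun y hy => ?_⟩, ha.2.trans ?_⟩
  · rcases List.mem_append.1 hy with h | h
    · obtain rfl := (List.mem_replicate.1 h).2; omega
    · obtain ⟨j, hj, rfl⟩ := mem_pre h; exact ha.1 j (by omega)
  · rw [← hi, add_comm, Finset.sum_range_add, List.sum_append, sum_pre, List.sum_replicate,
      add_comm, smul_eq_mul]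
    refine Nat.add_le_add_right ?_ _
    refine (Finset.sum_le_card_nsmul _ _ k fun j hj => ?_).trans (by simp)
    have := Finset.mem_range.1 hj
    exact (ha.1 (m + j) (by omega)).2

/-- The string `s` is heavy and has rank `r`. -/
def IsRanked (k n w r : ℕ) (s : List ℕ) : Prop :=
  s ∈ heavyStrings k n w ∧ HasRank (cycle k n w) s r

theorem length_cycle {k n w : ℕ} (hn : 1 ≤ n) :
    (cycle k n w).length = (heavyStrings k n w).card := by
  rw [cycle, length_flatten_map, card_heavyStrings hn]

theorem drop_eq_replicate {k n i : ℕ} {a : ℕ → ℕ}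
    (h : ¬ ∃ t, n - i ≤ t ∧ t < n ∧ a t < k) (hk : ∀ j < n, a j ≤ k) (hi : i ≤ n) :
    (pre a n).drop (n - i) = List.replicate i k := by
  push Not at h
  rw [drop_pre]
  refine List.eq_replicate_iff.2 ⟨by simp; omega, fun y hy => ?_⟩
  obtain ⟨j, hj, rfl⟩ := mem_pre hy
  exact le_antisymm (hk _ (by omega)) (h _ (by omega) (by omega))

/-- The aperiodic prefix is also the suffix of a of the same length (`aperiodicPrefix_eq_drop`), so
its last i symbols are the last i symbols of a. -/
theorem drop_cycle {k n w i r : ℕ} {a : ℕ → ℕ} {L₁ L₂ : List (List ℕ)} (hn : 1 ≤ n)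
    (hL : necklaces k n w = L₁ ++ pre a n :: L₂) (hi : i ≤ period (pre a n))
    (hr : r - 1 = totalLength L₁ + (period (pre a n) - i)) :
    (cycle k n w).drop (r - 1) =
      (pre a n).drop (n - i) ++ (L₂.map aperiodicPrefix).flatten := by
  have hne : pre a n ≠ [] := by
    intro h; have := congrArg List.length h; simp at this; omega
  have hd := period_le_length hne
  have hl := length_aperiodicPrefix hne
  rw [length_pre] at hd
  rw [cycle, hL, List.map_append, List.flatten_append, List.map_cons, List.flatten_cons,
    List.drop_append, length_flatten_map, List.drop_eq_nil_of_le (by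
      rw [length_flatten_map]; omega), List.nil_append,
    List.drop_append_of_le_length (by omega), aperiodicPrefix_eq_drop hne, List.drop_drop,
    length_pre]
  congr 2
  omega

/-- The rank of the remaining part of the cycle that is used to complete a string. -/
def nextTarget (total g : ℕ) : ℕ := if g = 0 then total - 1 else g - 1

/-- Any earlier necklace would contribute at least one symbol, leaving fewer than N from a on. -/
theorem Target.first {k n w : ℕ} {a : ℕ → ℕ} (hn : 1 ≤ n) (hT : 0 < (heavyStrings k n w).card)
    (h : Target k n w ((heavyStrings k n w).card - 1) a) :
    ∃ L, necklaces k n w = pre a n :: L := by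
  obtain ⟨L₁, L₂, hL, h1, h2⟩ := h.exists_split hn (by omega)
  cases L₁ with
  | nil => exact ⟨L₂, hL⟩
  | cons s L₁ =>
    have h3 := card_heavyStrings (k := k) (w := w) hn
    rw [hL, totalLength_append, totalLength_cons] at h3
    have hs : s ∈ necklaces k n w := by simp [hL]
    have hne := ne_nil_of_mem_heavyStrings hn (mem_necklaces.1 hs).1
    have := period_pos hne
    rw [length_aperiodicPrefix hne] at h3
    omega

theorem first_lt_of_mem_necklaces {k n w : ℕ} {a : ℕ → ℕ} (hn : 1 ≤ n)
    (ha : pre a n ∈ necklaces k n w) (hne : pre a n ≠ pre (fun _ => k) n) : a 0 < k := by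
  rw [mem_necklaces, pre_mem_heavyStrings] at ha
  have hk : ∀ i < n, a i ≤ k := fun i hi => (ha.1.1 i hi).2
  refine lt_of_le_of_ne (hk 0 hn) fun h0 => hne ?_
  exact pre_congr (ha.2.isPre.eq_of_first hk h0)

/-- If any string is heavy then so is k^n; hence the cycle is the single symbol k, read n times
around. -/
theorem isRanked_of_card_eq_one {k n w : ℕ} (hn : 1 ≤ n) (hk : 1 ≤ k)
    (hT : (heavyStrings k n w).card = 1) :
    IsRanked k n w 1 (List.replicate n k) ∧
      ∀ a, Target k n w 0 a → pre a n = List.replicate n k := by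
  have hmem := top_mem_necklaces hk (Finset.card_pos.1 (by omega : 0 < (heavyStrings k n w).card))
  have hrep : pre (fun _ => k) n = List.replicate n k := by simp [pre]
  have huniq : ∀ s ∈ heavyStrings k n w, s = List.replicate n k := by
    obtain ⟨u, hu⟩ := Finset.card_eq_one.1 hT
    intro s hs
    have h1 := (mem_necklaces.1 hmem).1
    rw [hu, Finset.mem_singleton] at hs h1
    rw [hs, ← h1, hrep]
  obtain ⟨L₁, a, L₂, hL, -, -, hT'⟩ := exists_target (k := k) (n := n) (w := w) (R := 0) hn
    (by omega)
  have ha : pre a n = List.replicate n k :=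
    huniq _ (mem_necklaces.1 (by simp [hL] : pre a n ∈ necklaces k n w)).1
  refine ⟨⟨?_, le_rfl, by rw [length_cycle hn, hT], fun i hi => ?_⟩,
    fun a' ha' => (ha'.unique hT').trans ha⟩
  · rw [← hrep]; exact (mem_necklaces.1 hmem).1
  · have hcyc : cycle k n w = [k] := by
      have h0 : totalLength L₁ = 0 ∧ totalLength L₂ = 0 := by
        have h := card_heavyStrings (k := k) (w := w) hn
        rw [hL, totalLength_append, totalLength_cons, ha, ← hrep, aperiodicPrefix_top hn] at h
        simp at h; omega
      rw [← length_flatten_map, ← length_flatten_map, List.length_eq_zero_iff,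
        List.length_eq_zero_iff] at h0
      rw [cycle, hL, List.map_append, List.flatten_append, List.map_cons, List.flatten_cons,
        h0.1, h0.2, ha, ← hrep, aperiodicPrefix_top hn]
      rfl
    rw [hcyc, List.length_singleton, Nat.mod_one, List.getElem?_replicate, if_pos (by simpa using hi)]
    rfl

/-- What the program needs: its truncated subtractions do not lose anything, the suffix length i is
at most n, and the second search has an admissible target. -/
theorem Target.bounds {k n w r : ℕ} {a : ℕ → ℕ} (hn : 1 ≤ n) (h1 : 1 ≤ r)
    (hr : r ≤ (heavyStrings k n w).card)
    (ha : Target k n w ((heavyStrings k n w).card - r) a) :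
    (aboveStrings k n w a).card ≤ (heavyStrings k n w).card - r ∧
      (heavyStrings k n w).card - r + 1 - (aboveStrings k n w a).card ≤ n ∧
      nextTarget (heavyStrings k n w).card (aboveStrings k n w a).card <
        (heavyStrings k n w).card := by
  obtain ⟨L₁, L₂, hL, h2, h3⟩ := ha.exists_split hn (by omega)
  have hne : pre a n ≠ [] := by
    intro h; have := congrArg List.length h; simp at this; omega
  have hd := period_le_length hne
  rw [length_pre] at hd
  rw [totalLength_cons, length_aperiodicPrefix hne] at h3
  have hg := card_aboveStrings_of_split hn hL
  have hle := ha.le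
  refine ⟨hle, by omega, ?_⟩
  unfold nextTarget
  split_ifs <;> omega

/-- The string at rank `r` consists of the end of one necklace and the beginning of another,
where the necklace consisting of symbols `k` only contributes a single symbol. -/
theorem Target.isRanked {k n w r : ℕ} {a : ℕ → ℕ} (hn : 1 ≤ n) (hk : 1 ≤ k) (h1 : 1 ≤ r)
    (hr : r ≤ (heavyStrings k n w).card)
    (ha : Target k n w ((heavyStrings k n w).card - r) a) {i R : ℕ}
    (hi : i = (heavyStrings k n w).card - r + 1 - (aboveStrings k n w a).card)
    (hR : R = nextTarget (heavyStrings k n w).card (aboveStrings k n w a).card) {a' : ℕ → ℕ} :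
    (R = 0 ∧ i < n → Target k n w ((heavyStrings k n w).card - 1) a' →
      IsRanked k n w r ((pre a n).drop (n - i) ++ k :: pre a' (n - i - 1))) ∧
    (¬ (R = 0 ∧ i < n) → Target k n w R a' →
      IsRanked k n w r ((pre a n).drop (n - i) ++ pre a' (n - i))) := by
  have hrep : pre (fun _ => k) n = List.replicate n k := by simp [pre]
  have hin : i ≤ n := hi ▸ (ha.bounds hn h1 hr).2.1
  -- With a single heavy string the first necklace is k^n itself, and the argument that the cycle
  -- starts with its first necklace breaks down.
  rcases Nat.lt_or_ge 1 (heavyStrings k n w).card with hT | hT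
  swap
  · have hT1 : (heavyStrings k n w).card = 1 := by omega
    obtain rfl : r = 1 := by omega
    obtain ⟨h2, h3⟩ := isRanked_of_card_eq_one hn hk hT1
    have e1 := h3 a (by rwa [hT1] at ha)
    have hg : (aboveStrings k n w a).card = 0 := by have := ha.le; omega
    rw [hT1, hg] at hi hR
    have hR0 : R = 0 := by simp [hR, nextTarget]
    have hi1 : i = 1 := by omega
    have hpre : ∀ m ≤ n, ∀ a', Target k n w 0 a' → pre a' m = List.replicate m k := by
      intro m hm a' ha'
      have := congrArg (List.take m) (h3 a' ha')
      rwa [take_pre hm, List.take_replicate, min_eq_left hm] at this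
    rw [e1, hi1, hR0, hT1]
    constructor
    · rintro ⟨-, hlt⟩ ha'
      rw [hpre _ (by omega) a' ha', ← List.replicate_succ, List.drop_replicate,
        List.replicate_append_replicate,
        show n - (n - 1) + (n - 1 - 1 + 1) = n by omega]
      exact h2
    · intro _ ha'
      rw [hpre _ (by omega) a' ha', List.drop_replicate,
        List.replicate_append_replicate, show n - (n - 1) + (n - 1) = n by omega]
      exact h2
  obtain ⟨L₁, L₂, hL, h2, h3⟩ := ha.exists_split hn (by omega)
  have hamem : pre a n ∈ necklaces k n w := by simp [hL]
  have haheavy := (mem_necklaces.1 hamem).1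
  have hak : ∀ j < n, a j ≤ k := fun j hj => (ha.symbol j hj).2
  have hne : pre a n ≠ [] := ne_nil_of_mem_heavyStrings hn haheavy
  have hg := card_aboveStrings_of_split hn hL
  have htot := card_heavyStrings (k := k) (w := w) hn
  rw [hL, totalLength_append, totalLength_cons, length_aperiodicPrefix hne] at htot
  rw [totalLength_cons, length_aperiodicPrefix hne] at h3
  rw [hg] at hi hR
  have hdrop := drop_cycle (r := r) (i := i) hn hL (by omega) (by omega)
  have hlen := length_cycle (k := k) (w := w) hn
  have hp := pairwise_necklaces k n w
  rw [hL, List.pairwise_append, List.pairwise_cons] at hp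
  obtain ⟨-, ⟨hp2, hp3⟩, -⟩ := hp
  have htop := top_mem_necklaces hk (Finset.card_pos.1 (by omega : 0 < (heavyStrings k n w).card))
  have hxs : ∀ z, (pre a n).drop (n - i) ++ z <+: (cycle k n w).drop (r - 1) ++ cycle k n w ↔
      z <+: (L₂.map aperiodicPrefix).flatten ++ cycle k n w := by
    intro z
    rw [hdrop, List.append_assoc, List.prefix_append_right_inj]
  have hwrap : Target k n w ((heavyStrings k n w).card - 1) a' →
      pre a' n ∈ heavyStrings k n w ∧ pre a' n <+: cycle k n w := by
    intro ha'
    obtain ⟨L, hL'⟩ := ha'.first hn (by omega)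
    have hmem' : pre a' n ∈ necklaces k n w := by simp [hL']
    refine ⟨(mem_necklaces.1 hmem').1, ?_⟩
    -- If the first necklace were k^n, it would be the only one and the cycle would have length 1.
    have hne' : pre a' n ≠ pre (fun _ => k) n := by
      intro he
      have hnil : L = [] := by
        rw [List.eq_nil_iff_forall_not_mem]
        intro s hs
        have hs' : s ∈ necklaces k n w := by simp [hL', hs]
        have hp := pairwise_necklaces k n w
        rw [hL', List.pairwise_cons] at hp
        have := hp.1 s hs
        rw [he] at this
        exact absurd (le_top_of_mem_heavyStrings (mem_necklaces.1 hs').1) (not_le.2 this)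
      have := card_heavyStrings (k := k) (w := w) hn
      rw [hL', hnil, he, totalLength_cons, aperiodicPrefix_top hn] at this
      simp [totalLength] at this
      omega
    have := necklace_prefix_flatten (L₁ := []) hn hL' (first_lt_of_mem_necklaces hn hmem' hne')
    rwa [← hL'] at this
  have hwhole : i = n → ∀ b, IsRanked k n w r ((pre a n).drop (n - i) ++ pre b (n - i)) := by
    intro hin' b
    have e : pre b (n - i) = [] := by rw [hin', Nat.sub_self]; rfl
    rw [e]
    refine ⟨?_, hasRank_of_prefix h1 (by omega) ((hxs _).2 (by simp))⟩
    rw [hin']; simpa using haheavy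
  -- Nothing follows: a is k^n, and reading continues with the first necklace after the wrap.
  cases L₂ with
  | nil =>
    have hatop : pre a n = pre (fun _ => k) n := by
      by_contra hne'
      obtain ⟨b, L₃, h, -⟩ := next_necklace hL le_rfl hn (first_lt_of_mem_necklaces hn hamem hne')
      simp at h
    have hd1 : period (pre a n) = 1 := by
      rw [← length_aperiodicPrefix hne, hatop, aperiodicPrefix_top hn]; rfl
    have h0 : totalLength ([] : List (List ℕ)) = 0 := rfl
    rw [h0] at hi hR h2 h3
    have hR' : R = (heavyStrings k n w).card - 1 := by simp [hR, nextTarget]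
    refine ⟨fun h => by omega, fun _ ha' => ?_⟩
    rw [hR'] at ha'
    obtain ⟨hw1, hw2⟩ := hwrap ha'
    refine ⟨?_, hasRank_of_prefix h1 (by omega) ((hxs _).2 ?_)⟩
    · rw [hatop, hrep, List.drop_replicate, show n - (n - i) = i by omega]
      exact replicate_append_mem_heavyStrings hk hw1 (by omega)
    · simpa using (pre_prefix_pre (Nat.sub_le _ _)).trans hw2
  | cons s L₃ =>
    have hs : s ∈ necklaces k n w := by simp [hL]
    obtain ⟨b, rfl⟩ := exists_eq_pre (mem_heavyStrings.1 (mem_necklaces.1 hs).1).1.1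
    have hbne : pre b n ≠ [] := ne_nil_of_mem_heavyStrings hn (mem_necklaces.1 hs).1
    have hbpos := period_pos hbne
    have hL' : necklaces k n w = (L₁ ++ [pre a n]) ++ pre b n :: L₃ := by simp [hL]
    have hane : pre a n ≠ pre (fun _ => k) n := by
      intro he
      have := hp2 _ (List.mem_cons_self)
      rw [he] at this
      exact absurd (le_top_of_mem_heavyStrings (mem_necklaces.1 hs).1) (not_le.2 this)
    have ha0 := first_lt_of_mem_necklaces hn hamem hane
    rw [totalLength_cons, length_aperiodicPrefix hbne] at hg h2 h3 hi hR htot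
    have hR' : R = period (pre b n) + totalLength L₃ - 1 := by
      rw [hR, nextTarget, if_neg (by omega)]
    have hagree : ∀ t, n - i ≤ t → t < n → a t < k → ∀ j < n - i, b j = a j := by
      intro t ht1 ht2 hat
      obtain ⟨b', L', h, hb'⟩ := next_necklace hL ht1 ht2 hat
      obtain ⟨h, -⟩ := List.cons.inj h
      intro j hj
      rw [pre_inj h (by omega), hb' j hj]
    -- The next necklace is the last one, k^n. Here R = 0; it supplies one k before the wrap, unless
    -- i = n and nothing is left to read.
    cases L₃ with
    | nil =>
      have hbtop : pre b n = pre (fun _ => k) n := by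
        by_contra hne'
        obtain ⟨b, L₃, h, -⟩ :=
          next_necklace hL' le_rfl hn (first_lt_of_mem_necklaces hn hs hne')
        simp at h
      have hd1 : period (pre b n) = 1 := by
        rw [← length_aperiodicPrefix hbne, hbtop, aperiodicPrefix_top hn]; rfl
      have h0 : totalLength ([] : List (List ℕ)) = 0 := rfl
      rw [hd1, h0] at hR'
      refine ⟨fun h ha' => ?_, fun h _ => hwhole (by omega) _⟩
      obtain ⟨hw1, hw2⟩ := hwrap ha'
      -- A symbol below k among the last i would make k^n agree with a at index 0, but a starts
      -- below k.
      have hx : (pre a n).drop (n - i) = List.replicate i k := by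
        refine drop_eq_replicate ?_ hak hin
        rintro ⟨t, ht1, ht2, ht3⟩
        have := hagree t ht1 ht2 ht3 0 (by omega)
        have h4 := pre_inj hbtop (i := 0) (by omega)
        omega
      refine ⟨?_, hasRank_of_prefix h1 (by omega) ((hxs _).2 ?_)⟩
      · rw [hx]
        have := replicate_append_mem_heavyStrings (i := i + 1) (m := n - i - 1) hk hw1 (by omega)
        rwa [List.replicate_succ', List.append_assoc, List.singleton_append] at this
      · rw [hbtop, List.map_cons, aperiodicPrefix_top hn]
        simpa using (pre_prefix_pre (by omega)).trans hw2
    | cons c L₄ =>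
      have hc : c ∈ necklaces k n w := by simp [hL]
      have hcne : c ≠ [] := ne_nil_of_mem_heavyStrings hn (mem_necklaces.1 hc).1
      have hcpos := period_pos hcne
      have hcl : totalLength (c :: L₄) = period c + totalLength L₄ := by
        rw [totalLength_cons, length_aperiodicPrefix hcne]
      have hbne' : pre b n ≠ pre (fun _ => k) n := by
        intro he
        have := (List.pairwise_cons.1 hp3).1 _ (List.mem_cons_self)
        rw [he] at this
        exact absurd (le_top_of_mem_heavyStrings (mem_necklaces.1 hc).1) (not_le.2 this)
      refine ⟨fun h => by omega, fun _ ha' => ?_⟩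
      have hbT : Target k n w R b := target_of_split hn hL' (by omega) (by
        rw [totalLength_cons, length_aperiodicPrefix hbne]; omega)
      have hba : pre a' n = pre b n := ha'.unique hbT
      have hpp : pre a' (n - i) = pre b (n - i) := by
        rw [← take_pre (Nat.sub_le n i), hba, take_pre (Nat.sub_le n i)]
      rw [hpp]
      refine ⟨?_, hasRank_of_prefix h1 (by omega) ((hxs _).2 ?_)⟩
      -- If the suffix contains a symbol below k, the next necklace shares the missing prefix with
      -- a, so the string is a rotation of a. Otherwise the suffix is k^i, and moving a prefix of a
      -- heavy string behind it cannot lose weight.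
      · by_cases hall : ∃ t, n - i ≤ t ∧ t < n ∧ a t < k
        · obtain ⟨t, ht1, ht2, ht3⟩ := hall
          rw [pre_congr (hagree t ht1 ht2 ht3), ← take_pre (Nat.sub_le n i),
            ← List.rotate_eq_drop_append_take (by simp), heavyStrings_rotate]
          exact haheavy
        · rw [drop_eq_replicate hall hak hin]
          exact replicate_append_mem_heavyStrings hk (mem_necklaces.1 hs).1 (by omega)
      · exact ((pre_prefix_pre (Nat.sub_le _ _)).trans
          (necklace_prefix_flatten hn hL' (first_lt_of_mem_necklaces hn hs hbne'))).trans
          (List.prefix_append _ _)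

end BoundedWeight

/-! ### The counting program -/

namespace Structured

open BoundedWeight

/-- The constants of a run. -/
structure Ctx (n k w : ℕ) (σ : State) : Prop where
  n_eq : σ.s .n = n
  k_eq : σ.s .k = k
  w_eq : σ.s .w = w
  one : σ.s .one = 1
  two : σ.s .two = 2
  n1 : σ.s .n1 = n + 1
  k1 : σ.s .k1 = k + 1
  len : σ.s .len = w + 1
  bb : σ.s .bb = heapStart
  ba : σ.s .ba = heapStart + n

/-- The program assigns no constant. -/
def Stmt.keepsConstants (p : Stmt) : Bool :=
  [Var.n, .k, .w, .one, .two, .n1, .k1, .len, .bb, .ba].all fun x => !p.some (Op.assigns x)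

theorem Ctx.frame {n k w : ℕ} {σ σ' : State} (h : Ctx n k w σ) {p : Stmt} (hf : Frame p σ σ')
    (hp : p.keepsConstants = true) : Ctx n k w σ' := by
  simp only [Stmt.keepsConstants, List.all_cons, List.all_nil, Bool.and_true, Bool.and_eq_true,
    Bool.not_eq_true'] at hp
  obtain ⟨h1, h2, h3, h4, h5, h6, h7, h8, h9, h10⟩ := hp
  exact ⟨(hf.scalar _ h1).trans h.n_eq, (hf.scalar _ h2).trans h.k_eq, (hf.scalar _ h3).trans h.w_eq,
    (hf.scalar _ h4).trans h.one, (hf.scalar _ h5).trans h.two, (hf.scalar _ h6).trans h.n1,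
    (hf.scalar _ h7).trans h.k1, (hf.scalar _ h8).trans h.len, (hf.scalar _ h9).trans h.bb,
    (hf.scalar _ h10).trans h.ba⟩

/-- The bounds `M` on addresses and `W` on values are sufficient. -/
structure Lim (n k w M W : ℕ) : Prop where
  n_pos : 1 ≤ n
  w_le : w ≤ n * k
  k_pos : 1 ≤ k
  space : heapStart + n + (n + 1) * (w + 1) + (n * k + 2 * k + 2) ≤ M
  word : M ≤ W
  big : (n + 2) * (k ^ n + 2) ≤ W

/-- The address of a table entry. -/
def cell (n w t v : ℕ) : ℕ := heapStart + n + t * (w + 1) + v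

theorem cell_lt {n w t v t' v' : ℕ} (h : t' < t) (hv : v' ≤ w) : cell n w t' v' < cell n w t v := by
  have : (t' + 1) * (w + 1) ≤ t * (w + 1) := Nat.mul_le_mul_right _ h
  rw [Nat.succ_mul] at this
  unfold cell; omega

theorem Lim.cell_lt {n k w M W t v : ℕ} (h : Lim n k w M W) (ht : t ≤ n) (hv : v ≤ w) :
    cell n w t v < M := by
  have := h.space
  have h2 : t * (w + 1) ≤ n * (w + 1) := Nat.mul_le_mul_right _ ht
  rw [Nat.succ_mul] at this
  unfold cell; omega

/-- Sum over the last symbol of a block. -/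
def symbolLoop : Stmt :=
  .loop .c .k1 (.ops [.add .xa .ws .c, .sub .xa .v .xa, .add .xa .xa .m, .load .xa .xa,
    .add .acc .acc .xa, .mul .xa .xa .j, .add .g .g .xa, .add .c .c .one])

section

variable {n k w M W : ℕ}

/-- One pass feeds two sums: `acc` for the table entry and `g` with weight `j`. The row of remaining
length starts at address `m` and is abstracted to f. -/
theorem symbolLoop_spec (hl : Lim n k w M W) {σ : State} (hσ : Ctx n k w σ) {b : ℕ}
    {f : ℕ → ℕ} (hc : σ.s .c = b + 1) (hb : b ≤ k) (hv : σ.s .v ≤ w)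
    (hm : heapStart ≤ σ.s .m) (hmM : σ.s .m + w < M) (hf : ∀ y ≤ w, σ.h (σ.s .m + y) = f y)
    (hw : σ.s .ws + k ≤ W)
    (hacc : σ.s .acc + ∑ c ∈ Finset.Ioc b k, f (σ.s .v - (σ.s .ws + c)) ≤ W)
    (hg : σ.s .g + σ.s .j * ∑ c ∈ Finset.Ioc b k, f (σ.s .v - (σ.s .ws + c)) ≤ W) :
    Tri M W symbolLoop σ (10 * k + 2) fun σ' =>
      σ'.s .acc = σ.s .acc + ∑ c ∈ Finset.Ioc b k, f (σ.s .v - (σ.s .ws + c)) ∧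
      σ'.s .g = σ.s .g + σ.s .j * ∑ c ∈ Finset.Ioc b k, f (σ.s .v - (σ.s .ws + c)) := by
  -- Partial sums are at most the full sum, so bounding the final values suffices for all
  -- intermediate words.
  have hmono : ∀ i ≤ k - b, ∑ c ∈ Finset.Ioc b (b + i), f (σ.s .v - (σ.s .ws + c)) ≤
      ∑ c ∈ Finset.Ioc b k, f (σ.s .v - (σ.s .ws + c)) := fun i hi =>
    Finset.sum_le_sum_of_subset (Finset.Ioc_subset_Ioc_right (by omega))
  refine (Tri.loop_count (N := k - b) (T := 8) (fun i σ' => σ'.s .c = b + 1 + i ∧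
    σ'.s .acc = σ.s .acc + ∑ c ∈ Finset.Ioc b (b + i), f (σ.s .v - (σ.s .ws + c)) ∧
    σ'.s .g = σ.s .g + σ.s .j * ∑ c ∈ Finset.Ioc b (b + i), f (σ.s .v - (σ.s .ws + c)))
    ?_ ?_ ?_ ?_).time ?_
  · simp [hc]
  · rintro i σ' hfr ⟨h1, -, -⟩ hi
    rw [h1, (hσ.frame hfr rfl).k1]; omega
  · rintro i σ' hfr ⟨h1, h2, h3⟩ hi
    have h4 := hmono (i + 1) (by omega)
    have h5 := Nat.mul_le_mul_left (σ.s .j) h4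
    rw [← add_assoc, Finset.sum_Ioc_succ_top (by omega)] at h4 h5
    have hfv := hf (σ.s .v - (σ.s .ws + (b + i + 1))) (by omega)
    have e1 := hfr.scalar .ws rfl
    have e2 := hfr.scalar .v rfl
    have e3 := hfr.scalar .m rfl
    have e4 := hfr.scalar .j rfl
    have e5 := (hσ.frame hfr rfl).one
    have e6 := hfr.heap rfl
    have e7 : b + 1 + i = b + i + 1 := by omega
    rw [mul_add] at h5
    have hkM := hl.space
    have hMW := hl.word
    rw [add_comm] at hfv
    refine Tri.ops ?_ ?_
    · simp [SafeAll, Op.Safe, Op.exec, State.set, h1, h2, h3, e1, e2, e3,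
        e4, e5, e6, e7, hfv]
      rw [mul_comm (f _)]
      omega
    · simp [execAll, Op.exec, State.set, h1, h2, h3, e1, e2, e3,
        e4, e5, e6, e7, hfv, ← add_assoc b i 1]
      rw [Finset.sum_Ioc_succ_top (by omega)]
      refine ⟨by omega, by omega, by ring⟩
  · rintro σ' - ⟨-, h2, h3⟩
    rw [show b + (k - b) = k by omega] at h2 h3
    exact ⟨h2, h3⟩
  · have : k - b ≤ k := by omega
    omega

/-- Sum over the first block. -/
def blockLoop : Stmt :=
  .loop .j .t (.seq (.ops [.add .p .bb .j, .load .bj .p, .add .c .bj .one, .sub .m .t .j,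
    .sub .m .m .one, .mul .m .m .len, .add .m .m .ba, .add .j .j .one])
    (.seq symbolLoop (.ops [.add .ws .ws .bj])))

/-- The number of block sequences of length `t` and weight at least `v`, where each sequence is
weighted with the length of its first block. -/
noncomputable def wcnt (k : ℕ) (b : ℕ → ℕ) (t v : ℕ) : ℕ :=
  ∑ j ∈ Finset.range t, (j + 1) * ∑ c ∈ Finset.Ioc (b j) k,
    cnt k b (t - 1 - j) (v - (∑ i ∈ Finset.range j, b i + c))

/-- The program increments `j` before the inner loop, so the inner weight is j + 1, the length of
the block. Both sums are formed for every entry, although only the last value of `g` is ever needed.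
-/
theorem blockLoop_spec (hl : Lim n k w M W) {σ : State} (hσ : Ctx n k w σ) {b : ℕ → ℕ}
    (hb : ∀ i < n, 1 ≤ b i ∧ b i ≤ k) (hh : ∀ i < n, σ.h (heapStart + i) = b i)
    (ht1 : 1 ≤ σ.s .t) (ht : σ.s .t ≤ n) (hv : σ.s .v ≤ w)
    (hrow : ∀ t < σ.s .t, ∀ y ≤ w, σ.h (cell n w t y) = cnt k b t y)
    (hj : σ.s .j = 0) (hacc : σ.s .acc = 0) (hg : σ.s .g = 0) (hws : σ.s .ws = 0) :
    Tri M W blockLoop σ (25 * (n * k)) fun σ' =>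
      σ'.s .acc = cnt k b (σ.s .t) (σ.s .v) ∧ σ'.s .g = wcnt k b (σ.s .t) (σ.s .v) := by
  have hrec := cnt_succ hb ht1 ht (σ.s .v)
  set S : ℕ → ℕ := fun j => ∑ c ∈ Finset.Ioc (b j) k,
    cnt k b (σ.s .t - 1 - j) (σ.s .v - (∑ i ∈ Finset.range j, b i + c)) with hS
  -- The plain sum is a number of strings, hence at most k^n; the weighted one then is at most n
  -- k^n.
  have hSle : ∀ i ≤ σ.s .t, ∑ j ∈ Finset.range i, S j ≤ k ^ n := fun i hi =>
    calc ∑ j ∈ Finset.range i, S j ≤ ∑ j ∈ Finset.range (σ.s .t), S j :=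
          Finset.sum_le_sum_of_subset (Finset.range_mono hi)
      _ ≤ k ^ (σ.s .t) := hrec ▸ cnt_le _ _ _ _
      _ ≤ k ^ n := Nat.pow_le_pow_right hl.k_pos ht
  have hGle : ∀ i ≤ σ.s .t, ∑ j ∈ Finset.range i, (j + 1) * S j ≤ n * k ^ n := fun i hi =>
    calc ∑ j ∈ Finset.range i, (j + 1) * S j ≤ ∑ j ∈ Finset.range i, n * S j :=
          Finset.sum_le_sum fun j hj => Nat.mul_le_mul_right _ (by
            have := Finset.mem_range.1 hj; omega)
      _ ≤ n * k ^ n := by rw [← Finset.mul_sum]; exact Nat.mul_le_mul_left _ (hSle i hi)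
  have hW : ∀ i ≤ n, ∑ j ∈ Finset.range i, b j ≤ i * k := fun i hi => by
    have := Finset.sum_le_card_nsmul (Finset.range i) b k fun j hj =>
      (hb j (by have := Finset.mem_range.1 hj; omega)).2
    simpa using this
  have hbig := hl.big
  have hkM := hl.space
  have hMW := hl.word
  have hbig2 : k ^ n + n * k ^ n ≤ W := by nlinarith
  refine (Tri.loop_count (N := σ.s .t) (T := 8 + (10 * k + 2 + 1)) (fun i σ' => σ'.s .j = i ∧
    σ'.s .ws = ∑ j ∈ Finset.range i, b j ∧ σ'.s .acc = ∑ j ∈ Finset.range i, S j ∧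
    σ'.s .g = ∑ j ∈ Finset.range i, (j + 1) * S j)
    ?_ ?_ ?_ ?_).time ?_
  · simp [hj, hacc, hg, hws]
  · rintro i σ' hfr ⟨h1, -⟩ hi
    rw [h1, hfr.scalar .t rfl]
  · rintro i σ' hfr ⟨h1, h2, h3, h4⟩ hi
    have hσ' := hσ.frame hfr rfl
    have e1 := hfr.scalar .t rfl
    have e2 := hfr.scalar .v rfl
    have e3 := hfr.heap rfl
    have e4 := hσ'.one
    have e5 := hσ'.bb
    have e6 := hσ'.ba
    have e7 := hσ'.len
    have hbi := hb i (by omega)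
    have hhi := hh i (by omega)
    have hWk : ∑ j ∈ Finset.range i, b j + k ≤ W := by
      have hWi := hW i (by omega)
      have hik : (i + 1) * k ≤ n * k := Nat.mul_le_mul_right _ (by omega)
      rw [Nat.succ_mul] at hik
      omega
    have hSi := hSle (i + 1) (by omega)
    have hGi := hGle (i + 1) (by omega)
    rw [Finset.sum_range_succ] at hSi hGi
    have e8 : σ.s .t - i - 1 = σ.s .t - 1 - i := by omega
    have hcell := hl.cell_lt (t := σ.s .t - 1 - i) (v := w) (by omega) le_rfl
    have hrowi := hrow (σ.s .t - 1 - i) (by omega)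
    unfold cell at hcell hrowi
    refine Tri.ops_seq ?_ ?_
    · simp [SafeAll, Op.Safe, Op.exec, State.set, h1, e1, e3, e4, e5, e6, e7, e8, hhi]
      omega
    · generalize hτ : execAll _ σ' = τ
      simp only [execAll, Op.exec, State.set] at hτ
      have t1 : τ.s .bj = b i := by simp [← hτ, h1, e3, e5, hhi]
      have t2 : τ.s .c = b i + 1 := by simp [← hτ, h1, e3, e4, e5, hhi]
      have t3 : τ.s .m = heapStart + n + (σ.s .t - 1 - i) * (w + 1) := by
        simp [← hτ, h1, e1, e4, e6, e7, e8, add_comm]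
      have t4 : τ.s .j = i + 1 := by simp [← hτ, h1, e4]
      have t5 : τ.s .ws = ∑ j ∈ Finset.range i, b j := by simp [← hτ, h2]
      have t6 : τ.s .acc = ∑ j ∈ Finset.range i, S j := by simp [← hτ, h3]
      have t7 : τ.s .g = ∑ j ∈ Finset.range i, (j + 1) * S j := by simp [← hτ, h4]
      have t8 : τ.s .v = σ.s .v := by simp [← hτ, e2]
      have t9 : τ.h = σ.h := by simp [← hτ, e3]
      have hτc : Ctx n k w τ := by
        constructor <;> simp [← hτ, hσ'.n_eq, hσ'.k_eq, hσ'.w_eq, hσ'.one, hσ'.two, hσ'.n1,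
          hσ'.k1, hσ'.len, hσ'.bb, hσ'.ba]
      clear hτ
      have hsp := symbolLoop_spec (b := b i) (f := cnt k b (σ.s .t - 1 - i)) hl hτc t2 hbi.2
        (by omega) (by omega) (by omega) (by rw [t3, t9]; exact hrowi) (by rw [t5]; exact hWk)
      simp only [t4, t5, t6, t7, t8] at hsp
      refine Tri.seq (hsp ?_ ?_) ?_
      · exact hSi.trans (by omega)
      · exact hGi.trans (by omega)
      rintro ρ hfρ ⟨r1, r2⟩
      have r3 : ρ.s .bj = b i := (hfρ.scalar .bj rfl).trans t1
      have r4 : ρ.s .ws = _ := (hfρ.scalar .ws rfl).trans t5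
      have r5 : ρ.s .j = _ := (hfρ.scalar .j rfl).trans t4
      refine Tri.ops ?_ ?_
      · simp only [SafeAll, Op.Safe, r3, r4, and_true]
        omega
      · simp [execAll, Op.exec, State.set, r1, r2, r3, r4, r5, Finset.sum_range_succ, hS]
  · rintro σ' - ⟨-, -, h3, h4⟩
    exact ⟨h3.trans hrec.symm, h4⟩
  · have : σ.s .t * (8 + (10 * k + 2 + 1) + 2) ≤ n * (8 + (10 * k + 2 + 1) + 2) :=
      Nat.mul_le_mul_right _ ht
    have := hl.n_pos
    have := hl.k_pos
    nlinarith

end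

end Structured

/-! ### Filling the table and testing suffixes. -/

namespace Structured

open BoundedWeight

section

variable {n k w M W : ℕ}

theorem Ctx.ops {σ : State} (h : Ctx n k w σ) {l : List Op}
    (hp : (Stmt.ops l).keepsConstants = true) : Ctx n k w (execAll l σ) :=
  h.frame (frame_execAll l σ) hp

/-- One row of the table. -/
def rowLoop : Stmt :=
  .loop .v .len (.seq (.ops [.const .acc 0, .const .g 0, .const .ws 0, .const .j 0])
    (.seq blockLoop (.ops [.mul .p .t .len, .add .p .p .v, .add .p .p .ba, .store .p .acc,
      .add .v .v .one])))

/-- `g` is reset for each v, so after the row it holds the value for v = w; the invariant records it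
for the column just finished. The time uses w ≤ nk. -/
theorem rowLoop_spec (hl : Lim n k w M W) {σ : State} (hσ : Ctx n k w σ) {b : ℕ → ℕ}
    (hb : ∀ i < n, 1 ≤ b i ∧ b i ≤ k) (hh : ∀ i < n, σ.h (heapStart + i) = b i)
    (ht1 : 1 ≤ σ.s .t) (ht : σ.s .t ≤ n) (hv : σ.s .v = 0)
    (hrow : ∀ t < σ.s .t, ∀ y ≤ w, σ.h (cell n w t y) = cnt k b t y) :
    Tri M W rowLoop σ (74 * (n * k) ^ 2) fun σ' =>
      (∀ i < n, σ'.h (heapStart + i) = b i) ∧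
      (∀ t < σ.s .t + 1, ∀ y ≤ w, σ'.h (cell n w t y) = cnt k b t y) ∧
      σ'.s .g = wcnt k b (σ.s .t) w := by
  refine (Tri.loop_count (N := w + 1) (T := 4 + (25 * (n * k) + 5)) (fun i σ' => σ'.s .v = i ∧
    (∀ i < n, σ'.h (heapStart + i) = b i) ∧
    (∀ t < σ.s .t, ∀ y ≤ w, σ'.h (cell n w t y) = cnt k b t y) ∧
    (∀ y < i, σ'.h (cell n w (σ.s .t) y) = cnt k b (σ.s .t) y) ∧
    ∀ j, i = j + 1 → σ'.s .g = wcnt k b (σ.s .t) j)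
    ?_ ?_ ?_ ?_).time ?_
  · exact ⟨hv, hh, hrow, by simp, by simp⟩
  · rintro i σ' hfr ⟨h1, -⟩ hi
    rw [h1, (hσ.frame hfr rfl).len]
  · rintro i σ' hfr ⟨h1, h2, h3, h4, -⟩ hi
    have hσ' := hσ.frame hfr rfl
    have e1 := hfr.scalar .t rfl
    refine Tri.ops_seq (by simp [SafeAll, Op.Safe]) ?_
    have hτc : Ctx n k w (execAll [.const .acc 0, .const .g 0, .const .ws 0, .const .j 0] σ') :=
      hσ'.ops rfl
    generalize hτ : execAll _ σ' = τ at hτc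
    simp only [execAll, Op.exec, State.set] at hτ
    have t1 : τ.s .t = σ.s .t := by simp [← hτ, e1]
    have t2 : τ.s .v = i := by simp [← hτ, h1]
    have t3 : τ.h = σ'.h := by simp [← hτ]
    refine Tri.seq (blockLoop_spec hl hτc hb (by rwa [t3]) (by omega) (by omega) (by omega)
      (by rwa [t1, t3]) (by simp [← hτ]) (by simp [← hτ]) (by simp [← hτ]) (by simp [← hτ])) ?_
    clear hτ
    rintro ρ hfρ ⟨r1, r2⟩
    have hρ := hτc.frame hfρ rfl
    have r3 : ρ.s .t = σ.s .t := (hfρ.scalar .t rfl).trans t1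
    have r4 : ρ.s .v = i := (hfρ.scalar .v rfl).trans t2
    have r5 : ρ.h = σ'.h := (hfρ.heap rfl).trans t3
    rw [t1, t2] at r1 r2
    have hcell := hl.cell_lt ht (show i ≤ w by omega)
    have hMW := hl.word
    have hsp := hl.space
    have e2 : σ.s .t * (w + 1) + i + (heapStart + n) = cell n w (σ.s .t) i := by
      unfold cell; ring
    have hc1 : heapStart + n ≤ cell n w (σ.s .t) i := by unfold cell; omega
    refine Tri.ops ?_ ?_
    · simp [SafeAll, Op.Safe, Op.exec, State.set, r3, r4, hρ.len, hρ.ba, hρ.one, e2]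
      have : σ.s .t * (w + 1) + i ≤ cell n w (σ.s .t) i := by omega
      have : i + 1 ≤ M := by
        have : (n + 1) * (w + 1) = n * (w + 1) + (w + 1) := by ring
        omega
      omega
    · simp only [execAll, Op.exec, State.set]
      refine ⟨by simp [r4, hρ.one], fun i' hi' => ?_, fun t' ht' y hy => ?_, fun y hy => ?_,
        fun j hj => ?_⟩
      · have : heapStart + i' ≠ cell n w (σ.s .t) i := by omega
        simp [r3, r4, r5, hρ.len, hρ.ba, e2, this, h2 i' hi']
      · have := (cell_lt (n := n) (w := w) (v := i) ht' hy).ne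
        simp [r3, r4, r5, hρ.len, hρ.ba, e2, this, h3 t' ht' y hy]
      · rcases Nat.lt_succ_iff_lt_or_eq.1 hy with hy | rfl
        · have : cell n w (σ.s .t) y ≠ cell n w (σ.s .t) i := by unfold cell; omega
          simp [r3, r4, r5, hρ.len, hρ.ba, e2, this, h4 y hy]
        · simp [r3, r4, hρ.len, hρ.ba, e2, r1]
      · obtain rfl : i = j := by omega
        simp [r2]
  · rintro σ' - ⟨-, h2, h3, h4, h5⟩
    refine ⟨h2, fun t ht y hy => ?_, h5 w rfl⟩
    rcases Nat.lt_succ_iff_lt_or_eq.1 ht with ht | rfl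
    · exact h3 t ht y hy
    · exact h4 y (by omega)
  · have h1 := hl.w_le
    have h2 : 1 ≤ n * k := Nat.mul_pos hl.n_pos hl.k_pos
    generalize n * k = X at *
    have : (w + 1) * (4 + (25 * X + 5) + 2) ≤ (X + 1) * (4 + (25 * X + 5) + 2) :=
      Nat.mul_le_mul_right _ (by omega)
    nlinarith

/-- The heap holds the string `b` and the first row of the table. -/
structure Heap (n w : ℕ) (b : ℕ → ℕ) (σ : State) : Prop where
  string : ∀ i < n, σ.h (heapStart + i) = b i
  row : ∀ y ≤ w, σ.h (cell n w 0 y) = if y = 0 then 1 else 0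

/-- The counting program. -/
def countProg : Stmt :=
  .seq (.ops [.const .t 1]) (.loop .t .n1 (.seq (.ops [.const .v 0])
    (.seq rowLoop (.ops [.add .t .t .one]))))

/-- Row 0 does not depend on b and is never overwritten, and all other rows are recomputed. So
`Heap` survives and the table can be reused for the next probe. -/
theorem countProg_spec (hl : Lim n k w M W) {σ : State} (hσ : Ctx n k w σ) {b : ℕ → ℕ}
    (hb : ∀ i < n, 1 ≤ b i ∧ b i ≤ k) (hh : Heap n w b σ) :
    Tri M W countProg σ (90 * (n ^ 3 * k ^ 2)) fun σ' =>
      Heap n w b σ' ∧ σ'.s .g = wcnt k b n w := by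
  have hMW := hl.word
  have hsp := hl.space
  have hT : 1 + (n * (1 + (74 * (n * k) ^ 2 + 1) + 2) + 2) ≤ 90 * (n ^ 3 * k ^ 2) := by
    have h1 := hl.n_pos
    have h2 : 1 ≤ (n * k) ^ 2 := Nat.one_le_pow _ _ (Nat.mul_pos hl.n_pos hl.k_pos)
    have h3 : n ^ 3 * k ^ 2 = n * (n * k) ^ 2 := by ring
    rw [h3]
    nlinarith
  refine Tri.time ?_ hT
  refine Tri.ops_seq (l := [.const .t 1]) (by simp [SafeAll, Op.Safe]; omega) ?_
  have hτc : Ctx n k w (execAll [.const .t 1] σ) := hσ.ops rfl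
  generalize hτ : execAll _ σ = τ at hτc
  simp only [execAll, Op.exec, State.set] at hτ
  have t1 : τ.s .t = 1 := by simp [← hτ]
  have t2 : τ.h = σ.h := by simp [← hτ]
  clear hτ
  refine Tri.loop_count (fun i σ' => σ'.s .t = i + 1 ∧
    (∀ i < n, σ'.h (heapStart + i) = b i) ∧
    (∀ t < i + 1, ∀ y ≤ w, σ'.h (cell n w t y) = cnt k b t y) ∧
    ∀ j, i = j + 1 → σ'.s .g = wcnt k b i w) ?_ ?_ ?_ ?_
  · refine ⟨t1, fun i hi => t2 ▸ hh.string i hi, fun t ht y hy => ?_, by simp⟩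
    obtain rfl : t = 0 := by omega
    rw [t2, hh.row y hy, cnt_zero]
  · rintro i σ' hfr ⟨h1, -⟩ hi
    rw [h1, (hτc.frame hfr rfl).n1]; omega
  · rintro i σ' hfr ⟨h1, h2, h3, -⟩ hi
    have hσ' := hτc.frame hfr rfl
    refine Tri.ops_seq (l := [.const .v 0]) (by simp [SafeAll, Op.Safe]) ?_
    have hυc : Ctx n k w (execAll [.const .v 0] σ') := hσ'.ops rfl
    generalize hυ : execAll _ σ' = υ at hυc
    simp only [execAll, Op.exec, State.set] at hυ
    have u1 : υ.s .t = i + 1 := by simp [← hυ, h1]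
    have u2 : υ.h = σ'.h := by simp [← hυ]
    refine Tri.seq (rowLoop_spec hl hυc hb (by rwa [u2]) (by omega) (by omega)
      (by simp [← hυ]) (by rwa [u1, u2])) ?_
    clear hυ
    rw [u1]
    rintro ρ hfρ ⟨r1, r2, r3⟩
    have hρ := hυc.frame hfρ rfl
    have r4 : ρ.s .t = i + 1 := (hfρ.scalar .t rfl).trans u1
    refine Tri.ops (l := [.add .t .t .one]) ?_ ?_
    · simp [SafeAll, Op.Safe, r4, hρ.one]; omega
    · simp only [execAll, Op.exec, State.set]
      refine ⟨by simp [r4, hρ.one], r1, r2, fun j hj => by simp [r3]⟩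
  · rintro σ' - ⟨-, h2, h3, h4⟩
    refine ⟨⟨h2, fun y hy => ?_⟩, h4 (n - 1) (by have := hl.n_pos; omega)⟩
    rw [h3 0 (by omega) y hy, cnt_zero]

/-- Comparison of one suffix with the prefix of the same length. -/
def suffixLoop : Stmt :=
  .loop .q .n (.seq (.ops [.add .p .bb .l, .load .xa .p, .add .p .bb .q, .load .ya .p])
    (.seq (.ite .ya .xa (.ops [.sub .ok .ok .eq, .const .eq 0])
      (.ite .xa .ya (.ops [.const .eq 0]) (.ops [])))
      (.ops [.add .l .l .one, .add .q .q .one])))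

/-- `eq` records that no difference has been met so far, `ok` that no comparison has failed; A is
the verdict on the suffixes treated earlier. -/
theorem suffixLoop_spec (hl : Lim n k w M W) {σ : State} (hσ : Ctx n k w σ) {b : ℕ → ℕ}
    (hh : ∀ i < n, σ.h (heapStart + i) = b i) {d : ℕ} (hd : d ≤ n)
    (h0 : σ.s .l = 0) (hq : σ.s .q = d) (he : σ.s .eq = 1) {A : Prop}
    (hok : σ.s .ok ≤ 1 ∧ (σ.s .ok = 1 ↔ A)) :
    Tri M W suffixLoop σ (14 * n + 2) fun σ' => σ'.s .ok ≤ 1 ∧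
      (σ'.s .ok = 1 ↔ A ∧ ∀ l, d + l < n → (∀ i < l, b (d + i) = b i) → b l ≤ b (d + l)) := by
  have hMW := hl.word
  have hsp := hl.space
  refine (Tri.loop_count (N := n - d) (T := 4 + (2 + 2 + 2 + 2)) (fun i σ' => σ'.s .l = i ∧
    σ'.s .q = d + i ∧ σ'.s .eq ≤ 1 ∧ (σ'.s .eq = 1 ↔ ∀ j < i, b (d + j) = b j) ∧ σ'.s .ok ≤ 1 ∧
    (σ'.s .ok = 1 ↔ A ∧ ∀ l < i, (∀ j < l, b (d + j) = b j) → b l ≤ b (d + l)))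
    ?_ ?_ ?_ ?_).time ?_
  · simp [h0, hq, he, hok.1, hok.2]
  · rintro i σ' hfr ⟨-, h1, -⟩ hi
    rw [h1, (hσ.frame hfr rfl).n_eq]; omega
  · rintro i σ' hfr ⟨h1, h2, h3, h4, h5, h6⟩ hi
    have hσ' := hσ.frame hfr rfl
    have e1 := hfr.heap rfl
    have b1 := hh i (by omega)
    have b2 := hh (d + i) (by omega)
    refine Tri.ops_seq ?_ ?_
    · simp [SafeAll, Op.Safe, Op.exec, State.set, h1, h2, hσ'.bb]
      omega
    have hτc : Ctx n k w (execAll [.add .p .bb .l, .load .xa .p, .add .p .bb .q, .load .ya .p] σ')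
      := hσ'.ops rfl
    generalize hτ : execAll _ σ' = τ at hτc
    simp only [execAll, Op.exec, State.set] at hτ
    have t1 : τ.s .xa = b i := by simp [← hτ, h1, hσ'.bb, e1, b1]
    have t2 : τ.s .ya = b (d + i) := by simp [← hτ, h2, hσ'.bb, e1, b2]
    have t3 : τ.s .l = i := by simp [← hτ, h1]
    have t4 : τ.s .q = d + i := by simp [← hτ, h2]
    have t5 : τ.s .eq = σ'.s .eq := by simp [← hτ]
    have t6 : τ.s .ok = σ'.s .ok := by simp [← hτ]
    clear hτ
    rw [← t5] at h3 h4
    rw [← t6] at h5 h6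
    clear t5 t6
    have hE : (∀ j < i + 1, b (d + j) = b j) ↔ (∀ j < i, b (d + j) = b j) ∧ b (d + i) = b i := by
      constructor
      · exact fun h => ⟨fun j hj => h j (by omega), h i (by omega)⟩
      · rintro ⟨h, h'⟩ j hj
        rcases Nat.lt_succ_iff_lt_or_eq.1 hj with hj | rfl
        · exact h j hj
        · exact h'
    have hO : (∀ l < i + 1, (∀ j < l, b (d + j) = b j) → b l ≤ b (d + l)) ↔
        (∀ l < i, (∀ j < l, b (d + j) = b j) → b l ≤ b (d + l)) ∧
          ((∀ j < i, b (d + j) = b j) → b i ≤ b (d + i)) := by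
      constructor
      · exact fun h => ⟨fun j hj => h j (by omega), h i (by omega)⟩
      · rintro ⟨h, h'⟩ j hj
        rcases Nat.lt_succ_iff_lt_or_eq.1 hj with hj | rfl
        · exact h j hj
        · exact h'
    refine Tri.seq (Q' := fun σ' => σ'.s .eq ≤ 1 ∧ (σ'.s .eq = 1 ↔ ∀ j < i + 1, b (d + j) = b j) ∧
      σ'.s .ok ≤ 1 ∧
      (σ'.s .ok = 1 ↔ A ∧ ∀ l < i + 1, (∀ j < l, b (d + j) = b j) → b l ≤ b (d + l))) ?_ ?_
    · rw [hE, hO]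
      generalize (∀ j < i, b (d + j) = b j) = E at h4 ⊢
      generalize (∀ l < i, (∀ j < l, b (d + j) = b j) → b l ≤ b (d + l)) = O at h6 ⊢
      refine Tri.ite (fun hlt => ?_) fun hlt => Tri.ite (fun hlt' => ?_) fun hlt' => ?_
      · rw [t1, t2] at hlt
        refine (Tri.ops (by simp [SafeAll, Op.Safe]) ?_).time (T := 2) (by simp)
        simp only [execAll, Op.exec, State.set]
        have e1 : b (d + i) ≠ b i := hlt.ne
        have e2 : ¬ b i ≤ b (d + i) := not_le.2 hlt
        -- Subtracting `eq` from `ok` clears `ok` exactly when this is the first difference.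
        by_cases hE : E
        · have := h4.2 hE
          simp [hE, e1, e2, this]; omega
        · have : τ.s .eq = 0 := by have := mt h4.1 hE; omega
          simp [hE, e1, this, h5, h6]
      · rw [t1, t2] at hlt hlt'
        refine (Tri.ops (by simp [SafeAll, Op.Safe]) ?_).time (by simp)
        simp only [execAll, Op.exec, State.set]
        have e1 : b (d + i) ≠ b i := hlt'.ne'
        have e2 : b i ≤ b (d + i) := hlt'.le
        simp [e1, e2, h5, h6]
      · rw [t1, t2] at hlt hlt'
        refine (Tri.ops (by simp [SafeAll]) ?_).time (by simp)
        simp only [execAll]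
        have e1 : b (d + i) = b i := by omega
        simp [e1, h5, h6, h3, h4]
    · rintro ρ hfρ ⟨r1, r2, r3, r4⟩
      have hρ := hτc.frame hfρ rfl
      have r5 : ρ.s .l = i := (hfρ.scalar .l rfl).trans t3
      have r6 : ρ.s .q = d + i := (hfρ.scalar .q rfl).trans t4
      refine Tri.ops (l := [.add .l .l .one, .add .q .q .one]) ?_ ?_
      · simp [SafeAll, Op.Safe, Op.exec, State.set, hρ.one, r5, r6]; omega
      · simp only [execAll, Op.exec, State.set]
        simp only [hρ.one, r5, r6, ne_eq, reduceCtorEq, not_false_eq_true, Function.update_of_ne,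
          Function.update_self]
        exact ⟨trivial, by omega, r1, r2, r3, r4⟩
  · rintro σ' - ⟨-, -, -, -, h5, h6⟩
    refine ⟨h5, h6.trans (and_congr_right fun _ => ?_)⟩
    exact ⟨fun h l hl => h l (by omega), fun h l hl => h l (by omega)⟩
  · have : (n - d) * (4 + (2 + 2 + 2 + 2) + 2) ≤ n * (4 + (2 + 2 + 2 + 2) + 2) :=
      Nat.mul_le_mul_right _ (Nat.sub_le _ _)
    omega

/-- Test whether the string on the heap is at most its suffixes. -/
def checkProg : Stmt :=
  .seq (.ops [.const .ok 1, .const .h 0]) (.loop .h .n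
    (.seq (.ops [.const .eq 1, .const .l 0, .add .q .h .l])
      (.seq suffixLoop (.ops [.add .h .h .one]))))

theorem checkProg_spec (hl : Lim n k w M W) {σ : State} (hσ : Ctx n k w σ) {b : ℕ → ℕ}
    (hh : ∀ i < n, σ.h (heapStart + i) = b i) :
    Tri M W checkProg σ (30 * n ^ 2) fun σ' => σ'.s .ok ≤ 1 ∧ (σ'.s .ok = 1 ↔ IsPre b n) := by
  have hMW := hl.word
  have hsp := hl.space
  refine Tri.time (T := 2 + (n * (3 + (14 * n + 2 + 1) + 2) + 2)) ?_ ?_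
  swap
  · have := hl.n_pos; nlinarith
  refine Tri.ops_seq (l := [.const .ok 1, .const .h 0]) (by simp [SafeAll, Op.Safe]; omega) ?_
  have hτc : Ctx n k w (execAll [.const .ok 1, .const .h 0] σ) := hσ.ops rfl
  generalize hτ : execAll _ σ = τ at hτc
  simp only [execAll, Op.exec, State.set] at hτ
  have t1 : τ.s .ok = 1 := by simp [← hτ]
  have t2 : τ.h = σ.h := by simp [← hτ]
  have t3 : τ.s .h = 0 := by simp [← hτ]
  clear hτ
  refine Tri.loop_count (fun d σ' => σ'.s .h = d ∧ σ'.s .ok ≤ 1 ∧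
    (σ'.s .ok = 1 ↔ ∀ d' < d, ∀ l, d' + l < n → (∀ i < l, b (d' + i) = b i) →
      b l ≤ b (d' + l))) ?_ ?_ ?_ ?_
  · simp [t1, t3]
  · rintro i σ' hfr ⟨h1, -⟩ hi
    rw [h1, (hτc.frame hfr rfl).n_eq]
  · rintro d σ' hfr ⟨h1, h2, h3⟩ hd
    have hσ' := hτc.frame hfr rfl
    have e1 := hfr.heap rfl
    refine Tri.ops_seq (l := [.const .eq 1, .const .l 0, .add .q .h .l])
      (by simp [SafeAll, Op.Safe, Op.exec, State.set, h1]; omega) ?_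
    have hυc : Ctx n k w (execAll [.const .eq 1, .const .l 0, .add .q .h .l] σ') := hσ'.ops rfl
    generalize hυ : execAll _ σ' = υ at hυc
    simp only [execAll, Op.exec, State.set] at hυ
    have u1 : υ.s .h = d := by simp [← hυ, h1]
    have u2 : υ.h = σ.h := by simp [← hυ, e1, t2]
    have u3 : υ.s .ok = σ'.s .ok := by simp [← hυ]
    refine Tri.seq (suffixLoop_spec hl hυc (by rwa [u2]) hd.le (by simp [← hυ])
      (by simp [← hυ, h1]) (by simp [← hυ]) (by rw [u3]; exact ⟨h2, h3⟩)) ?_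
    clear hυ
    rintro ρ hfρ ⟨r1, r2⟩
    have hρ := hυc.frame hfρ rfl
    have r4 : ρ.s .h = d := (hfρ.scalar .h rfl).trans u1
    refine Tri.ops (l := [.add .h .h .one]) ?_ ?_
    · simp [SafeAll, Op.Safe, r4, hρ.one]; omega
    · simp only [execAll, Op.exec, State.set]
      refine ⟨by simp [r4, hρ.one], by simpa using r1, ?_⟩
      simp only [ne_eq, reduceCtorEq, not_false_eq_true, Function.update_of_ne, r2]
      constructor
      · rintro ⟨h, h'⟩ d' hd'
        rcases Nat.lt_succ_iff_lt_or_eq.1 hd' with hd' | rfl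
        · exact h d' hd'
        · exact h'
      · exact fun h => ⟨fun d' hd' => h d' (by omega), h d (by omega)⟩
  · rintro σ' - ⟨-, h2, h3⟩
    refine ⟨h2, h3.trans ⟨fun h d l hl => h d (by omega) l hl, fun h d _ l hl => h d l hl⟩⟩

end

end Structured

/-! ### The unranking program -/

namespace Structured

open BoundedWeight

section

variable {n k w M W : ℕ}

theorem Heap.congr {b b' : ℕ → ℕ} {σ σ' : State} (h : Heap n w b σ) (hb : ∀ i < n, b i = b' i)
    (hσ : σ'.h = σ.h) : Heap n w b' σ' :=
  ⟨fun i hi => by rw [hσ, h.string i hi, hb i hi], fun y hy => by rw [hσ, h.row y hy]⟩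

theorem Heap.store {b b' : ℕ → ℕ} {σ σ' : State} (h : Heap n w b σ) {t v : ℕ} (ht : t < n)
    (hσ : σ'.h = Function.update σ.h (heapStart + t) v) (hb : ∀ i < n, i ≠ t → b i = b' i)
    (hv : b' t = v) : Heap n w b' σ' := by
  refine ⟨fun i hi => ?_, fun y hy => ?_⟩
  · by_cases hit : i = t
    · subst hit; rw [hσ, hv, Function.update_self]
    · rw [hσ, Function.update_of_ne (by omega), h.string i hi, hb i hi hit]
  · rw [hσ, Function.update_of_ne (by unfold cell; omega), h.row y hy]

/-- Fill the string on the heap with a constant. -/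
def fillLoop : Stmt :=
  .loop .q .n (.ops [.add .p .bb .q, .store .p .fill, .add .q .q .one])

theorem fillLoop_spec (hl : Lim n k w M W) {σ : State} (hσ : Ctx n k w σ) {b : ℕ → ℕ}
    (hh : Heap n w b σ) (hq : σ.s .q = 0) :
    Tri M W fillLoop σ (5 * n + 2) fun σ' => Heap n w (fun _ => σ.s .fill) σ' := by
  have hMW := hl.word
  have hsp := hl.space
  refine (Tri.loop_count (N := n) (T := 3) (fun i σ' => σ'.s .q = i ∧
    Heap n w (fun j => if j < i then σ.s .fill else b j) σ') ?_ ?_ ?_ ?_).time (by omega)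
  · exact ⟨hq, by simpa using hh⟩
  · rintro i σ' hfr ⟨h1, -⟩ hi
    rw [h1, (hσ.frame hfr rfl).n_eq]
  · rintro i σ' hfr ⟨h1, h2⟩ hi
    have hσ' := hσ.frame hfr rfl
    have e1 := hfr.scalar .fill rfl
    refine Tri.ops (l := [.add .p .bb .q, .store .p .fill, .add .q .q .one]) ?_ ?_
    · simp [SafeAll, Op.Safe, Op.exec, State.set, h1, hσ'.bb, hσ'.one]; omega
    · simp only [execAll, Op.exec, State.set]
      refine ⟨by simp [h1, hσ'.one], h2.store (t := i) (v := σ.s .fill) hi ?_ ?_ (by simp)⟩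
      · simp [h1, hσ'.bb, e1]
      · intro j hj hne
        have : j < i + 1 ↔ j < i := by omega
        simp [this]
  · rintro σ' - ⟨-, h⟩
    exact h.congr (fun i hi => by simp [hi]) rfl

/-- Binary search for one symbol. -/
def searchLoop : Stmt :=
  .loop .lo1 .hi (.seq (.ops [.add .mid .lo .hi, .div .mid .mid .two, .store .addr .mid])
    (.seq checkProg (.seq countProg (.seq (.ops [.mul .xa .lim .ok])
      (.ite .g .xa (.ops [.mul .hi .mid .one]) (.ops [.mul .lo .mid .one, .add .lo1 .lo .one]))))))

theorem card_aboveStrings_eq_wcnt (hl : Lim n k w M W) {b : ℕ → ℕ}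
    (hb : ∀ i < n, 1 ≤ b i ∧ b i ≤ k) (hpre : IsPre b n) :
    (aboveStrings k n w b).card = wcnt k b n w := card_aboveStrings hb hpre hl.n_pos

/-- Bisection with lo < a_t ≤ hi and hi - lo ≤ 2^m, so m bounds the remaining rounds. Multiplying by
`one` serves as a copy instruction. -/
theorem searchLoop_spec (hl : Lim n k w M W) {σ : State} (hσ : Ctx n k w σ) {R t c : ℕ}
    {a : ℕ → ℕ} (ha : Target k n w R a) (ht : t < n) (hR : R + 1 ≤ W)
    (hh : Heap n w (probe k a t c) σ) (hlim : σ.s .lim = R + 1)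
    (haddr : σ.s .addr = heapStart + t) (hlo : σ.s .lo = 0) (hlo1 : σ.s .lo1 = 1)
    (hhi : σ.s .hi = k) :
    Tri M W searchLoop σ (Nat.clog 2 k * (132 * (n ^ 3 * k ^ 2)) + 2) fun σ' =>
      σ'.s .hi = a t ∧ ∃ c, Heap n w (probe k a t c) σ' := by
  have hMW := hl.word
  have hsp := hl.space
  have hT : 3 + (30 * n ^ 2 + (90 * (n ^ 3 * k ^ 2) + (1 + (2 + 2)))) + 2 ≤
      132 * (n ^ 3 * k ^ 2) := by
    have h1 : 1 ≤ k ^ 2 := Nat.one_le_pow _ _ hl.k_pos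
    have h2 : n ^ 2 ≤ n ^ 3 := Nat.pow_le_pow_right hl.n_pos (by omega)
    have h3 : 1 ≤ n ^ 2 := Nat.one_le_pow _ _ hl.n_pos
    have h4 : n ^ 3 * 1 ≤ n ^ 3 * k ^ 2 := Nat.mul_le_mul_left _ h1
    omega
  refine Tri.time ?_ (Nat.add_le_add_right (Nat.mul_le_mul_left _ hT) 2)
  refine Tri.loop_variant (fun m σ' => σ'.s .lo < a t ∧ a t ≤ σ'.s .hi ∧ σ'.s .hi ≤ k ∧
    σ'.s .lo1 = σ'.s .lo + 1 ∧ σ'.s .hi - σ'.s .lo ≤ 2 ^ m ∧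
    ∃ c, Heap n w (probe k a t c) σ') ?_ ?_ ?_
  · have h1 := ha.symbol t ht
    exact ⟨by omega, by omega, by omega, by omega,
      by rw [hlo, hhi]; exact Nat.le_pow_clog one_lt_two k, c, hh⟩
  · rintro m σ' hfr ⟨h1, h2, h3, h4, h5, c, hc⟩ hlt
    have hσ' := hσ.frame hfr rfl
    have e1 := hfr.scalar .addr rfl
    have e2 := hfr.scalar .lim rfl
    cases m with
    -- The guard lo + 1 < hi is impossible when hi - lo ≤ 1.
    | zero => simp at h5; omega
    | succ m =>
    refine ⟨m, by omega, ?_⟩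
    rw [pow_succ] at h5
    obtain ⟨mid, hmid⟩ : ∃ mid, mid = (σ'.s .lo + σ'.s .hi) / 2 := ⟨_, rfl⟩
    refine Tri.ops_seq ?_ ?_
    · simp [SafeAll, Op.Safe, Op.exec, State.set, e1, haddr]; omega
    have hτc : Ctx n k w
        (execAll [.add .mid .lo .hi, .div .mid .mid .two, .store .addr .mid] σ') := hσ'.ops rfl
    generalize hτ : execAll _ σ' = τ at hτc
    simp only [execAll, Op.exec, State.set] at hτ
    have t1 : τ.s .mid = mid := by simp [← hτ, hmid, hσ'.two]
    have t2 : τ.s .lo = σ'.s .lo := by simp [← hτ]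
    have t3 : τ.s .hi = σ'.s .hi := by simp [← hτ]
    have t4 : τ.s .lo1 = σ'.s .lo1 := by simp [← hτ]
    have t5 : τ.s .lim = R + 1 := by simp [← hτ, e2, hlim]
    have t6 : Heap n w (probe k a t mid) τ := by
      refine hc.store (v := mid) ht ?_ (fun i _ hne => by simp [probe, hne]) (by simp [probe])
      rw [← hτ]
      simp [e1, haddr, hmid, hσ'.two]
    clear hτ
    refine Tri.seq (checkProg_spec hl hτc t6.string) ?_
    rintro υ hfυ ⟨u1, u2⟩
    have hυ := hτc.frame hfυ rfl
    have hsym : ∀ i < n, 1 ≤ probe k a t mid i ∧ probe k a t mid i ≤ k :=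
      ha.symbol_probe hl.k_pos (by omega) (by omega)
    refine Tri.seq (countProg_spec hl hυ hsym (t6.congr (fun _ _ => rfl) (hfυ.heap rfl))) ?_
    rintro ρ hfρ ⟨r1, r2⟩
    have hρ := hυ.frame hfρ rfl
    have r3 : ρ.s .ok = υ.s .ok := hfρ.scalar .ok rfl
    have r4 : ρ.s .mid = mid := by rw [hfρ.scalar .mid rfl, hfυ.scalar .mid rfl, t1]
    have r5 : ρ.s .lo = σ'.s .lo := by rw [hfρ.scalar .lo rfl, hfυ.scalar .lo rfl, t2]
    have r6 : ρ.s .hi = σ'.s .hi := by rw [hfρ.scalar .hi rfl, hfυ.scalar .hi rfl, t3]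
    have r7 : ρ.s .lo1 = σ'.s .lo1 := by rw [hfρ.scalar .lo1 rfl, hfυ.scalar .lo1 rfl, t4]
    have r8 : ρ.s .lim = R + 1 := by rw [hfρ.scalar .lim rfl, hfυ.scalar .lim rfl, t5]
    -- The counting program runs on any probe, but its result has a meaning only under `IsPre`. The
    -- factor `ok` makes the comparison fail otherwise, which is the right answer, since then mid <
    -- a_t.
    have hgood : ρ.s .g < (R + 1) * ρ.s .ok ↔ a t ≤ mid := by
      rw [r2, r3]
      by_cases hle : a t ≤ mid
      · have hp := ha.isPre_probe (t := t) hle (by omega)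
        have := ha.probe_le (t := t) hle
        rw [card_aboveStrings_eq_wcnt hl hsym hp] at this
        rw [u2.2 hp]; omega
      · have hlt := ha.lt_probe ht (not_le.1 hle)
        by_cases hp : IsPre (probe k a t mid) n
        · rw [card_aboveStrings_eq_wcnt hl hsym hp] at hlt
          rw [u2.2 hp]; omega
        · have : υ.s .ok = 0 := by have := mt u2.1 hp; omega
          rw [this]; omega
    have hWR : (R + 1) * ρ.s .ok ≤ W := by
      rcases Nat.le_one_iff_eq_zero_or_eq_one.1 u1 with h | h <;> rw [r3, h] <;> omega
    refine Tri.ops_seq (l := [.mul .xa .lim .ok]) ?_ ?_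
    · simpa [SafeAll, Op.Safe, r8] using hWR
    have hφc : Ctx n k w (execAll [.mul .xa .lim .ok] ρ) := hρ.ops rfl
    generalize hφ : execAll _ ρ = φ at hφc
    simp only [execAll, Op.exec, State.set] at hφ
    have f1 : φ.s .g < φ.s .xa ↔ a t ≤ mid := by rw [← hgood]; simp [← hφ, r8]
    have f4 : φ.s .mid = mid := by simp [← hφ, r4]
    have f5 : φ.s .lo = σ'.s .lo := by simp [← hφ, r5]
    have f6 : φ.s .hi = σ'.s .hi := by simp [← hφ, r6]
    have f7 : φ.s .lo1 = σ'.s .lo1 := by simp [← hφ, r7]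
    have f8 : Heap n w (probe k a t mid) φ := r1.congr (fun _ _ => rfl) (by simp [← hφ])
    clear hφ
    rw [← f1] at hgood
    refine Tri.ite (fun hlt => ?_) fun hlt => ?_
    · refine (Tri.ops ?_ ?_).time (by simp)
      · simp [SafeAll, Op.Safe, f4, hφc.one]; omega
      · have := f1.1 hlt
        simp [execAll, Op.exec, State.set, f4, f5, f7, hφc.one]
        exact ⟨h1, this, by omega, h4, by omega, mid, f8.congr (fun _ _ => rfl) rfl⟩
    · refine (Tri.ops ?_ ?_).time (by simp)
      · simp [SafeAll, Op.Safe, Op.exec, State.set, f4, hφc.one]; omega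
      · have := mt f1.2 hlt
        simp [execAll, Op.exec, State.set, f4, f6, hφc.one]
        exact ⟨by omega, h2, h3, by omega, mid, f8.congr (fun _ _ => rfl) rfl⟩
  · rintro m σ' - ⟨h1, h2, h3, h4, -, h5⟩ hlt
    exact ⟨by omega, h5⟩

/-- Find the least string above which there are fewer than `lim` strings. -/
def findProg : Stmt :=
  .seq (.ops [.const .q 0, .mul .fill .k .one]) (.seq fillLoop (.seq (.ops [.const .i 0])
    (.seq (.loop .i .n (.seq
      (.ops [.const .lo 0, .const .lo1 1, .mul .hi .k .one, .add .addr .bb .i])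
      (.seq searchLoop (.ops [.store .addr .hi, .add .i .i .one])))) countProg)))

/-- Starting from k^n, the symbols of a are fixed from left to right: after i rounds the heap holds
a_0 ... a_{i-1} k ... k. -/
theorem findProg_spec (hl : Lim n k w M W) {σ : State} (hσ : Ctx n k w σ) {R : ℕ}
    {a b : ℕ → ℕ} (ha : Target k n w R a) (hR : R + 1 ≤ W) (hh : Heap n w b σ)
    (hlim : σ.s .lim = R + 1) :
    Tri M W findProg σ (260 * (n ^ 4 * k ^ 2 * (Nat.clog 2 k + 1))) fun σ' =>
      Heap n w a σ' ∧ σ'.s .g = (aboveStrings k n w a).card := by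
  have hMW := hl.word
  have hsp := hl.space
  have hT : 2 + (5 * n + 2 + (1 + (n * (4 + (Nat.clog 2 k * (132 * (n ^ 3 * k ^ 2)) + 2 + 2) + 2)
      + 2 + 90 * (n ^ 3 * k ^ 2)))) ≤ 260 * (n ^ 4 * k ^ 2 * (Nat.clog 2 k + 1)) := by
    have h1 : 1 ≤ n ^ 3 * k ^ 2 :=
      Nat.mul_pos (Nat.one_le_pow _ _ hl.n_pos) (Nat.one_le_pow _ _ hl.k_pos)
    have h2 : n ^ 4 * k ^ 2 * (Nat.clog 2 k + 1) = n * (n ^ 3 * k ^ 2) * Nat.clog 2 k +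
      n * (n ^ 3 * k ^ 2) := by ring
    have h3 := hl.n_pos
    rw [h2]
    generalize n ^ 3 * k ^ 2 = X at *
    have h4 : n * (4 + (Nat.clog 2 k * (132 * X) + 2 + 2) + 2) =
      132 * (n * X * Nat.clog 2 k) + 10 * n := by ring
    have h5 : n ≤ n * X := Nat.le_mul_of_pos_right n h1
    have h6 : X ≤ n * X := Nat.le_mul_of_pos_left X h3
    rw [h4]
    omega
  refine Tri.time ?_ hT
  refine Tri.ops_seq (l := [.const .q 0, .mul .fill .k .one]) ?_ ?_
  · simp [SafeAll, Op.Safe, Op.exec, State.set, hσ.k_eq, hσ.one]; omega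
  have hτc : Ctx n k w (execAll [.const .q 0, .mul .fill .k .one] σ) := hσ.ops rfl
  generalize hτ : execAll _ σ = τ at hτc
  simp only [execAll, Op.exec, State.set] at hτ
  have t1 : τ.s .q = 0 := by simp [← hτ]
  have t2 : τ.s .fill = k := by simp [← hτ, hσ.k_eq, hσ.one]
  have t3 : τ.s .lim = R + 1 := by simp [← hτ, hlim]
  have t4 : Heap n w b τ := hh.congr (fun _ _ => rfl) (by simp [← hτ])
  clear hτ
  refine Tri.seq (fillLoop_spec hl hτc t4 t1) ?_
  rw [t2]
  rintro υ hfυ u1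
  have hυc := hτc.frame hfυ rfl
  have u2 := (hfυ.scalar .lim rfl).trans t3
  refine Tri.ops_seq (l := [.const .i 0]) (by simp [SafeAll, Op.Safe]) ?_
  have hφc : Ctx n k w (execAll [.const .i 0] υ) := hυc.ops rfl
  generalize hφ : execAll _ υ = φ at hφc
  simp only [execAll, Op.exec, State.set] at hφ
  have f1 : φ.s .i = 0 := by simp [← hφ]
  have f2 : φ.s .lim = R + 1 := by simp [← hφ, u2]
  have f3 : Heap n w (fun _ => k) φ := u1.congr (fun _ _ => rfl) (by simp [← hφ])
  clear hφ
  refine Tri.seq (Q' := fun σ' => Heap n w a σ') ?_ ?_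
  · refine Tri.loop_count (fun i σ' => σ'.s .i = i ∧ Heap n w (probe k a i k) σ') ?_ ?_ ?_ ?_
    · exact ⟨f1, f3.congr (fun i _ => by simp [probe]) rfl⟩
    · rintro i σ' hfr ⟨h1, -⟩ hi
      rw [h1, (hφc.frame hfr rfl).n_eq]
    · rintro i σ' hfr ⟨h1, h2⟩ hi
      have hσ' := hφc.frame hfr rfl
      have e2 := (hfr.scalar .lim rfl).trans f2
      refine Tri.ops_seq (l := [.const .lo 0, .const .lo1 1, .mul .hi .k .one, .add .addr .bb .i])
        ?_ ?_
      · simp [SafeAll, Op.Safe, Op.exec, State.set, hσ'.k_eq, hσ'.one, hσ'.bb, h1]; omega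
      have hψc : Ctx n k w (execAll
          [.const .lo 0, .const .lo1 1, .mul .hi .k .one, .add .addr .bb .i] σ') := hσ'.ops rfl
      generalize hψ : execAll _ σ' = ψ at hψc
      simp only [execAll, Op.exec, State.set] at hψ
      have p1 : ψ.s .addr = heapStart + i := by simp [← hψ, hσ'.bb, h1]
      have p2 : ψ.s .i = i := by simp [← hψ, h1]
      refine Tri.seq (searchLoop_spec (c := k) hl hψc ha hi hR (h2.congr (fun _ _ => rfl)
        (by simp [← hψ])) (by simp [← hψ, e2]) p1 (by simp [← hψ]) (by simp [← hψ])
        (by simp [← hψ, hσ'.k_eq, hσ'.one])) ?_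
      clear hψ
      rintro ρ hfρ ⟨r1, c, r2⟩
      have hρ := hψc.frame hfρ rfl
      have r3 := (hfρ.scalar .addr rfl).trans p1
      have r4 := (hfρ.scalar .i rfl).trans p2
      refine Tri.ops (l := [.store .addr .hi, .add .i .i .one]) ?_ ?_
      · simp [SafeAll, Op.Safe, Op.exec, r3, r4, hρ.one]; omega
      · simp only [execAll, Op.exec, State.set]
        refine ⟨by simp [r4, hρ.one], r2.store (t := i) (v := a i) hi ?_ (fun j _ hne => ?_) ?_⟩
        · simp [r1, r3]
        · by_cases hji : j < i
          · simp [probe, hji, show j < i + 1 by omega]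
          · simp [probe, hji, hne, show ¬ j < i + 1 by omega]
        · simp [probe]
    · rintro σ' - ⟨-, h⟩
      exact h.congr (fun i hi => by simp [probe, hi]) rfl
  · rintro ρ hfρ r1
    have hρ := hφc.frame hfρ rfl
    -- The last probe need not have been a, so the count for a is computed afresh.
    refine (countProg_spec hl hρ ha.symbol r1).mono le_rfl ?_
    rintro σ' - ⟨h1, h2⟩
    exact ⟨h1, h2.trans (card_aboveStrings_eq_wcnt hl ha.symbol ha.isPre).symm⟩

/-- Output the string on the heap from position `q` to position `e`. -/
def outputLoop (e : Var) : Stmt :=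
  .loop .q e (.ops [.add .p .bb .q, .load .xa .p, .write .xa, .add .q .q .one])

theorem outputLoop_spec (hl : Lim n k w M W) {σ : State} (hσ : Ctx n k w σ) {b : ℕ → ℕ}
    (hh : Heap n w b σ) {e : Var} (he : e ≠ .q ∧ e ≠ .p ∧ e ≠ .xa) (h1 : σ.s .q ≤ σ.s e)
    (h2 : σ.s e ≤ n) :
    Tri M W (outputLoop e) σ (6 * n + 2) fun σ' =>
      Heap n w b σ' ∧ σ'.out = σ.out ++ seg b (σ.s .q) (σ.s e - σ.s .q) := by
  have hMW := hl.word
  have hsp := hl.space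
  have hT : (σ.s e - σ.s .q) * (4 + 2) + 2 ≤ 6 * n + 2 := by omega
  refine Tri.time ?_ hT
  refine Tri.loop_count (fun i σ' => σ'.s .q = σ.s .q + i ∧ Heap n w b σ' ∧
    σ'.out = σ.out ++ seg b (σ.s .q) i) ?_ ?_ ?_ ?_
  · exact ⟨rfl, hh, by simp [seg, pre]⟩
  · rintro i σ' hfr ⟨h1, -⟩ hi
    rw [h1, hfr.scalar e]
    · omega
    · simp [Stmt.some, Op.assigns, he.1.symm, he.2.1.symm, he.2.2.symm]
  · rintro i σ' hfr ⟨h1, h2, h3⟩ hi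
    have hσ' := hσ.frame hfr rfl
    have hb := h2.string (σ.s .q + i) (by omega)
    refine Tri.ops (l := [.add .p .bb .q, .load .xa .p, .write .xa, .add .q .q .one]) ?_ ?_
    · simp [SafeAll, Op.Safe, Op.exec, State.set, hσ'.bb, hσ'.one, h1]; omega
    · simp only [execAll, Op.exec, State.set]
      refine ⟨by simp [h1, hσ'.one, add_assoc], h2.congr (fun _ _ => rfl) rfl, ?_⟩
      rw [seg_add]
      simp [h1, hσ'.bb, hb, h3, seg, pre]
  · rintro σ' - ⟨-, h⟩
    exact h

end

end Structured

/-! ### The complete program and its resource bounds. -/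

namespace Structured

open BoundedWeight

/-- Initialization of the constants. -/
def setupOps : List Op :=
  [.const .one 1, .const .two 2, .add .n1 .n .one, .add .k1 .k .one, .add .len .w .one,
    .const .bb heapStart, .add .ba .bb .n, .store .ba .one, .const .fill 1, .const .q 0]

/-- Compute the number of heavy strings. -/
def totalProg : Stmt :=
  .seq (.ops setupOps) (.seq fillLoop (.seq countProg (.seq (.ops [.mul .total .g .one])
    (.ite .w .n1 (.ops [.add .total .total .one]) (.ops [])))))

/-- Choose the necklace with which the output continues. -/
def nextProg : Stmt :=
  .seq (.ite .g .one (.ops [.mul .lim .total .one]) (.ops [.mul .lim .g .one]))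
    (.ite .lim .two (.ite .rem .one (.ops [])
      (.ops [.write .k, .sub .rem .rem .one, .mul .lim .total .one])) (.ops []))

/-- The unranking program. -/
def mainProg : Stmt :=
  .seq totalProg (.seq (.ops [.sub .lim .total .r, .add .lim .lim .one]) (.seq findProg
    (.seq (.ops [.sub .m .lim .g, .sub .rem .n .m, .mul .q .rem .one]) (.seq (outputLoop .n)
      (.seq nextProg (.seq findProg (.seq (.ops [.const .q 0]) (outputLoop .rem))))))))

section

variable {n k w M W : ℕ}

theorem card_heavyStrings_le (n k w : ℕ) : (heavyStrings k n w).card ≤ k ^ n := by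
  rw [← card_strings]
  exact Finset.card_filter_le _ _

/-- Implements `card_heavyStrings_eq_one`: the count for 1^n, plus one if w < n + 1. -/
theorem totalProg_spec (hl : Lim n k w M W) (r : ℕ) :
    Tri M W totalProg (initialState n k w r) (120 * (n ^ 3 * k ^ 2)) fun σ' =>
      Ctx n k w σ' ∧ Heap n w (fun _ => 1) σ' ∧ σ'.s .total = (heavyStrings k n w).card ∧
        σ'.s .r = r ∧ σ'.out = [] := by
  have hMW := hl.word
  have hsp := hl.space
  have hns : (n + 1) * (w + 1) = n * (w + 1) + (w + 1) := by ring
  have hT : 10 + (5 * n + 2 + (90 * (n ^ 3 * k ^ 2) + (1 + (1 + 2)))) ≤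
      120 * (n ^ 3 * k ^ 2) := by
    have h1 : n ^ 3 * 1 ≤ n ^ 3 * k ^ 2 := Nat.mul_le_mul_left _ (Nat.one_le_pow _ _ hl.k_pos)
    have h2 : n ≤ n ^ 3 := Nat.le_self_pow (by omega) n
    have := hl.n_pos
    omega
  refine Tri.time ?_ hT
  refine Tri.ops_seq (l := setupOps) ?_ ?_
  · simp [setupOps, SafeAll, Op.Safe, Op.exec, State.set, initialState]
    omega
  generalize hτ : execAll setupOps (initialState n k w r) = τ
  have hτc : Ctx n k w τ := by
    constructor <;> simp [← hτ, setupOps, execAll, Op.exec, State.set, initialState]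
  have t1 : τ.s .q = 0 := by simp [← hτ, setupOps, execAll, Op.exec, State.set]
  have t2 : τ.s .fill = 1 := by simp [← hτ, setupOps, execAll, Op.exec, State.set]
  have t3 : τ.s .r = r := by simp [← hτ, setupOps, execAll, Op.exec, State.set, initialState]
  have t4 : τ.out = [] := by simp [← hτ, setupOps, execAll, Op.exec, State.set, initialState]
  -- The only store sets table cell (0, 0) to 1; the rest of row 0 is correct because memory starts
  -- at zero.
  have t5 : τ.h = Function.update (fun _ => 0) (heapStart + n) 1 := by
    simp [← hτ, setupOps, execAll, Op.exec, State.set, initialState]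
  clear hτ
  have t6 : Heap n w (fun _ => 0) τ := by
    refine ⟨fun i hi => ?_, fun y _ => ?_⟩
    · rw [t5, Function.update_of_ne (by omega)]
    · rw [t5]
      split_ifs with hy
      · subst hy; simp [cell]
      · rw [Function.update_of_ne (by unfold cell; omega)]
  refine Tri.seq (fillLoop_spec hl hτc t6 t1) ?_
  rintro υ hfυ u1
  have hυ := hτc.frame hfυ rfl
  rw [t2] at u1
  have hone : ∀ i < n, 1 ≤ (fun _ : ℕ => 1) i ∧ (fun _ : ℕ => 1) i ≤ k := fun _ _ =>
    ⟨le_rfl, hl.k_pos⟩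
  refine Tri.seq (countProg_spec hl hυ hone u1) ?_
  rintro ρ hfρ ⟨r1, r2⟩
  have hρ := hυ.frame hfρ rfl
  rw [← card_aboveStrings_eq_wcnt hl hone (isPre_one n)] at r2
  have hcard := card_heavyStrings_eq_one (n := n) (w := w) hl.k_pos
  have hle := card_heavyStrings_le n k w
  have hbig := hl.big
  have hkW : k ^ n ≤ W := by nlinarith
  have r3 : ρ.s .r = r := by rw [hfρ.scalar .r rfl, hfυ.scalar .r rfl, t3]
  have r4 : ρ.out = [] := by rw [hfρ.out rfl, hfυ.out rfl, t4]
  refine Tri.ops_seq (l := [.mul .total .g .one]) ?_ ?_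
  · simp [SafeAll, Op.Safe, r2, hρ.one]; omega
  have hφc : Ctx n k w (execAll [.mul .total .g .one] ρ) := hρ.ops rfl
  generalize hφ : execAll _ ρ = φ at hφc
  simp only [execAll, Op.exec, State.set] at hφ
  have f1 : φ.s .total = (aboveStrings k n w fun _ => 1).card := by simp [← hφ, r2, hρ.one]
  have f2 : φ.s .r = r := by simp [← hφ, r3]
  have f3 : φ.out = [] := by simp [← hφ, r4]
  have f4 : Heap n w (fun _ => 1) φ := r1.congr (fun _ _ => rfl) (by simp [← hφ])
  clear hφ
  refine Tri.ite (fun hlt => ?_) fun hlt => ?_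
  · rw [hφc.w_eq, hφc.n1] at hlt
    rw [if_pos (by omega)] at hcard
    refine Tri.ops (l := [.add .total .total .one]) ?_ ?_
    · simp [SafeAll, Op.Safe, f1, hφc.one]; omega
    · refine ⟨hφc.ops rfl, f4.congr (fun _ _ => rfl) rfl, ?_, ?_, f3⟩
      · simp [execAll, Op.exec, State.set, f1, hφc.one, hcard]
      · simp [execAll, Op.exec, State.set, f2]
  · rw [hφc.w_eq, hφc.n1] at hlt
    rw [if_neg (by omega)] at hcard
    refine (Tri.ops (l := []) trivial ?_).time (by simp)
    exact ⟨hφc, f4, by rw [hcard]; exact f1, f2, f3⟩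

/-- `lim` is the target plus one throughout. Target 0 means that k^n comes next: if symbols are
still missing, its single k is output and the search is redirected to the first necklace. -/
theorem nextProg_spec {σ : State} (hσ : Ctx n k w σ) {N : ℕ}
    (hN : 1 ≤ N) (hNW : N ≤ W) (htot : σ.s .total = N) (hg : σ.s .g ≤ N) :
    Tri M W nextProg σ 10 fun σ' =>
      (nextTarget N (σ.s .g) = 0 ∧ 0 < σ.s .rem → σ'.s .lim = N ∧ σ'.s .rem = σ.s .rem - 1 ∧
        σ'.out = σ.out ++ [k]) ∧
      (¬ (nextTarget N (σ.s .g) = 0 ∧ 0 < σ.s .rem) →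
        σ'.s .lim = nextTarget N (σ.s .g) + 1 ∧ σ'.s .rem = σ.s .rem ∧ σ'.out = σ.out) := by
  refine Tri.time (T := 1 + 2 + (3 + 2 + 2)) ?_ le_rfl
  refine Tri.seq (Q' := fun σ' => σ'.s .lim = nextTarget N (σ.s .g) + 1 ∧
    σ'.s .rem = σ.s .rem ∧ σ'.s .total = N ∧ σ'.out = σ.out) ?_ ?_
  · refine Tri.ite (fun hlt => ?_) fun hlt => ?_
    · rw [hσ.one] at hlt
      refine Tri.ops (l := [.mul .lim .total .one]) ?_ ?_
      · simp [SafeAll, Op.Safe, htot, hσ.one]; omega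
      · have h0 : σ.s .g = 0 := by omega
        simp [execAll, Op.exec, State.set, htot, hσ.one, h0, nextTarget]
        omega
    · rw [hσ.one] at hlt
      refine Tri.ops (l := [.mul .lim .g .one]) ?_ ?_
      · simp [SafeAll, Op.Safe, hσ.one]; omega
      · have h0 : σ.s .g ≠ 0 := by omega
        simp [execAll, Op.exec, State.set, htot, hσ.one, h0, nextTarget]
        omega
  · rintro τ hfτ ⟨t1, t2, t3, t4⟩
    have hτ := hσ.frame hfτ rfl
    generalize nextTarget N (σ.s .g) = R at *
    refine Tri.ite (fun hlt => Tri.ite (fun hlt' => ?_) fun hlt' => ?_) fun hlt => ?_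
    · rw [hτ.one, t2] at hlt'
      refine (Tri.ops (l := []) trivial ?_).time (by simp)
      refine ⟨fun h => by omega, fun _ => ⟨t1, t2, t4⟩⟩
    · rw [hτ.one, t2] at hlt'
      rw [hτ.two, t1] at hlt
      refine Tri.ops (l := [.write .k, .sub .rem .rem .one, .mul .lim .total .one]) ?_ ?_
      · simp [SafeAll, Op.Safe, Op.exec, State.set, t3, hτ.one]; omega
      · refine ⟨fun _ => ?_, fun h => absurd ⟨by omega, by omega⟩ h⟩
        simp [execAll, Op.exec, State.set, t2, t3, t4, hτ.one, hτ.k_eq]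
    · rw [hτ.two, t1] at hlt
      refine (Tri.ops (l := []) trivial ?_).time (by simp)
      exact ⟨fun h => by omega, fun _ => ⟨t1, t2, t4⟩⟩

theorem mainProg_spec (hl : Lim n k w M W) {r : ℕ} (h1 : 1 ≤ r)
    (hr : r ≤ (heavyStrings k n w).card) :
    Tri M W mainProg (initialState n k w r) (700 * (n ^ 4 * k ^ 2 * (Nat.clog 2 k + 1)))
      fun σ' => IsRanked k n w r σ'.out := by
  have hMW := hl.word
  have hsp := hl.space
  have hT : 120 * (n ^ 3 * k ^ 2) + (2 + (260 * (n ^ 4 * k ^ 2 * (Nat.clog 2 k + 1)) +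
      (3 + (6 * n + 2 + (10 + (260 * (n ^ 4 * k ^ 2 * (Nat.clog 2 k + 1)) +
        (1 + (6 * n + 2)))))))) ≤ 700 * (n ^ 4 * k ^ 2 * (Nat.clog 2 k + 1)) := by
    have h1 : n ^ 3 * k ^ 2 * 1 ≤ n ^ 3 * k ^ 2 * (n * (Nat.clog 2 k + 1)) :=
      Nat.mul_le_mul_left _ (Nat.mul_pos hl.n_pos (Nat.succ_pos _))
    have h2 : n ^ 3 * k ^ 2 * (n * (Nat.clog 2 k + 1)) =
      n ^ 4 * k ^ 2 * (Nat.clog 2 k + 1) := by ring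
    have h3 : n ≤ n ^ 3 := Nat.le_self_pow (by omega) n
    have h4 : n ^ 3 * 1 ≤ n ^ 3 * k ^ 2 := Nat.mul_le_mul_left _ (Nat.one_le_pow _ _ hl.k_pos)
    have := hl.n_pos
    omega
  have hle := card_heavyStrings_le n k w
  have hbig := hl.big
  have hkW : k ^ n + 2 ≤ W := by nlinarith
  refine Tri.time ?_ hT
  obtain ⟨N, hN⟩ : ∃ N, N = (heavyStrings k n w).card := ⟨_, rfl⟩
  obtain ⟨-, a, -, -, -, -, ha⟩ := exists_target (k := k) (w := w) (R := N - r) hl.n_pos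
    (by omega)
  refine Tri.seq (totalProg_spec hl r) ?_
  rintro τ - ⟨hτ, t1, t2, t3, t4⟩
  rw [← hN] at t2
  refine Tri.ops_seq (l := [.sub .lim .total .r, .add .lim .lim .one]) ?_ ?_
  · simp [SafeAll, Op.Safe, Op.exec, State.set, t2, t3, hτ.one]; omega
  have hυc : Ctx n k w (execAll [.sub .lim .total .r, .add .lim .lim .one] τ) := hτ.ops rfl
  generalize hυ : execAll _ τ = υ at hυc
  simp only [execAll, Op.exec, State.set] at hυ
  have u1 : υ.s .lim = N - r + 1 := by simp [← hυ, t2, t3, hτ.one]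
  have u2 : υ.s .total = N := by simp [← hυ, t2]
  have u3 : υ.out = [] := by simp [← hυ, t4]
  have u4 : Heap n w (fun _ => 1) υ := t1.congr (fun _ _ => rfl) (by simp [← hυ])
  clear hυ
  refine Tri.seq (findProg_spec hl hυc ha (by omega) u4 u1) ?_
  rintro ρ hfρ ⟨r1, r2⟩
  have hρ := hυc.frame hfρ rfl
  have r3 := (hfρ.scalar .lim rfl).trans u1
  have r4 := (hfρ.scalar .total rfl).trans u2
  have r5 := (hfρ.out rfl).trans u3
  obtain ⟨g, hg⟩ : ∃ g, g = (aboveStrings k n w a).card := ⟨_, rfl⟩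
  rw [← hg] at r2
  obtain ⟨i, hi⟩ : ∃ i, i = N - r + 1 - g := ⟨_, rfl⟩
  rw [hN] at ha hi
  rw [hg] at hi
  have hbd := ha.bounds hl.n_pos h1 hr
  have hin : i ≤ n := hi ▸ hbd.2.1
  have hranked := fun a' => ha.isRanked (a' := a') hl.n_pos hl.k_pos h1 hr hi rfl
  rw [← hg, ← hN] at hbd hi hranked
  refine Tri.ops_seq (l := [.sub .m .lim .g, .sub .rem .n .m, .mul .q .rem .one]) ?_ ?_
  · simp [SafeAll, Op.Safe, Op.exec, State.set, r2, r3, hρ.one, hρ.n_eq]; omega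
  have hφc : Ctx n k w (execAll [.sub .m .lim .g, .sub .rem .n .m, .mul .q .rem .one] ρ) :=
    hρ.ops rfl
  generalize hφ : execAll _ ρ = φ at hφc
  simp only [execAll, Op.exec, State.set] at hφ
  have f1 : φ.s .rem = n - i := by simp [← hφ, r2, r3, hρ.n_eq, hi]
  have f2 : φ.s .q = n - i := by simp [← hφ, r2, r3, hρ.n_eq, hρ.one, hi]
  have f3 : φ.s .total = N := by simp [← hφ, r4]
  have f4 : φ.s .g = g := by simp [← hφ, r2]
  have f5 : φ.out = [] := by simp [← hφ, r5]
  have f6 : Heap n w a φ := r1.congr (fun _ _ => rfl) (by simp [← hφ])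
  clear hφ
  refine Tri.seq (outputLoop_spec hl hφc f6 (e := .n) (by simp) (by rw [f2, hφc.n_eq]; omega)
    (by rw [hφc.n_eq])) ?_
  rintro ψ hfψ ⟨p1, p2⟩
  have hψ := hφc.frame hfψ rfl
  rw [f5, f2, hφc.n_eq, List.nil_append, ← drop_pre] at p2
  have p3 := (hfψ.scalar .total rfl).trans f3
  have p4 := (hfψ.scalar .g rfl).trans f4
  have p5 := (hfψ.scalar .rem rfl).trans f1
  refine Tri.seq (nextProg_spec hψ (N := N) (by omega) (by omega) p3 (by omega)) ?_
  rintro χ hfχ hnext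
  have hχ := hψ.frame hfχ rfl
  rw [p2, p4, p5] at hnext
  have hχh : Heap n w a χ := p1.congr (fun _ _ => rfl) (hfχ.heap rfl)
  -- Both outcomes of the choice are brought to one form: a target R and a number m of symbols still
  -- to be copied.
  obtain ⟨R, m, x1, hRN, x2, hm, x4⟩ : ∃ R m, χ.s .lim = R + 1 ∧ R < N ∧ χ.s .rem = m ∧ m ≤ n ∧
      ∀ a', Target k n w R a' → IsRanked k n w r (χ.out ++ pre a' m) := by
    by_cases hc : nextTarget N g = 0 ∧ 0 < n - i
    · obtain ⟨h3, h4, h5⟩ := hnext.1 hc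
      refine ⟨N - 1, n - i - 1, by omega, by omega, h4, by omega, fun a' ha' => ?_⟩
      rw [h5]
      have := (hranked a').1 ⟨hc.1, by omega⟩ ha'
      simpa using this
    · obtain ⟨h3, h4, h5⟩ := hnext.2 hc
      refine ⟨nextTarget N g, n - i, h3, hbd.2.2, h4, by omega, fun a' ha' => ?_⟩
      rw [h5]
      exact (hranked a').2 (fun h => hc ⟨h.1, by omega⟩) ha'
  obtain ⟨-, a', -, -, -, -, ha'⟩ := exists_target (k := k) (w := w) (R := R) hl.n_pos
    (by omega)
  refine Tri.seq (findProg_spec hl hχ ha' (by omega) hχh x1) ?_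
  rintro ω hfω ⟨w1, -⟩
  have hω := hχ.frame hfω rfl
  have w2 := (hfω.scalar .rem rfl).trans x2
  have w3 := hfω.out rfl
  refine Tri.ops_seq (l := [.const .q 0]) (by simp [SafeAll, Op.Safe]) ?_
  have hζc : Ctx n k w (execAll [.const .q 0] ω) := hω.ops rfl
  generalize hζ : execAll _ ω = ζ at hζc
  simp only [execAll, Op.exec, State.set] at hζ
  have z1 : ζ.s .q = 0 := by simp [← hζ]
  have z2 : ζ.s .rem = m := by simp [← hζ, w2]
  have z3 : ζ.out = χ.out := by simp [← hζ, w3]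
  have z4 : Heap n w a' ζ := w1.congr (fun _ _ => rfl) (by simp [← hζ])
  clear hζ
  refine (outputLoop_spec hl hζc z4 (e := .rem) (by simp) (by omega) (by omega)).mono le_rfl ?_
  rintro σ' - ⟨-, h⟩
  rw [h, z1, z2, z3]
  simpa [seg] using x4 a' ha'

/-- An admissible rank forces w ≤ nk. Without this the table width and the input w would be
unbounded in terms of n and k. -/
theorem weight_le_of_nonempty (h : (heavyStrings k n w).Nonempty) : w ≤ n * k := by
  obtain ⟨s, hs⟩ := h
  obtain ⟨⟨hl, hs⟩, hw⟩ := mem_heavyStrings.1 hs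
  have := List.sum_le_card_nsmul s k fun x hx => (hs x hx).2
  rw [hl] at this
  exact hw.trans this

theorem lim_of_two_le (hn : 1 ≤ n) (hk : 2 ≤ k) (hw : w ≤ n * k) :
    Lim n k w (5000 * n ^ 3 * k) (k ^ (5000 * n)) := by
  have hn2 : n < k ^ n := Nat.lt_pow_self (by omega)
  have hk1 : k ^ 1 ≤ k ^ n := Nat.pow_le_pow_right (by omega) hn
  -- The exponents 13, 3 and 1 absorb the constant, n^3 and k, far below the available 5000 n.
  have h13 : 5000 ≤ k ^ (13 * n) :=
    calc 5000 ≤ 2 ^ 13 := by norm_num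
      _ ≤ k ^ 13 := Nat.pow_le_pow_left hk 13
      _ ≤ k ^ (13 * n) := Nat.pow_le_pow_right (by omega) (by omega)
  refine ⟨hn, hw, by omega, ?_, ?_, ?_⟩
  · have h1 : n ≤ n ^ 3 * k := by
      calc n = n ^ 1 * 1 := by ring
        _ ≤ n ^ 3 * k := Nat.mul_le_mul (Nat.pow_le_pow_right hn (by omega)) (by omega)
    have h2 : n ^ 2 * k ≤ n ^ 3 * k :=
      Nat.mul_le_mul_right _ (Nat.pow_le_pow_right hn (by omega))
    have h3 : n * k ≤ n ^ 3 * k := by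
      calc n * k = n ^ 1 * k := by ring
        _ ≤ n ^ 3 * k := Nat.mul_le_mul_right _ (Nat.pow_le_pow_right hn (by omega))
    have h4 : k ≤ n * k := Nat.le_mul_of_pos_left k hn
    have h5 : (n + 1) * (w + 1) ≤ (n + 1) * (n * k + 1) := Nat.mul_le_mul_left _ (by omega)
    have h6 : (n + 1) * (n * k + 1) = n ^ 2 * k + n + n * k + 1 := by ring
    have h7 : 5000 * n ^ 3 * k = 5000 * (n ^ 3 * k) := by ring
    unfold heapStart
    omega
  · calc 5000 * n ^ 3 * k ≤ k ^ (13 * n) * (k ^ n) ^ 3 * k ^ n := by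
          gcongr
          simpa using hk1
      _ = k ^ (17 * n) := by ring
      _ ≤ k ^ (5000 * n) := Nat.pow_le_pow_right (by omega) (by omega)
  · have h2 : 2 ≤ k ^ n := hk.trans (by simpa using hk1)
    calc (n + 2) * (k ^ n + 2) ≤ (k ^ n * k ^ n) * (k ^ n * k ^ n) := by
          refine Nat.mul_le_mul ?_ ?_ <;> nlinarith
      _ = k ^ (4 * n) := by ring
      _ ≤ k ^ (5000 * n) := Nat.pow_le_pow_right (by omega) (by omega)

/-- Rounding costs a factor 3, as the binary logarithm is at least 1, and ln 2 > 1/2 costs a factor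
2. -/
theorem clog_add_one_le_log (hk : 2 ≤ k) : ((Nat.clog 2 k + 1 : ℕ) : ℝ) ≤ 6 * Real.log k := by
  have h1 : Nat.clog 2 k ≤ Nat.log 2 k + 1 :=
    Nat.clog_le_of_le_pow (Nat.lt_pow_succ_log_self one_lt_two k).le
  have h2 : 1 ≤ Nat.log 2 k := Nat.log_pos one_lt_two hk
  have h3 : (Nat.log 2 k : ℝ) * Real.log 2 ≤ Real.log k := by
    rw [← Real.log_pow]
    refine Real.log_le_log (by positivity) ?_
    exact_mod_cast Nat.pow_log_le_self 2 (by omega)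
  have h4 : ((Nat.clog 2 k + 1 : ℕ) : ℝ) ≤ 3 * (Nat.log 2 k : ℝ) := by
    exact_mod_cast (by omega : Nat.clog 2 k + 1 ≤ 3 * Nat.log 2 k)
  have h5 : (0 : ℝ) ≤ Nat.log 2 k := Nat.cast_nonneg _
  have := Real.log_two_gt_d9
  nlinarith

end

end Structured

theorem mainTheorem2 :
    ∃ (P : RAM.Program) (C : ℕ), ∀ n k w r : ℕ, 1 ≤ n → 2 ≤ k →
      1 ≤ r → r ≤ (BoundedWeight.heavyStrings k n w).card →
      ∃ s ∈ BoundedWeight.heavyStrings k n w,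
        BoundedWeight.HasRank (BoundedWeight.cycle k n w) s r ∧
        RAM.ComputesWithin P [n, k, w, r] s
          ((C : ℝ) * (n : ℝ) ^ 4 * (k : ℝ) ^ 2 * Real.log k)
          (C * n ^ 3 * k)
          (k ^ (C * n)) := by
  refine ⟨Structured.mainProg.code 0, 5000, fun n k w r hn hk h1 hr => ?_⟩
  have hw := Structured.weight_le_of_nonempty (Finset.card_pos.1 (h1.trans hr))
  have hl := Structured.lim_of_two_le hn hk hw
  obtain ⟨t, ht, σ, he, hs, hrank⟩ := Structured.mainProg_spec hl h1 hr
  have hsp := hl.space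
  have hword := hl.word
  have hbig := hl.big
  have hle := Structured.card_heavyStrings_le n k w
  have hns : (n + 1) * (w + 1) = n * (w + 1) + (w + 1) := by ring
  refine ⟨σ.out, hs, hrank, he.computesWithin (by omega) (by omega) (by omega) (by omega)
    (by nlinarith) ?_⟩
  have hlog := Structured.clog_add_one_le_log hk
  have hlog0 : 0 ≤ Real.log k := Real.log_nonneg (by exact_mod_cast (by omega : 1 ≤ k))
  calc (t : ℝ) ≤ ((700 * (n ^ 4 * k ^ 2 * (Nat.clog 2 k + 1)) : ℕ) : ℝ) := by exact_mod_cast ht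
    _ = 700 * ((n : ℝ) ^ 4 * (k : ℝ) ^ 2 * ((Nat.clog 2 k + 1 : ℕ) : ℝ)) := by push_cast; ring
    -- 700 · 6 = 4200, which fits under the constant 5000.
    _ ≤ 700 * ((n : ℝ) ^ 4 * (k : ℝ) ^ 2 * (6 * Real.log k)) := by gcongr
    _ = 4200 * ((n : ℝ) ^ 4 * (k : ℝ) ^ 2 * Real.log k) := by ring
    _ ≤ 5000 * ((n : ℝ) ^ 4 * (k : ℝ) ^ 2 * Real.log k) := by gcongr; norm_num
    _ = ((5000 : ℕ) : ℝ) * (n : ℝ) ^ 4 * (k : ℝ) ^ 2 * Real.log k := by push_cast; ring
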